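/- Let $(M,g)$ be a compact $C^\infty$ Riemannian manifold of dimension $n$ without boundary (not necessarily connected), and let $\Delta f = \frac{1}{\sqrt g}\sum_{i,j=1}^n \partial_i\bigl(g^{ij}\sqrt g\,\partial_j f\bigr)$ be its (negative) Laplacian. Let $dV$ be the Riemannian volume measure ($\sqrt g\,dx$ in local coordinates), and let $dS=\mathcal H^{n-1}$ be the Riemannian surface measure on hypersurfaces, i.e. the $(n-1)$-dimensional Hausdorff measure of the Riemannian distance, normalized so as to agree with Lebesgue measure on $\mathbb R^{n-1}$. Let $\lambda\in\mathbb R$ and let $\varphi_\lambda\in C^2(M)$ be a real-valued eigenfunction, $\Delta\varphi_\lambda=-\lambda^2\varphi_\lambda$ (no normalization is needed), with nodal set $\mathcal N_{\varphi_\lambda}=\{x\in M:\varphi_\lambda(x)=0\}$; it is not assumed that $0$ is a regular value. Then for every real-valued $f\in C^2(M)$ the functions $|\varphi_\lambda|(\Delta+\lambda^2)f$ and $|\nabla\varphi_\lambda|\,f$ are integrable on $(M,dV)$ and on $(\mathcal N_{\varphi_\lambda},dS)$ respectively, and $$\int_M |\varphi_\lambda|\,(\Delta+\lambda^2)f\,dV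 \;=\; 2\int_{\mathcal N_{\varphi_\lambda}} |\nabla\varphi_\lambda|\,f\,dS .$$ In particular (for $f\equiv 1$), $|\varphi_\lambda|$ is integrable on $(M,dV)$, $|\nabla\varphi_\lambda|$ is integrable on $(\mathcal N_{\varphi_\lambda},dS)$, and $$\lambda^2\int_M|\varphi_\lambda|\,dV \;=\; 2\int_{\mathcal N_{\varphi_\lambda}}|\nabla\varphi_\lambda|\,dS .$$ -/

import Mathlib

open MeasureTheory Bundle
open scoped Manifold ContDiff

noncomputable section

namespace RiemannianNodal

section Coordinates

variable {n : ℕ} {M : Type*} [TopologicalSpace M] [ChartedSpace (EuclideanSpace ℝ (Fin n)) M]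

/-- The partial derivative `∂F/∂y_i` of a function on `ℝⁿ`. -/
def partialDeriv (i : Fin n) (F : EuclideanSpace ℝ (Fin n) → ℝ)
    (y : EuclideanSpace ℝ (Fin n)) : ℝ :=
  fderiv ℝ F y (EuclideanSpace.single i 1)

/-- The coordinate vector `∂/∂y_i` of the chart around `x₀`, at the point with coordinates `y`. -/
def coordVector (x₀ : M) (y : EuclideanSpace ℝ (Fin n)) (i : Fin n) :
    TangentSpace (𝓡 n) ((extChartAt (𝓡 n) x₀).symm y) :=
  mfderiv 𝓘(ℝ, EuclideanSpace ℝ (Fin n)) (𝓡 n) (extChartAt (𝓡 n) x₀).symm y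
    (EuclideanSpace.single i (1 : ℝ))

variable [RiemannianBundle (fun x : M ↦ TangentSpace (𝓡 n) x)]

/-- The matrix `(g_{ij})` of the Riemannian metric in the chart around `x₀`, as a function of the
coordinates `y`. -/
def metricMatrix (x₀ : M) (y : EuclideanSpace ℝ (Fin n)) : Matrix (Fin n) (Fin n) ℝ :=
  Matrix.of fun i j ↦ inner ℝ (coordVector x₀ y i) (coordVector x₀ y j)

/-- The density `√g = √(det (g_{ij}))` in the chart around `x₀`. -/
def volumeDensity (x₀ : M) (y : EuclideanSpace ℝ (Fin n)) : ℝ :=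
  √(metricMatrix x₀ y).det

/-- The (negative) Laplace–Beltrami operator
`Δ f = (1 / √g) ∑ᵢⱼ ∂ᵢ (g^{ij} √g ∂ⱼ f)`, computed at `x` in the chart around `x`. -/
def laplacian (n : ℕ) {M : Type*} [TopologicalSpace M]
    [ChartedSpace (EuclideanSpace ℝ (Fin n)) M]
    [RiemannianBundle (fun x : M ↦ TangentSpace (𝓡 n) x)] (f : M → ℝ) (x : M) : ℝ :=
  (volumeDensity x (extChartAt (𝓡 n) x x))⁻¹ *
    ∑ i : Fin n, ∑ j : Fin n,
      partialDeriv i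
        (fun y ↦ (metricMatrix x y)⁻¹ i j * volumeDensity x y *
          partialDeriv j (f ∘ (extChartAt (𝓡 n) x).symm) y)
        (extChartAt (𝓡 n) x x)

instance completeSpace_tangentSpace (x : M) : CompleteSpace (TangentSpace (𝓡 n) x) :=
  haveI : FiniteDimensional ℝ (TangentSpace (𝓡 n) x) :=
    inferInstanceAs (FiniteDimensional ℝ (EuclideanSpace ℝ (Fin n)))
  FiniteDimensional.complete ℝ _

/-- The Riemannian gradient `∇φ(x) ∈ T_x M`, defined by `⟪∇φ(x), v⟫ = dφ_x(v)`. -/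
def grad (n : ℕ) {M : Type*} [TopologicalSpace M]
    [ChartedSpace (EuclideanSpace ℝ (Fin n)) M]
    [RiemannianBundle (fun x : M ↦ TangentSpace (𝓡 n) x)] (φ : M → ℝ) (x : M) :
    TangentSpace (𝓡 n) x :=
  (InnerProductSpace.toDual ℝ (TangentSpace (𝓡 n) x)).symm
    (mfderiv (𝓡 n) 𝓘(ℝ, ℝ) φ x : TangentSpace (𝓡 n) x →L[ℝ] ℝ)

theorem inner_grad (φ : M → ℝ) (x : M) (v : TangentSpace (𝓡 n) x) :
    inner ℝ (grad n φ x) v = (mfderiv (𝓡 n) 𝓘(ℝ, ℝ) φ x v : ℝ) :=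
  InnerProductSpace.toDual_symm_apply

/-- The Riemannian volume measure `dV_g`, given in every chart by `√g dy`. The local measures
coincide where two charts overlap, and their supremum is the measure glued from them. -/
def volumeMeasure (n : ℕ) (M : Type*) [TopologicalSpace M]
    [ChartedSpace (EuclideanSpace ℝ (Fin n)) M]
    [RiemannianBundle (fun x : M ↦ TangentSpace (𝓡 n) x)] [MeasurableSpace M] : Measure M :=
  ⨆ x₀ : M, Measure.map (extChartAt (𝓡 n) x₀).symm
    ((volume.restrict (extChartAt (𝓡 n) x₀).target).withDensity
      fun y ↦ ENNReal.ofReal (volumeDensity x₀ y))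

end Coordinates

/-- The nodal set `N_φ = {x | φ x = 0}`. -/
def nodalSet {M : Type*} (φ : M → ℝ) : Set M := {x | φ x = 0}

/-- The Riemannian surface measure `dS = ℋ^{n-1}` on hypersurfaces of an `n`-dimensional
Riemannian manifold: the `(n-1)`-dimensional Hausdorff measure of the Riemannian distance,
normalized so that it is Lebesgue measure on `ℝ^{n-1}`. -/
def surfaceMeasure (n : ℕ) (M : Type*) [EMetricSpace M] [MeasurableSpace M] [BorelSpace M] :
    Measure M :=
  Measure.euclideanHausdorffMeasure (n - 1)

end RiemannianNodal

end

/-!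
For a function `φ` of class `C²` and a test function `η` of class `C¹`, consider the *flux*
`L(η) = -½ ∫ sgn φ · div (η ∇φ) dV` (`nodalFlux`). Formally the divergence theorem on the two sets
`{φ > 0}` and `{φ < 0}`, whose outer normals along the nodal set are `∓∇φ / |∇φ|`, turns it into the
integral of `η |∇φ|` over the nodal set. On the other hand, if `Δφ = -λ² φ` and `η = f` is of class
`C²`, then `2 L(f) = ∫ |φ| (Δ + λ²) f dV` by Green's formula (`integral_abs_mul_laplacian_add`).
So the theorem follows once `L(η)` is identified with the nodal integral for all `η ≥ 0`
(`nodalIntegral_eq`); test functions of variable sign are differences of nonnegative ones.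

Green's formula (`integral_mul_laplacian`) is integration by parts in charts and a partition of
unity. Applied to the test function `arctan (a φ) η`, it shows that `π L(η)` is the limit, as
`a → ∞`, of the integrals of `a / (1 + (a φ)²) · η |∇φ|²`, which concentrate on the nodal set
(`tendsto_integral_cauchy_mul_norm_grad_sq`).

No implicit function theorem for hypersurfaces and no area formula on manifolds is used to relate
this limit to the Hausdorff measure. Instead, around a point where `∇φ ≠ 0` and for every `K > 1`
there is a chart which has `φ / c` as its first coordinate and which preserves distances, volumes
and the size of `∇φ` up to factors of `K` (`exists_isAlmostIsometricChart`). In such a chart the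
limit above is computed by an approximation of the identity on Euclidean space
(`tendsto_integral_cauchy_mul`), and the surface measure is compared with Lebesgue measure on a
hyperplane by the behaviour of Hausdorff measures under Lipschitz maps. Both sides thus agree up to
a power of `K`; a partition of unity makes this global, and `K → 1` gives equality as long as `η`
vanishes near the singular set `{φ = 0, ∇φ = 0}` (`nodalIntegral_eq_of_regular`).

The singular set is removed by cutoffs in terms of `q = |∇φ|² + φ²`. The derivative of `q` along
`∇φ` is `O(q)` (`isBigO_inner_grad_jetNormSq`), because `q` is quadratic in the 1-jet of `φ`.
Hence the cutoffs `χ(k q)` have bounded derivatives along `∇φ`, and dominated convergence shows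
that they do not affect the flux in the limit (`tendsto_nodalFlux_cutoff`); the measure or dimension
of the singular set never enters.
-/

noncomputable section

namespace RiemannianNodal

open Set Filter Topology Manifold Asymptotics
open scoped ENNReal NNReal

set_option linter.unusedSectionVars false

/-! ### Charts and the metric in coordinates -/

section
variable {n : ℕ} {M : Type*} [TopologicalSpace M] [ChartedSpace (EuclideanSpace ℝ (Fin n)) M]

/-- The differential of the inverse of the chart around `x₀`. -/
def chartDeriv (x₀ : M) (y : EuclideanSpace ℝ (Fin n)) :
    EuclideanSpace ℝ (Fin n) →L[ℝ] TangentSpace (𝓡 n) ((extChartAt (𝓡 n) x₀).symm y) :=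
  mfderiv 𝓘(ℝ, EuclideanSpace ℝ (Fin n)) (𝓡 n) (extChartAt (𝓡 n) x₀).symm y

lemma coordVector_eq (x₀ : M) (y : EuclideanSpace ℝ (Fin n)) (i : Fin n) :
    coordVector x₀ y i = chartDeriv x₀ y (EuclideanSpace.single i 1) := rfl

variable [IsManifold (𝓡 n) ∞ M]

lemma chartDeriv_injective {x₀ : M} {y : EuclideanSpace ℝ (Fin n)}
    (hy : y ∈ (extChartAt (𝓡 n) x₀).target) : Function.Injective (chartDeriv x₀ y) := by
  have := isInvertible_mfderivWithin_extChartAt_symm (I := 𝓡 n) hy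
  simp only [modelWithCornersSelf_coe, range_id, mfderivWithin_univ] at this
  exact this.injective

lemma contMDiffOn_symm (x₀ : M) : ContMDiffOn 𝓘(ℝ, EuclideanSpace ℝ (Fin n)) (𝓡 n) ∞
    (extChartAt (𝓡 n) x₀).symm
   (extChartAt (𝓡 n) x₀).target := contMDiffOn_extChartAt_symm x₀

lemma mdifferentiableAt_symm {x₀ : M} {y : EuclideanSpace ℝ (Fin n)}
    (hy : y ∈ (extChartAt (𝓡 n) x₀).target) :
    MDifferentiableAt 𝓘(ℝ, EuclideanSpace ℝ (Fin n)) (𝓡 n) (extChartAt (𝓡 n) x₀).symm y :=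
  ((contMDiffOn_symm x₀).contMDiffAt ((isOpen_extChartAt_target x₀).mem_nhds hy)).mdifferentiableAt
    (by simp)

lemma mfderiv_chartDeriv {x₀ : M} {y : EuclideanSpace ℝ (Fin n)}
    (hy : y ∈ (extChartAt (𝓡 n) x₀).target) {f : M → ℝ}
    (hf : MDifferentiableAt (𝓡 n) 𝓘(ℝ, ℝ) f ((extChartAt (𝓡 n) x₀).symm y))
      (v : EuclideanSpace ℝ (Fin n)) :
    (mfderiv (𝓡 n) 𝓘(ℝ, ℝ) f ((extChartAt (𝓡 n) x₀).symm y) (chartDeriv x₀ y v) : ℝ) =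
      fderiv ℝ (f ∘ (extChartAt (𝓡 n) x₀).symm) y v := by
  rw [← mfderiv_eq_fderiv, mfderiv_comp y hf (mdifferentiableAt_symm hy)]
  rfl

instance finiteDimensional_tangentSpace (x : M) : FiniteDimensional ℝ (TangentSpace (𝓡 n) x) :=
  inferInstanceAs (FiniteDimensional ℝ (EuclideanSpace ℝ (Fin n)))

lemma finrank_tangentSpace (x : M) : Module.finrank ℝ (TangentSpace (𝓡 n) x) = n :=
  finrank_euclideanSpace_fin (𝕜 := ℝ) (n := n)

variable [RiemannianBundle (fun x : M ↦ TangentSpace (𝓡 n) x)]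

/-- The metric in coordinates. -/
lemma inner_chartDeriv (x₀ : M) (y v w : EuclideanSpace ℝ (Fin n)) :
    inner ℝ (chartDeriv x₀ y v) (chartDeriv x₀ y w) =
      ∑ i, ∑ j, v i * w j * metricMatrix x₀ y i j := by
  have hv : ∀ v : EuclideanSpace ℝ (Fin n), chartDeriv x₀ y v = ∑ i, v i • coordVector x₀ y i := by
    intro v
    conv_lhs => rw [← (EuclideanSpace.basisFun (Fin n) ℝ).sum_repr v]
    refine (map_sum (chartDeriv x₀ y) _ _).trans (Finset.sum_congr rfl fun i _ ↦ ?_)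
    rw [map_smul, EuclideanSpace.basisFun_apply, EuclideanSpace.basisFun_repr, coordVector_eq]
  rw [hv v, hv w, sum_inner]
  simp_rw [inner_sum, inner_smul_left, inner_smul_right, metricMatrix, Matrix.of_apply]
  simp [mul_assoc]

variable
    [IsContMDiffRiemannianBundle (𝓡 n) ∞ (EuclideanSpace ℝ (Fin n))
      (fun x : M ↦ TangentSpace (𝓡 n) x)]

lemma contDiffOn_metricMatrix (x₀ : M) (i j : Fin n) :
    ContDiffOn ℝ ∞ (fun y ↦ metricMatrix x₀ y i j) (extChartAt (𝓡 n) x₀).target := by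
  have key : ∀ i : Fin n, ContMDiffOn 𝓘(ℝ, EuclideanSpace ℝ (Fin n))
    ((𝓡 n).prod 𝓘(ℝ, EuclideanSpace ℝ (Fin n))) ∞
     (fun y ↦ (⟨(extChartAt (𝓡 n) x₀).symm y, coordVector x₀ y i⟩ :
       TotalSpace (EuclideanSpace ℝ (Fin n)) (fun x : M ↦ TangentSpace (𝓡 n) x)))
     (extChartAt (𝓡 n) x₀).target := by
    intro i
    have h1 := (contMDiffOn_symm (n := n) x₀).contMDiffOn_tangentMapWithin (m := ∞) (by simp)
      (isOpen_extChartAt_target x₀).uniqueMDiffOn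
    have h2 : ContMDiffOn 𝓘(ℝ, EuclideanSpace ℝ (Fin n))
      (𝓘(ℝ, EuclideanSpace ℝ (Fin n)).prod 𝓘(ℝ, EuclideanSpace ℝ (Fin n))) ∞
      (fun y ↦ (⟨y, EuclideanSpace.single i (1:ℝ)⟩ :
        TotalSpace (EuclideanSpace ℝ (Fin n))
        (fun x : EuclideanSpace ℝ (Fin n) ↦ TangentSpace 𝓘(ℝ, EuclideanSpace ℝ (Fin n)) x)))
        (extChartAt (𝓡 n) x₀).target := by
      intro y hy
      rw [contMDiffWithinAt_totalSpace]
      refine ⟨contMDiffWithinAt_id, ?_⟩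
      simpa using contMDiffWithinAt_const
    refine (h1.comp h2 (fun y hy ↦ hy)).congr fun y hy ↦ ?_
    simp only [Function.comp, tangentMapWithin, coordVector]
    rw [mfderivWithin_of_isOpen (isOpen_extChartAt_target x₀) hy]
  exact (ContMDiffOn.inner_bundle (key i) (key j)).contDiffOn

lemma linearIndependent_coordVector {x₀ : M} {y : EuclideanSpace ℝ (Fin n)}
    (hy : y ∈ (extChartAt (𝓡 n) x₀).target) : LinearIndependent ℝ (coordVector x₀ y) := by
  have h := (EuclideanSpace.basisFun (Fin n) ℝ).toBasis.linearIndependent.map'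
    (chartDeriv x₀ y).toLinearMap (LinearMap.ker_eq_bot.2 (chartDeriv_injective hy))
  have he : coordVector x₀ y =
      (chartDeriv x₀ y).toLinearMap ∘ (EuclideanSpace.basisFun (Fin n) ℝ).toBasis := by
    ext i : 1
    rw [coordVector_eq, Function.comp_apply, OrthonormalBasis.coe_toBasis,
      EuclideanSpace.basisFun_apply]
    rfl
  rw [he]
  exact h

lemma metricMatrix_posDef {x₀ : M} {y : EuclideanSpace ℝ (Fin n)}
    (hy : y ∈ (extChartAt (𝓡 n) x₀).target) : (metricMatrix x₀ y).PosDef :=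
  Matrix.posDef_gram_of_linearIndependent (linearIndependent_coordVector hy)

lemma det_metricMatrix_pos {x₀ : M} {y : EuclideanSpace ℝ (Fin n)}
    (hy : y ∈ (extChartAt (𝓡 n) x₀).target) : 0 < (metricMatrix x₀ y).det :=
  (metricMatrix_posDef hy).det_pos

lemma volumeDensity_pos {x₀ : M} {y : EuclideanSpace ℝ (Fin n)}
    (hy : y ∈ (extChartAt (𝓡 n) x₀).target) : 0 < volumeDensity x₀ y :=
  Real.sqrt_pos.2 (det_metricMatrix_pos hy)

/-- The formula `⟪∇f, ∇h⟫ = ∑ᵢⱼ g^{ij} ∂ⱼh ∂ᵢf`, valid in every chart and not only in the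
preferred one. -/
lemma inner_grad_grad {x₀ : M} {y : EuclideanSpace ℝ (Fin n)}
    (hy : y ∈ (extChartAt (𝓡 n) x₀).target) {f h : M → ℝ}
    (hf : MDifferentiableAt (𝓡 n) 𝓘(ℝ, ℝ) f ((extChartAt (𝓡 n) x₀).symm y))
    (hh : MDifferentiableAt (𝓡 n) 𝓘(ℝ, ℝ) h ((extChartAt (𝓡 n) x₀).symm y)) :
    inner ℝ (grad n f ((extChartAt (𝓡 n) x₀).symm y)) (grad n h ((extChartAt (𝓡 n) x₀).symm y)) =
      ∑ i, ∑ j, (metricMatrix x₀ y)⁻¹ i j * partialDeriv j (h ∘ (extChartAt (𝓡 n) x₀).symm) y *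
        partialDeriv i (f ∘ (extChartAt (𝓡 n) x₀).symm) y := by
  set b := basisOfLinearIndependentOfCardEqFinrank' (coordVector x₀ y)
    (linearIndependent_coordVector hy)
    ((Fintype.card_fin n).trans (finrank_tangentSpace _).symm) with hb
  have hbi : ∀ i, b i = coordVector x₀ y i := fun i ↦
    congrFun (coe_basisOfLinearIndependentOfCardEqFinrank' _ _ _) i
  set G := metricMatrix x₀ y with hG
  have hpf : ∀ (f : M → ℝ) (hf : MDifferentiableAt (𝓡 n) 𝓘(ℝ, ℝ) f ((extChartAt (𝓡 n) x₀).symm y))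
    i,
      inner ℝ (grad n f ((extChartAt (𝓡 n) x₀).symm y)) (coordVector x₀ y i) =
        partialDeriv i (f ∘ (extChartAt (𝓡 n) x₀).symm) y := by
    intro f hf i
    rw [inner_grad, coordVector_eq, mfderiv_chartDeriv hy hf, partialDeriv]
  -- the coordinates of the gradient solve `G a = dh`
  set a : Fin n → ℝ := fun i ↦ b.repr (grad n h ((extChartAt (𝓡 n) x₀).symm y)) i with ha
  have hsum : grad n h ((extChartAt (𝓡 n) x₀).symm y) = ∑ i, a i • coordVector x₀ y i := by
    exact (b.sum_repr _).symm.trans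
      (Finset.sum_congr rfl fun i _ ↦ congrArg (fun v ↦ a i • v) (hbi i))
  have hGa : G.mulVec a = fun i ↦ partialDeriv i (h ∘ (extChartAt (𝓡 n) x₀).symm) y := by
    ext i
    rw [← hpf h hh, hsum, sum_inner, Matrix.mulVec, dotProduct]
    refine Finset.sum_congr rfl fun j _ ↦ ?_
    rw [inner_smul_left, real_inner_comm, hG, metricMatrix, Matrix.of_apply]
    simp [mul_comm]
  have ha' : a = G⁻¹.mulVec (fun i ↦ partialDeriv i (h ∘ (extChartAt (𝓡 n) x₀).symm) y) := by
    rw [← hGa, Matrix.mulVec_mulVec, Matrix.nonsing_inv_mul _ (det_metricMatrix_pos hy).ne'.isUnit,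
      Matrix.one_mulVec]
  rw [hsum, inner_sum]
  refine Finset.sum_congr rfl fun i _ ↦ ?_
  rw [inner_smul_right, hpf f hf, ha', Matrix.mulVec, dotProduct, Finset.sum_mul]

end

section
variable {n : ℕ} {M : Type*} [TopologicalSpace M] [ChartedSpace (EuclideanSpace ℝ (Fin n)) M]
  [IsManifold (𝓡 n) ∞ M]
 [RiemannianBundle (fun x : M ↦ TangentSpace (𝓡 n) x)]
    [IsContMDiffRiemannianBundle (𝓡 n) ∞ (EuclideanSpace ℝ (Fin n))
      (fun x : M ↦ TangentSpace (𝓡 n) x)]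

lemma contDiffOn_det_metricMatrix (x₀ : M) :
    ContDiffOn ℝ ∞ (fun y ↦ (metricMatrix x₀ y).det) (extChartAt (𝓡 n) x₀).target := by
  simp_rw [Matrix.det_apply]
  refine ContDiffOn.sum fun σ _ ↦ ContDiffOn.const_smul _ (contDiffOn_prod fun i _ ↦ ?_)
  exact contDiffOn_metricMatrix x₀ _ _

lemma contDiffOn_volumeDensity (x₀ : M) :
    ContDiffOn ℝ ∞ (volumeDensity (n := n) x₀) (extChartAt (𝓡 n) x₀).target :=
  (contDiffOn_det_metricMatrix x₀).sqrt fun _ hy ↦ (det_metricMatrix_pos hy).ne'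

lemma contDiffOn_metricMatrix_inv (x₀ : M) (i j : Fin n) :
    ContDiffOn ℝ ∞ (fun y ↦ (metricMatrix x₀ y)⁻¹ i j) (extChartAt (𝓡 n) x₀).target := by
  simp_rw [Matrix.inv_def, Matrix.smul_apply, Ring.inverse_eq_inv', smul_eq_mul,
    Matrix.adjugate_apply]
  refine ((contDiffOn_det_metricMatrix x₀).inv fun _ hy ↦ (det_metricMatrix_pos hy).ne').mul ?_
  simp_rw [Matrix.det_apply]
  refine ContDiffOn.sum fun σ _ ↦ ContDiffOn.const_smul _ (contDiffOn_prod fun k _ ↦ ?_)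
  rcases eq_or_ne (σ k) j with h | h
  · simp only [h, Matrix.updateRow_self]; exact contDiffOn_const
  · simp only [Matrix.updateRow_ne h]; exact contDiffOn_metricMatrix x₀ _ _

end

/-! ### The Riemannian volume in a chart -/

section
variable {n : ℕ} {M : Type*} [TopologicalSpace M] [ChartedSpace (EuclideanSpace ℝ (Fin n)) M]
  [IsManifold (𝓡 n) ∞ M]
 [RiemannianBundle (fun x : M ↦ TangentSpace (𝓡 n) x)]

/-- The two sides live in the tangent spaces at `f y` and at `g y`, which are equal only
propositionally, so that the equality of the differentials cannot be rewritten with. -/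
lemma inner_mfderiv_congr {F : Type*} [NormedAddCommGroup F] [NormedSpace ℝ F] {f g : F → M} {y : F}
    (h : f =ᶠ[𝓝 y] g) (v w : F) :
    inner ℝ (mfderiv 𝓘(ℝ, F) (𝓡 n) f y v) (mfderiv 𝓘(ℝ, F) (𝓡 n) f y w) =
      inner ℝ (mfderiv 𝓘(ℝ, F) (𝓡 n) g y v) (mfderiv 𝓘(ℝ, F) (𝓡 n) g y w) := by
  let Q : M → EuclideanSpace ℝ (Fin n) → EuclideanSpace ℝ (Fin n) → ℝ := fun p a b ↦
    @inner ℝ (TangentSpace (𝓡 n) p) _ a b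
  have h1 : f y = g y := h.eq_of_nhds
  have h2 : ∀ v : F, (mfderiv 𝓘(ℝ, F) (𝓡 n) f y v : EuclideanSpace ℝ (Fin n)) =
      mfderiv 𝓘(ℝ, F) (𝓡 n) g y v := fun v ↦
    congrArg (fun L : F →L[ℝ] EuclideanSpace ℝ (Fin n) ↦ L v) h.mfderiv_eq
  have h3 : ∀ p q a a' b b', p = q → a = a' → b = b' → Q p a b = Q q a' b' := by
    rintro p _ a _ b _ rfl rfl rfl
    rfl
  exact h3 _ _ _ _ _ _ h1 (h2 v) (h2 w)

/-- The change of coordinates from the chart around `x₁` to the chart around `x₀`. -/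
def transition (x₁ x₀ : M) : EuclideanSpace ℝ (Fin n) → EuclideanSpace ℝ (Fin n) :=
  extChartAt (𝓡 n) x₀ ∘ (extChartAt (𝓡 n) x₁).symm

lemma isOpen_overlap (x₁ x₀ : M) : IsOpen ((extChartAt (𝓡 n) x₁).target ∩
    (extChartAt (𝓡 n) x₁).symm ⁻¹' (extChartAt (𝓡 n) x₀).source) :=
  (continuousOn_extChartAt_symm x₁).isOpen_inter_preimage (isOpen_extChartAt_target x₁)
    (isOpen_extChartAt_source x₀)

lemma contDiffOn_transition (x₁ x₀ : M) : ContDiffOn ℝ ∞ (transition (n := n) x₁ x₀)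
    ((extChartAt (𝓡 n) x₁).target ∩ (extChartAt (𝓡 n) x₁).symm ⁻¹' (extChartAt (𝓡 n) x₀).source) :=
      by
  rw [← contMDiffOn_iff_contDiffOn]
  refine ContMDiffOn.comp (t := (extChartAt (𝓡 n) x₀).source) ?_
    ((contMDiffOn_symm x₁).mono inter_subset_left) inter_subset_right
  rw [extChartAt_source]
  exact contMDiffOn_extChartAt

lemma differentiableAt_transition {x₁ x₀ : M} {y : EuclideanSpace ℝ (Fin n)}
    (hy : y ∈ (extChartAt (𝓡 n) x₁).target)
    (hy' : (extChartAt (𝓡 n) x₁).symm y ∈ (extChartAt (𝓡 n) x₀).source) :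
    DifferentiableAt ℝ (transition x₁ x₀) y :=
  ((contDiffOn_transition x₁ x₀).contDiffAt ((isOpen_overlap x₁ x₀).mem_nhds
    ⟨hy, hy'⟩)).differentiableAt
    (by simp)

lemma inner_chartDeriv_transition {x₁ x₀ : M} {y : EuclideanSpace ℝ (Fin n)}
    (hy : y ∈ (extChartAt (𝓡 n) x₁).target)
    (hy' : (extChartAt (𝓡 n) x₁).symm y ∈ (extChartAt (𝓡 n) x₀).source)
      (v w : EuclideanSpace ℝ (Fin n)) :
    inner ℝ (chartDeriv x₁ y v) (chartDeriv x₁ y w) =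
    inner ℝ (chartDeriv x₀ (transition x₁ x₀ y) (fderiv ℝ (transition x₁ x₀) y v))
      (chartDeriv x₀ (transition x₁ x₀ y) (fderiv ℝ (transition x₁ x₀) y w)) := by
  have he : (extChartAt (𝓡 n) x₁).symm =ᶠ[𝓝 y] (extChartAt (𝓡 n) x₀).symm ∘ transition x₁ x₀ := by
    filter_upwards [(isOpen_overlap x₁ x₀).mem_nhds ⟨hy, hy'⟩] with z hz
    exact ((extChartAt (𝓡 n) x₀).left_inv hz.2).symm
  have ht : transition x₁ x₀ y ∈ (extChartAt (𝓡 n) x₀).target :=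
    (extChartAt (𝓡 n) x₀).map_source hy'
  have hd := differentiableAt_transition hy hy'
  have hc := mfderiv_comp y (mdifferentiableAt_symm ht) hd.mdifferentiableAt
  rw [mfderiv_eq_fderiv] at hc
  refine (inner_mfderiv_congr he v w).trans ?_
  rw [hc]
  rfl

lemma metricMatrix_transition {x₁ x₀ : M} {y : EuclideanSpace ℝ (Fin n)}
    (hy : y ∈ (extChartAt (𝓡 n) x₁).target)
    (hy' : (extChartAt (𝓡 n) x₁).symm y ∈ (extChartAt (𝓡 n) x₀).source) :
    metricMatrix x₁ y =
      (LinearMap.toMatrix (EuclideanSpace.basisFun (Fin n) ℝ).toBasis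
        (EuclideanSpace.basisFun (Fin n) ℝ).toBasis
        (fderiv ℝ (transition x₁ x₀) y).toLinearMap).transpose *
          metricMatrix x₀ (transition x₁ x₀ y) *
      (LinearMap.toMatrix (EuclideanSpace.basisFun (Fin n) ℝ).toBasis
        (EuclideanSpace.basisFun (Fin n) ℝ).toBasis
        (fderiv ℝ (transition x₁ x₀) y).toLinearMap) := by
  ext i j
  have : metricMatrix x₁ y i j =
      inner ℝ (chartDeriv x₁ y (EuclideanSpace.single i 1))
        (chartDeriv x₁ y (EuclideanSpace.single j 1)) := rfl
  rw [this, inner_chartDeriv_transition hy hy', inner_chartDeriv]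
  simp only [Matrix.mul_apply, Matrix.transpose_apply, LinearMap.toMatrix_apply, Finset.sum_mul]
  rw [Finset.sum_comm]
  refine Finset.sum_congr rfl fun k _ ↦ Finset.sum_congr rfl fun l _ ↦ ?_
  simp
  ring

lemma volumeDensity_transition {x₁ x₀ : M} {y : EuclideanSpace ℝ (Fin n)}
    (hy : y ∈ (extChartAt (𝓡 n) x₁).target)
    (hy' : (extChartAt (𝓡 n) x₁).symm y ∈ (extChartAt (𝓡 n) x₀).source) :
    volumeDensity x₁ y =
      |(fderiv ℝ (transition x₁ x₀) y).det| * volumeDensity x₀ (transition x₁ x₀ y) := by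
  rw [volumeDensity, metricMatrix_transition hy hy', Matrix.det_mul, Matrix.det_mul,
    Matrix.det_transpose,
    LinearMap.det_toMatrix, mul_right_comm, Real.sqrt_mul (mul_self_nonneg _),
      Real.sqrt_mul_self_eq_abs]
  rfl

/-- The measure `√g dy` of the chart around `x₀`, extended by zero outside of the domain of the
chart. -/
def chartMeasure [MeasurableSpace M] (x₀ : M) : Measure M :=
  Measure.map (extChartAt (𝓡 n) x₀).symm
    ((volume.restrict (extChartAt (𝓡 n) x₀).target).withDensity
      fun y ↦ ENNReal.ofReal (volumeDensity x₀ y))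

variable [MeasurableSpace M] [BorelSpace M]

lemma measurableSet_target (x₀ : M) : MeasurableSet (extChartAt (𝓡 n) x₀).target :=
  (isOpen_extChartAt_target x₀).measurableSet

lemma aemeasurable_symm (x₀ : M) : AEMeasurable (extChartAt (𝓡 n) x₀).symm
    ((volume.restrict (extChartAt (𝓡 n) x₀).target).withDensity
      fun y ↦ ENNReal.ofReal (volumeDensity x₀ y)) :=
  ((continuousOn_extChartAt_symm x₀).aemeasurable (measurableSet_target x₀)).mono_ac
    (withDensity_absolutelyContinuous _ _)

lemma chartMeasure_apply (x₀ : M) {S : Set M} (hS : MeasurableSet S) :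
    chartMeasure (n := n) x₀ S = ∫⁻ y in (extChartAt (𝓡 n) x₀).symm ⁻¹' S ∩
      (extChartAt (𝓡 n) x₀).target,
      ENNReal.ofReal (volumeDensity x₀ y) := by
  rw [chartMeasure, Measure.map_apply_of_aemeasurable (aemeasurable_symm x₀) hS, withDensity_apply',
    Measure.restrict_restrict' (measurableSet_target x₀)]

lemma measurableSet_preimage_symm (x₁ : M) {S : Set M} (hS : MeasurableSet S) :
    MeasurableSet ((extChartAt (𝓡 n) x₁).symm ⁻¹' S ∩ (extChartAt (𝓡 n) x₁).target) := by
  have := (continuousOn_extChartAt_symm (I := 𝓡 n) x₁).domRestrict.measurable hS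
  convert (MeasurableEmbedding.subtype_coe (measurableSet_target x₁)).measurableSet_image.2
    this using 1
  ext y
  simp [and_comm, -extChartAt]

lemma chartMeasure_overlap (x₁ x₀ : M) {S : Set M} (hS : MeasurableSet S)
    (h1 : S ⊆ (extChartAt (𝓡 n) x₁).source) (h0 : S ⊆ (extChartAt (𝓡 n) x₀).source) :
    chartMeasure (n := n) x₁ S = chartMeasure (n := n) x₀ S := by
  rw [chartMeasure_apply _ hS, chartMeasure_apply _ hS]
  have him : (extChartAt (𝓡 n) x₀).symm ⁻¹' S ∩ (extChartAt (𝓡 n) x₀).target =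
      transition x₁ x₀ '' ((extChartAt (𝓡 n) x₁).symm ⁻¹' S ∩ (extChartAt (𝓡 n) x₁).target) := by
    ext z
    constructor
    · rintro ⟨hz, hzt⟩
      refine ⟨extChartAt (𝓡 n) x₁ ((extChartAt (𝓡 n) x₀).symm z), ⟨?_, ?_⟩, ?_⟩
      · rw [mem_preimage, (extChartAt (𝓡 n) x₁).left_inv (h1 hz)]; exact hz
      · exact (extChartAt (𝓡 n) x₁).map_source (h1 hz)
      · rw [transition, Function.comp_apply, (extChartAt (𝓡 n) x₁).left_inv (h1 hz),
          (extChartAt (𝓡 n) x₀).right_inv hzt]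
    · rintro ⟨y, ⟨hy, hyt⟩, rfl⟩
      refine ⟨?_, (extChartAt (𝓡 n) x₀).map_source (h0 hy)⟩
      rw [mem_preimage, transition, Function.comp_apply, (extChartAt (𝓡 n) x₀).left_inv (h0 hy)]
      exact hy
  have hmeas := measurableSet_preimage_symm (n := n) x₁ hS
  -- the change of variables formula for the change of coordinates
  rw [him, lintegral_image_eq_lintegral_abs_det_fderiv_mul volume hmeas
    (fun y hy ↦ (differentiableAt_transition hy.2 (h0 hy.1)).hasFDerivAt.hasFDerivWithinAt)]
  · refine setLIntegral_congr_fun hmeas fun y hy ↦ ?_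
    rw [← ENNReal.ofReal_mul (abs_nonneg _), ← volumeDensity_transition hy.2 (h0 hy.1)]
  · intro y hy z hz hyz
    have := (extChartAt (𝓡 n) x₀).injOn (h0 hy.1) (h0 hz.1) hyz
    exact (extChartAt (𝓡 n) x₁).symm.injOn hy.2 hz.2 this

lemma chartMeasure_compl_source (x₀ : M) :
    chartMeasure (n := n) x₀ (extChartAt (𝓡 n) x₀).sourceᶜ = 0 := by
  rw [chartMeasure_apply _ (isOpen_extChartAt_source x₀).measurableSet.compl]
  have : (extChartAt (𝓡 n) x₀).symm ⁻¹' (extChartAt (𝓡 n) x₀).sourceᶜ ∩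
      (extChartAt (𝓡 n) x₀).target = ∅ := by
    ext y
    simp only [mem_inter_iff, mem_preimage, mem_compl_iff, mem_empty_iff_false, iff_false, not_and]
    exact fun h h' ↦ h ((extChartAt (𝓡 n) x₀).map_target h')
  rw [this, Measure.restrict_empty, lintegral_zero_measure]

/-- The measures of the charts agree on overlaps, so that their supremum restricts to each of
them. -/
theorem volumeMeasure_restrict_source (x₀ : M) :
    (volumeMeasure n M).restrict (extChartAt (𝓡 n) x₀).source =
      chartMeasure (n := n) x₀ := by
  have hs : MeasurableSet (extChartAt (𝓡 n) x₀).source :=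
    (isOpen_extChartAt_source x₀).measurableSet
  have hr : (chartMeasure (n := n) x₀).restrict
      (extChartAt (𝓡 n) x₀).source = chartMeasure (n := n) x₀ :=
    Measure.restrict_eq_self_of_ae_mem (
      ((measure_eq_zero_iff_ae_notMem.1 (chartMeasure_compl_source (n := n) x₀)).mono
        fun _ h ↦ not_not.1 h))
  apply le_antisymm
  -- on the domain of the chart no other chart exceeds it, and nothing is claimed outside
  · have hle : volumeMeasure n M ≤ chartMeasure (n := n) x₀ +
        (⊤ : Measure M).restrict (extChartAt (𝓡 n) x₀).sourceᶜ := by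
      refine iSup_le fun x₁ ↦ Measure.le_iff.2 fun S hS ↦ ?_
      change chartMeasure x₁ S ≤ _
      rw [← measure_inter_add_sdiff S hs, Measure.add_apply, Measure.restrict_apply hS]
      refine add_le_add ?_ (by rw [← sdiff_eq]; exact Measure.le_iff'.1 le_top _)
      rw [← measure_inter_add_sdiff (S ∩ _) (isOpen_extChartAt_source (I := 𝓡 n) x₁).measurableSet]
      have : chartMeasure (n := n) x₁ ((S ∩ (extChartAt (𝓡 n) x₀).source) \
          (extChartAt (𝓡 n) x₁).source) = 0 :=
        measure_mono_null (sdiff_subset_compl _ _) (chartMeasure_compl_source x₁)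
      rw [this, add_zero, chartMeasure_overlap x₁ x₀
        ((hS.inter hs).inter (isOpen_extChartAt_source x₁).measurableSet)
        inter_subset_right (inter_subset_left.trans inter_subset_right)]
      exact measure_mono (inter_subset_left.trans inter_subset_left)
    refine (Measure.restrict_mono_measure hle _).trans ?_
    rw [Measure.restrict_add, hr, Measure.restrict_restrict hs, inter_compl_self]
    simp
  · rw [← hr]
    exact Measure.restrict_mono_measure (le_iSup (fun x₀ ↦ chartMeasure (n := n) x₀) x₀) _

end

section
variable {n : ℕ} {M : Type*} [TopologicalSpace M] [ChartedSpace (EuclideanSpace ℝ (Fin n)) M]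
  [IsManifold (𝓡 n) ∞ M]
 [RiemannianBundle (fun x : M ↦ TangentSpace (𝓡 n) x)]
    [IsContMDiffRiemannianBundle (𝓡 n) ∞ (EuclideanSpace ℝ (Fin n))
      (fun x : M ↦ TangentSpace (𝓡 n) x)] [MeasurableSpace M] [BorelSpace M]

lemma integral_volumeMeasure_eq (x₀ : M) {F : M → ℝ}
    (hF : AEStronglyMeasurable F ((volumeMeasure n M).restrict (extChartAt (𝓡 n) x₀).source))
    (hF0 : ∀ x ∉ (extChartAt (𝓡 n) x₀).source, F x = 0) :
    ∫ x, F x ∂(volumeMeasure n M) = ∫ y in (extChartAt (𝓡 n) x₀).target,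
      volumeDensity x₀ y * F ((extChartAt (𝓡 n) x₀).symm y) := by
  rw [← setIntegral_eq_integral_of_forall_compl_eq_zero hF0]
  rw [volumeMeasure_restrict_source] at hF ⊢
  rw [chartMeasure, integral_map (aemeasurable_symm x₀) hF,
    integral_withDensity_eq_integral_toReal_smul₀]
  · refine setIntegral_congr_fun (measurableSet_target x₀) fun y hy ↦ ?_
    simp only [smul_eq_mul]
    rw [ENNReal.toReal_ofReal (volumeDensity_pos hy).le]
  · exact ENNReal.measurable_ofReal.comp_aemeasurable
      ((contDiffOn_volumeDensity x₀).continuousOn.aemeasurable (measurableSet_target x₀))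
  · simp

instance isLocallyFiniteMeasure_volumeMeasure : IsLocallyFiniteMeasure (volumeMeasure n M) := by
  refine ⟨fun x ↦ ?_⟩
  obtain ⟨r, hr, hb⟩ := Metric.nhds_basis_closedBall.mem_iff.1
    (extChartAt_target_mem_nhds (I := 𝓡 n) x)
  set S : Set M := (extChartAt (𝓡 n) x).source ∩
    extChartAt (𝓡 n) x ⁻¹' Metric.ball (extChartAt (𝓡 n) x x) r
  have hS : IsOpen S := isOpen_extChartAt_preimage' x Metric.isOpen_ball
  refine ⟨S, hS.mem_nhds ⟨mem_extChartAt_source x, Metric.mem_ball_self hr⟩, ?_⟩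
  have : volumeMeasure n M S = chartMeasure (n := n) x S := by
    rw [← volumeMeasure_restrict_source, Measure.restrict_apply hS.measurableSet,
      inter_eq_left.2 inter_subset_left]
  rw [this, chartMeasure_apply _ hS.measurableSet]
  have hint : IntegrableOn (volumeDensity (n := n) x)
      (Metric.closedBall (extChartAt (𝓡 n) x x) r) :=
    ((contDiffOn_volumeDensity x).continuousOn.mono hb).integrableOn_compact
      (isCompact_closedBall _ _)
  refine lt_of_le_of_lt (lintegral_mono_set ?_) hint.lintegral_lt_top
  rintro y ⟨⟨_, hy⟩, hyt⟩
  rw [mem_preimage, (extChartAt (𝓡 n) x).right_inv hyt] at hy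
  exact Metric.ball_subset_closedBall hy

instance isOpenPosMeasure_volumeMeasure : (volumeMeasure n M).IsOpenPosMeasure := by
  refine ⟨fun U hU ⟨x, hx⟩ h0 ↦ ?_⟩
  have h1 : chartMeasure (n := n) x U = 0 := by
    rw [← volumeMeasure_restrict_source]
    exact Measure.absolutelyContinuous_of_le Measure.restrict_le_self h0
  rw [chartMeasure_apply _ hU.measurableSet] at h1
  set O := (extChartAt (𝓡 n) x).symm ⁻¹' U ∩ (extChartAt (𝓡 n) x).target with hO
  have hOo : IsOpen O := by
    rw [hO, inter_comm]
    exact (continuousOn_extChartAt_symm x).isOpen_inter_preimage (isOpen_extChartAt_target x) hU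
  have hm : extChartAt (𝓡 n) x x ∈ O := ⟨by rwa [mem_preimage, extChartAt_to_inv],
    mem_extChartAt_target x⟩
  have hae : AEMeasurable (fun y ↦ ENNReal.ofReal (volumeDensity x y)) (volume.restrict O) :=
    ENNReal.measurable_ofReal.comp_aemeasurable
      (((contDiffOn_volumeDensity x).continuousOn.mono inter_subset_right).aemeasurable
        hOo.measurableSet)
  rw [setLIntegral_eq_zero_iff'  hOo.measurableSet hae] at h1
  refine (hOo.measure_pos volume ⟨_, hm⟩).ne' (measure_mono_null ?_ h1)
  intro y hy
  simp only [mem_compl_iff, mem_ofPred_eq, not_forall]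
  exact ⟨hy, (ENNReal.ofReal_pos.2 (volumeDensity_pos hy.2)).ne'⟩

end

/-! ### Gradient and Laplacian in coordinates -/

section
variable {n : ℕ} {M : Type*} [TopologicalSpace M] [ChartedSpace (EuclideanSpace ℝ (Fin n)) M]
  [IsManifold (𝓡 n) ∞ M]

lemma contDiffOn_comp_symm (x₀ : M) {k : ℕ} {f : M → ℝ} (hf : ContMDiff (𝓡 n) 𝓘(ℝ, ℝ) k f) :
    ContDiffOn ℝ k (f ∘ (extChartAt (𝓡 n) x₀).symm) (extChartAt (𝓡 n) x₀).target := by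
  rw [← contMDiffOn_iff_contDiffOn]
  exact hf.comp_contMDiffOn ((contMDiffOn_symm x₀).of_le (mod_cast le_top))

lemma contDiffOn_partialDeriv {f : EuclideanSpace ℝ (Fin n) → ℝ}
    {s : Set (EuclideanSpace ℝ (Fin n))} {k : ℕ}
    (hs : IsOpen s) (hf : ContDiffOn ℝ (k + 1 : ℕ) f s) (i : Fin n) :
      ContDiffOn ℝ k (partialDeriv i f) s :=
  (hf.fderiv_of_isOpen hs (m := k) (by norm_cast)).clm_apply contDiffOn_const

variable [RiemannianBundle (fun x : M ↦ TangentSpace (𝓡 n) x)]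

/-- The expression `g^{ij} √g ∂ⱼf` whose divergence is `√g Δf`, in the chart around `x₀`. -/
def gradFlux (x₀ : M) (f : M → ℝ) (i j : Fin n) (y : EuclideanSpace ℝ (Fin n)) : ℝ :=
  (metricMatrix x₀ y)⁻¹ i j * volumeDensity x₀ y *
    partialDeriv j (f ∘ (extChartAt (𝓡 n) x₀).symm) y

/-- The Laplacian at `x`, computed in the chart around `x₀` instead of the chart around `x`. -/
def laplacianIn (x₀ : M) (f : M → ℝ) (x : M) : ℝ :=
  (volumeDensity x₀ (extChartAt (𝓡 n) x₀ x))⁻¹ *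
    ∑ i : Fin n, ∑ j : Fin n, partialDeriv i (gradFlux x₀ f i j) (extChartAt (𝓡 n) x₀ x)

lemma grad_eq_zero_of_eventuallyEq_zero {w : M → ℝ} {x : M} (h : w =ᶠ[𝓝 x] 0) : grad n w x = 0 := by
  refine ext_inner_right ℝ fun v ↦ ?_
  rw [inner_grad, h.mfderiv_eq, inner_zero_left]
  exact congrArg (fun L : TangentSpace (𝓡 n) x →L[ℝ] ℝ ↦ L v) (mfderiv_const (c := (0 : ℝ)))

variable
    [IsContMDiffRiemannianBundle (𝓡 n) ∞ (EuclideanSpace ℝ (Fin n))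
      (fun x : M ↦ TangentSpace (𝓡 n) x)]

lemma contDiffOn_gradFlux (x₀ : M) {k : ℕ} {f : M → ℝ} (hf : ContMDiff (𝓡 n) 𝓘(ℝ, ℝ) (k + 1 : ℕ) f)
    (i j : Fin n) :
    ContDiffOn ℝ k (gradFlux x₀ f i j) (extChartAt (𝓡 n) x₀).target :=
  (((contDiffOn_metricMatrix_inv x₀ i j).of_le (mod_cast le_top)).mul
    ((contDiffOn_volumeDensity x₀).of_le (mod_cast le_top))).mul
    (contDiffOn_partialDeriv (isOpen_extChartAt_target x₀) (contDiffOn_comp_symm x₀ hf) j)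

lemma continuousOn_laplacianIn (x₀ : M) {f : M → ℝ} (hf : ContMDiff (𝓡 n) 𝓘(ℝ, ℝ) 2 f) :
    ContinuousOn (laplacianIn (n := n) x₀ f) (extChartAt (𝓡 n) x₀).source := by
  have hmaps := (extChartAt (𝓡 n) x₀).mapsTo
  refine ContinuousOn.mul (ContinuousOn.inv₀ ?_ ?_) ?_
  · exact (contDiffOn_volumeDensity x₀).continuousOn.comp (continuousOn_extChartAt x₀) hmaps
  · exact fun x hx ↦ (volumeDensity_pos (hmaps hx)).ne'
  · refine continuousOn_finsetSum _ fun i _ ↦ continuousOn_finsetSum _ fun j _ ↦ ?_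
    exact (contDiffOn_partialDeriv (k := 0) (isOpen_extChartAt_target x₀)
      (contDiffOn_gradFlux x₀ (k := 1) hf i j) i).continuousOn.comp
        (continuousOn_extChartAt x₀) hmaps

lemma mdifferentiable_of_contMDiff {f : M → ℝ} (hf : ContMDiff (𝓡 n) 𝓘(ℝ, ℝ) 1 f) (x : M) :
    MDifferentiableAt (𝓡 n) 𝓘(ℝ, ℝ) f x := (hf x).mdifferentiableAt (by simp)

lemma volumeDensity_mul_inner_grad {x₀ : M} {y : EuclideanSpace ℝ (Fin n)}
    (hy : y ∈ (extChartAt (𝓡 n) x₀).target) {w f : M → ℝ}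
    (hw : ContMDiff (𝓡 n) 𝓘(ℝ, ℝ) 1 w) (hf : ContMDiff (𝓡 n) 𝓘(ℝ, ℝ) 1 f) :
    volumeDensity x₀ y * inner ℝ (grad n w ((extChartAt (𝓡 n) x₀).symm y))
      (grad n f ((extChartAt (𝓡 n) x₀).symm y)) =
      ∑ i, ∑ j, gradFlux x₀ f i j y * partialDeriv i (w ∘ (extChartAt (𝓡 n) x₀).symm) y := by
  rw [inner_grad_grad hy (mdifferentiable_of_contMDiff hw _) (mdifferentiable_of_contMDiff hf _),
    Finset.mul_sum]
  refine Finset.sum_congr rfl fun i _ ↦ ?_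
  rw [Finset.mul_sum]
  refine Finset.sum_congr rfl fun j _ ↦ ?_
  rw [gradFlux]; ring

lemma contDiffOn_inner_grad (x₀ : M) {k : ℕ} {w f : M → ℝ}
    (hw : ContMDiff (𝓡 n) 𝓘(ℝ, ℝ) (k + 1 : ℕ) w) (hf : ContMDiff (𝓡 n) 𝓘(ℝ, ℝ) (k + 1 : ℕ) f) :
    ContDiffOn ℝ k ((fun x ↦ inner ℝ (grad n w x) (grad n f x)) ∘ (extChartAt (𝓡 n) x₀).symm)
      (extChartAt (𝓡 n) x₀).target := by
  have hd : ∀ {f : M → ℝ}, ContMDiff (𝓡 n) 𝓘(ℝ, ℝ) (k + 1 : ℕ) f → ContMDiff (𝓡 n) 𝓘(ℝ, ℝ) 1 f :=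
    fun h ↦ h.of_le (by norm_cast; omega)
  refine ContDiffOn.congr (f := fun y ↦ ∑ i, ∑ j, (metricMatrix x₀ y)⁻¹ i j *
    partialDeriv j (f ∘ (extChartAt (𝓡 n) x₀).symm) y *
        partialDeriv i (w ∘ (extChartAt (𝓡 n) x₀).symm) y) ?_ fun y hy ↦
    inner_grad_grad hy (mdifferentiable_of_contMDiff (hd hw) _)
      (mdifferentiable_of_contMDiff (hd hf) _)
  have ho := isOpen_extChartAt_target (I := 𝓡 n) x₀
  refine ContDiffOn.sum fun i _ ↦ ContDiffOn.sum fun j _ ↦ ?_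
  exact (((contDiffOn_metricMatrix_inv x₀ i j).of_le (mod_cast le_top)).mul
    (contDiffOn_partialDeriv ho (contDiffOn_comp_symm x₀ hf) j)).mul
    (contDiffOn_partialDeriv ho (contDiffOn_comp_symm x₀ hw) i)

lemma contMDiff_inner_grad {k : ℕ} {w f : M → ℝ}
    (hw : ContMDiff (𝓡 n) 𝓘(ℝ, ℝ) (k + 1 : ℕ) w) (hf : ContMDiff (𝓡 n) 𝓘(ℝ, ℝ) (k + 1 : ℕ) f) :
    ContMDiff (𝓡 n) 𝓘(ℝ, ℝ) k (fun x ↦ inner ℝ (grad n w x) (grad n f x)) := by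
  intro x
  have h0 : ContMDiffOn (𝓡 n) 𝓘(ℝ, EuclideanSpace ℝ (Fin n)) k (extChartAt (𝓡 n) x)
      (extChartAt (𝓡 n) x).source := by
    rw [extChartAt_source]
    exact contMDiffOn_extChartAt
  have h1 := (contDiffOn_inner_grad x hw hf).contMDiffOn.comp h0 (extChartAt (𝓡 n) x).mapsTo
  refine (h1.congr fun z hz ↦ ?_).contMDiffAt
    ((isOpen_extChartAt_source x).mem_nhds (mem_extChartAt_source x))
  simp only [Function.comp]
  rw [(extChartAt (𝓡 n) x).left_inv hz]

/-! ### Green's formula in one chart -/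

/-- The function `w` in the coordinates of the chart around `x₀`, extended by zero. -/
def chartExtend (x₀ : M) (w : M → ℝ) : EuclideanSpace ℝ (Fin n) → ℝ :=
  (extChartAt (𝓡 n) x₀).target.indicator (w ∘ (extChartAt (𝓡 n) x₀).symm)

lemma chartExtend_eventuallyEq {x₀ : M} {w : M → ℝ} {y : EuclideanSpace ℝ (Fin n)}
    (hy : y ∈ (extChartAt (𝓡 n) x₀).target) :
    chartExtend x₀ w =ᶠ[𝓝 y] w ∘ (extChartAt (𝓡 n) x₀).symm := by
  filter_upwards [(isOpen_extChartAt_target x₀).mem_nhds hy] with z hz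
  exact indicator_of_mem hz _

lemma chartExtend_eq_zero {x₀ : M} {w : M → ℝ} {y : EuclideanSpace ℝ (Fin n)}
    (hy : y ∉ extChartAt (𝓡 n) x₀ '' tsupport w) : chartExtend x₀ w y = 0 := by
  by_cases h : y ∈ (extChartAt (𝓡 n) x₀).target
  · rw [chartExtend, indicator_of_mem h]
    refine image_eq_zero_of_notMem_tsupport (f := w) fun h' ↦
      hy ⟨_, h', (extChartAt (𝓡 n) x₀).right_inv h⟩
  · exact indicator_of_notMem h _

variable [T2Space M] [CompactSpace M]

lemma isCompact_image_tsupport {x₀ : M} {w : M → ℝ}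
    (hw : tsupport w ⊆ (extChartAt (𝓡 n) x₀).source) :
    IsCompact (extChartAt (𝓡 n) x₀ '' tsupport w) :=
  (isClosed_tsupport w).isCompact.image_of_continuousOn ((continuousOn_extChartAt x₀).mono hw)

lemma chartExtend_eventuallyEq_zero {x₀ : M} {w : M → ℝ}
    (hw : tsupport w ⊆ (extChartAt (𝓡 n) x₀).source)
    {y : EuclideanSpace ℝ (Fin n)}
    (hy : y ∉ extChartAt (𝓡 n) x₀ '' tsupport w) : chartExtend x₀ w =ᶠ[𝓝 y] 0 := by
  filter_upwards [(isCompact_image_tsupport hw).isClosed.isOpen_compl.mem_nhds hy] with z hz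
  exact chartExtend_eq_zero hz

lemma differentiable_chartExtend {x₀ : M} {w : M → ℝ}
    (hw : tsupport w ⊆ (extChartAt (𝓡 n) x₀).source)
    (hw1 : ContMDiff (𝓡 n) 𝓘(ℝ, ℝ) 1 w) : Differentiable ℝ (chartExtend (n := n) x₀ w) := by
  intro y
  by_cases h : y ∈ (extChartAt (𝓡 n) x₀).target
  · refine DifferentiableAt.congr_of_eventuallyEq ?_ (chartExtend_eventuallyEq h)
    exact ((contDiffOn_comp_symm (k := 1) x₀ hw1).contDiffAt
      ((isOpen_extChartAt_target x₀).mem_nhds h)).differentiableAt (by simp)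
  · refine (differentiableAt_const 0).congr_of_eventuallyEq (chartExtend_eventuallyEq_zero hw ?_)
    rintro ⟨x, hx, rfl⟩
    exact h ((extChartAt (𝓡 n) x₀).map_source (hw hx))

variable [MeasurableSpace M] [BorelSpace M]

/-- Integration by parts for `w` supported in the domain of one chart, with the Laplacian of that
chart. -/
lemma integral_mul_laplacianIn {x₀ : M} {w f : M → ℝ}
    (hw : tsupport w ⊆ (extChartAt (𝓡 n) x₀).source)
    (hw1 : ContMDiff (𝓡 n) 𝓘(ℝ, ℝ) 1 w) (hf : ContMDiff (𝓡 n) 𝓘(ℝ, ℝ) 2 f) :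
    ∫ x, w x * laplacianIn (n := n) x₀ f x ∂(volumeMeasure n M) =
      -∫ x, inner ℝ (grad n w x) (grad n f x) ∂(volumeMeasure n M) := by
  have hf1 : ContMDiff (𝓡 n) 𝓘(ℝ, ℝ) 1 f := hf.of_le (by norm_num)
  have ho := isOpen_extChartAt_target (I := 𝓡 n) x₀
  have hs := (isOpen_extChartAt_source (I := 𝓡 n) x₀).measurableSet
  set K := extChartAt (𝓡 n) x₀ '' tsupport w with hK
  have hKc : IsCompact K := isCompact_image_tsupport hw
  have hKt : K ⊆ (extChartAt (𝓡 n) x₀).target := by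
    rintro _ ⟨x, hx, rfl⟩
    exact (extChartAt (𝓡 n) x₀).map_source (hw hx)
  set W := chartExtend (n := n) x₀ w with hW
  have hWd : ∀ y ∈ (extChartAt (𝓡 n) x₀).target, ∀ i, partialDeriv i W y =
      partialDeriv i (w ∘ (extChartAt (𝓡 n) x₀).symm) y :=
    fun y hy i ↦ by rw [partialDeriv, partialDeriv, (chartExtend_eventuallyEq hy).fderiv_eq]
  have hW0 : ∀ y ∉ K, ∀ i, partialDeriv i W y = 0 := fun y hy i ↦ by
    rw [partialDeriv, (chartExtend_eventuallyEq_zero hw hy).fderiv_eq]; simp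
  have hint : ∀ g : EuclideanSpace ℝ (Fin n) → ℝ, ContinuousOn g (extChartAt (𝓡 n) x₀).target →
      (∀ y ∉ K, g y = 0) → Integrable g := fun g hg hg0 ↦
    ((hg.mono hKt).integrableOn_compact hKc).integrable_of_forall_notMem_eq_zero hg0
  have hWc : ContinuousOn W (extChartAt (𝓡 n) x₀).target :=
    (differentiable_chartExtend hw hw1).continuous.continuousOn
  have hWc' : ∀ i, ContinuousOn (partialDeriv i W) (extChartAt (𝓡 n) x₀).target := fun i ↦
    (contDiffOn_partialDeriv (k := 0) ho (contDiffOn_comp_symm (k := 1) x₀ hw1)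
      i).continuousOn.congr
      fun y hy ↦ hWd y hy i
  have hFc : ∀ i j, ContinuousOn (gradFlux x₀ f i j) (extChartAt (𝓡 n) x₀).target :=
    fun i j ↦ (contDiffOn_gradFlux (k := 1) x₀ hf i j).continuousOn
  have hFc' : ∀ i j, ContinuousOn (partialDeriv i (gradFlux x₀ f i j))
      (extChartAt (𝓡 n) x₀).target :=
    fun i j ↦ (contDiffOn_partialDeriv (k := 0) ho (contDiffOn_gradFlux (k := 1) x₀ hf i j)
      i).continuousOn
  have hi1 : ∀ i j, Integrable fun y ↦ partialDeriv i (gradFlux x₀ f i j) y * W y := fun i j ↦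
    hint _ ((hFc' i j).mul hWc) fun y hy ↦ by rw [hW, chartExtend_eq_zero hy, mul_zero]
  have hi2 : ∀ i j, Integrable fun y ↦ gradFlux x₀ f i j y * partialDeriv i W y := fun i j ↦
    hint _ ((hFc i j).mul (hWc' i)) fun y hy ↦ by rw [hW0 y hy, mul_zero]
  have hparts : ∀ i j, ∫ y, gradFlux x₀ f i j y * partialDeriv i W y =
      -∫ y, partialDeriv i (gradFlux x₀ f i j) y * W y := by
    intro i j
    refine integral_mul_fderiv_eq_neg_fderiv_mul_of_integrable (hi1 i j) (hi2 i j) ?_ ?_ ?_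
    · exact hint _ ((hFc i j).mul hWc) fun y hy ↦ by rw [hW, chartExtend_eq_zero hy, mul_zero]
    · intro y hy
      have hyK : y ∈ K := closure_minimal (fun z hz ↦ by_contra fun h ↦
        Function.mem_support.1 hz (chartExtend_eq_zero h)) hKc.isClosed hy
      exact ((contDiffOn_gradFlux (k := 1) x₀ hf i j).contDiffAt
        (ho.mem_nhds (hKt hyK))).differentiableAt (by simp)
    · exact fun y _ ↦ differentiable_chartExtend hw hw1 y
  have hw0 : ∀ x ∉ (extChartAt (𝓡 n) x₀).source, w =ᶠ[𝓝 x] 0 := fun x hx ↦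
    notMem_tsupport_iff_eventuallyEq.1 fun h ↦ hx (hw h)
  rw [integral_volumeMeasure_eq x₀, integral_volumeMeasure_eq x₀]
  · have e1 : ∫ y in (extChartAt (𝓡 n) x₀).target, volumeDensity x₀ y *
      (w ((extChartAt (𝓡 n) x₀).symm y) *
        laplacianIn (n := n) x₀ f ((extChartAt (𝓡 n) x₀).symm y)) =
        ∫ y, ∑ i, ∑ j, partialDeriv i (gradFlux x₀ f i j) y * W y := by
      refine Eq.trans ?_ (setIntegral_eq_integral_of_forall_compl_eq_zero
        (s := (extChartAt (𝓡 n) x₀).target) ?_)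
      · refine setIntegral_congr_fun ho.measurableSet fun y hy ↦ ?_
        simp only [laplacianIn]
        rw [(extChartAt (𝓡 n) x₀).right_inv hy, hW, (chartExtend_eventuallyEq hy).eq_of_nhds,
          Function.comp_apply]
        simp_rw [← Finset.sum_mul]
        field_simp [(volumeDensity_pos hy).ne']
      · intro y hy
        have : W y = 0 := indicator_of_notMem hy _
        simp [this]
    have e2 : ∫ y in (extChartAt (𝓡 n) x₀).target, volumeDensity x₀ y *
        inner ℝ (grad n w ((extChartAt (𝓡 n) x₀).symm y))
          (grad n f ((extChartAt (𝓡 n) x₀).symm y)) =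
        ∫ y, ∑ i, ∑ j, gradFlux x₀ f i j y * partialDeriv i W y := by
      refine Eq.trans ?_ (setIntegral_eq_integral_of_forall_compl_eq_zero
        (s := (extChartAt (𝓡 n) x₀).target) ?_)
      · refine setIntegral_congr_fun ho.measurableSet fun y hy ↦ ?_
        simp only [volumeDensity_mul_inner_grad hy hw1 hf1, hWd y hy]
      · intro y hy
        simp [hW0 y fun h ↦ hy (hKt h)]
    rw [e1, e2, integral_finsetSum _ fun i _ ↦ integrable_finsetSum _ fun j _ ↦ hi1 i j,
      integral_finsetSum _ fun i _ ↦ integrable_finsetSum _ fun j _ ↦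
        hi2 i j, ← Finset.sum_neg_distrib]
    refine Finset.sum_congr rfl fun i _ ↦ ?_
    rw [integral_finsetSum _ fun j _ ↦ hi1 i j, integral_finsetSum _ fun j _ ↦
      hi2 i j, ← Finset.sum_neg_distrib]
    refine Finset.sum_congr rfl fun j _ ↦ ?_
    rw [hparts, neg_neg]
  · exact (contMDiff_inner_grad (k := 0) hw1 hf1).continuous.aestronglyMeasurable
  · intro x hx
    rw [grad_eq_zero_of_eventuallyEq_zero (hw0 x hx), inner_zero_left]
  · exact (hw1.continuous.continuousOn.mul (continuousOn_laplacianIn x₀ hf)).aestronglyMeasurable hs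
  · intro x hx
    rw [(hw0 x hx).eq_of_nhds, Pi.zero_apply, zero_mul]

end

/-! ### Green's formula -/

section
variable {n : ℕ} {M : Type*} [TopologicalSpace M] [ChartedSpace (EuclideanSpace ℝ (Fin n)) M]
  [IsManifold (𝓡 n) ∞ M]

/-- A finite smooth partition of unity on a closed subset of a compact manifold, subordinate to a
choice of neighbourhoods of its points. -/
lemma exists_finite_partition [T2Space M] [CompactSpace M] {s : Set M} (hs : IsClosed s)
    (U : M → Set M)
    (hU : ∀ x ∈ s, IsOpen (U x) ∧ x ∈ U x) :
    ∃ (t : Finset M) (ρ : t → M → ℝ), (∀ i : t, (i : M) ∈ s) ∧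
      (∀ i, ContMDiff (𝓡 n) 𝓘(ℝ, ℝ) ∞ (ρ i)) ∧
      (∀ i x, 0 ≤ ρ i x) ∧ (∀ i, tsupport (ρ i) ⊆ U i) ∧ ∀ x ∈ s, ∑ i, ρ i x = 1 := by
  obtain ⟨t, hts, hcov⟩ := hs.isCompact.elim_nhds_subcover U fun x hx ↦
    (hU x hx).1.mem_nhds (hU x hx).2
  obtain ⟨ρ, hρ⟩ := SmoothPartitionOfUnity.exists_isSubordinate (𝓡 n) hs (fun i : t ↦ U i)
    (fun i ↦ (hU i (hts i i.2)).1) (by simpa [iUnion_subtype] using hcov)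
  refine ⟨t, fun i ↦ ρ i, fun i ↦ hts _ i.2, fun i ↦ (ρ i).contMDiff, fun i x ↦
    ρ.nonneg i x, hρ, fun x hx ↦ ?_⟩
  rw [← ρ.sum_eq_one hx, finsum_eq_sum_of_fintype]

variable [RiemannianBundle (fun x : M ↦ TangentSpace (𝓡 n) x)]

lemma grad_add {f h : M → ℝ} {x : M} (hf : MDifferentiableAt (𝓡 n) 𝓘(ℝ, ℝ) f x)
    (hh : MDifferentiableAt (𝓡 n) 𝓘(ℝ, ℝ) h x) :
    grad n (fun x ↦ f x + h x) x = grad n f x + grad n h x := by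
  refine ext_inner_right ℝ fun v ↦ ?_
  rw [inner_add_left, inner_grad, inner_grad, inner_grad]
  exact congrArg (fun L : TangentSpace (𝓡 n) x →L[ℝ] ℝ ↦ L v) (mfderiv_add hf hh)

lemma grad_mul {f h : M → ℝ} {x : M} (hf : MDifferentiableAt (𝓡 n) 𝓘(ℝ, ℝ) f x)
    (hh : MDifferentiableAt (𝓡 n) 𝓘(ℝ, ℝ) h x) :
    grad n (fun x ↦ f x * h x) x = f x • grad n h x + h x • grad n f x := by
  refine ext_inner_right ℝ fun v ↦ ?_
  rw [inner_add_left, inner_smul_left, inner_smul_left, inner_grad, inner_grad, inner_grad]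
  exact congrArg (fun L : TangentSpace (𝓡 n) x →L[ℝ] ℝ ↦ L v)
    (hf.hasMFDerivAt.mul hh.hasMFDerivAt).mfderiv

lemma grad_comp {f : M → ℝ} {s : ℝ → ℝ} {x : M} (hf : MDifferentiableAt (𝓡 n) 𝓘(ℝ, ℝ) f x)
    {s' : ℝ} (hs : HasDerivAt s s' (f x)) :
    grad n (fun x ↦ s (f x)) x = s' • grad n f x := by
  refine ext_inner_right ℝ fun v ↦ ?_
  rw [inner_smul_left, inner_grad, inner_grad]
  have h1 := mfderiv_comp x hs.differentiableAt.mdifferentiableAt hf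
  rw [mfderiv_eq_fderiv] at h1
  refine (congrArg (fun L : TangentSpace (𝓡 n) x →L[ℝ] ℝ ↦ L v) h1).trans ?_
  have key : ∀ r : ℝ, fderiv ℝ s (f x) r = s' * r := fun r ↦ by
    rw [hs.hasFDerivAt.fderiv]; simp [mul_comm]
  exact key _

variable
    [IsContMDiffRiemannianBundle (𝓡 n) ∞ (EuclideanSpace ℝ (Fin n))
      (fun x : M ↦ TangentSpace (𝓡 n) x)]

variable [T2Space M] [CompactSpace M] [MeasurableSpace M] [BorelSpace M]

/-- The Laplacian does not depend on the chart. This follows from integration by parts: the two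
expressions have the same integral against every test function supported in both charts. -/
lemma laplacianIn_eqOn (x₁ x₀ : M) {f : M → ℝ} (hf : ContMDiff (𝓡 n) 𝓘(ℝ, ℝ) 2 f) :
    EqOn (laplacianIn (n := n) x₁ f) (laplacianIn (n := n) x₀ f)
      ((extChartAt (𝓡 n) x₁).source ∩ (extChartAt (𝓡 n) x₀).source) := by
  set U := (extChartAt (𝓡 n) x₁).source ∩ (extChartAt (𝓡 n) x₀).source with hU
  have hUo : IsOpen U := (isOpen_extChartAt_source x₁).inter (isOpen_extChartAt_source x₀)
  have hc1 := (continuousOn_laplacianIn x₁ hf).mono (inter_subset_left : U ⊆ _)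
  have hc0 := (continuousOn_laplacianIn x₀ hf).mono (inter_subset_right : U ⊆ _)
  have hae : ∀ᵐ x ∂(volumeMeasure n M), x ∈ U →
      laplacianIn (n := n) x₁ f x - laplacianIn (n := n) x₀ f x = 0 := by
    refine hUo.ae_eq_zero_of_integral_contMDiff_smul_eq_zero (𝓡 n)
      ((hc1.sub hc0).locallyIntegrableOn hUo.measurableSet) fun w hw hwc hwU ↦ ?_
    have hw1 : ContMDiff (𝓡 n) 𝓘(ℝ, ℝ) 1 w := hw.of_le (by simp)
    have hi : ∀ y, U ⊆ (extChartAt (𝓡 n) y).source →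
        Integrable (fun x ↦ w x * laplacianIn (n := n) y f x) (volumeMeasure n M) := by
      intro y hy
      have : Continuous (fun x ↦ w x * laplacianIn (n := n) y f x) := by
        refine continuous_iff_continuousAt.2 fun x ↦ ?_
        by_cases hx : x ∈ (extChartAt (𝓡 n) y).source
        · exact hw.continuous.continuousAt.mul ((continuousOn_laplacianIn y hf).continuousAt
            ((isOpen_extChartAt_source y).mem_nhds hx))
        · refine (continuousAt_const (y := (0 : ℝ))).congr ?_
          filter_upwards [notMem_tsupport_iff_eventuallyEq.1 fun h ↦ hx (hy (hwU h))] with z hz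
          simp [hz]
      exact this.integrable_of_hasCompactSupport (HasCompactSupport.of_compactSpace _)
    simp_rw [smul_eq_mul, mul_sub]
    rw [integral_sub (hi x₁ inter_subset_left) (hi x₀ inter_subset_right),
      integral_mul_laplacianIn (hwU.trans inter_subset_left) hw1 hf,
      integral_mul_laplacianIn (hwU.trans inter_subset_right) hw1 hf, sub_self]
  refine Measure.eqOn_open_of_ae_eq (μ := volumeMeasure n M) ?_ hUo hc1 hc0
  rw [EventuallyEq, ae_restrict_iff' hUo.measurableSet]
  exact hae.mono fun x hx hxU ↦ sub_eq_zero.1 (hx hxU)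

lemma laplacian_eq_laplacianIn_of_mem {x₀ x : M} (hx : x ∈ (extChartAt (𝓡 n) x₀).source) {f : M → ℝ}
    (hf : ContMDiff (𝓡 n) 𝓘(ℝ, ℝ) 2 f) : laplacian n f x = laplacianIn (n := n) x₀ f x :=
  laplacianIn_eqOn x x₀ hf ⟨mem_extChartAt_source x, hx⟩

lemma continuous_laplacian {f : M → ℝ} (hf : ContMDiff (𝓡 n) 𝓘(ℝ, ℝ) 2 f) :
    Continuous (laplacian n f) := by
  refine continuous_iff_continuousAt.2 fun x ↦ ?_
  have hm := (isOpen_extChartAt_source (I := 𝓡 n) x).mem_nhds (mem_extChartAt_source x)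
  refine ((continuousOn_laplacianIn x hf).continuousAt hm).congr ?_
  filter_upwards [hm] with z hz using (laplacian_eq_laplacianIn_of_mem hz hf).symm

lemma integrable_of_continuous {f : M → ℝ} (hf : Continuous f) : Integrable f (volumeMeasure n M) :=
  hf.integrable_of_hasCompactSupport (HasCompactSupport.of_compactSpace _)

lemma continuous_inner_grad {w f : M → ℝ} (hw : ContMDiff (𝓡 n) 𝓘(ℝ, ℝ) 1 w)
    (hf : ContMDiff (𝓡 n) 𝓘(ℝ, ℝ) 1 f) :
    Continuous fun x ↦ inner ℝ (grad n w x) (grad n f x) :=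
  (contMDiff_inner_grad (k := 0) hw hf).continuous

/-- Green's formula on a compact manifold: `∫ w Δf = -∫ ⟪∇w, ∇f⟫`. -/
theorem integral_mul_laplacian {w f : M → ℝ} (hw : ContMDiff (𝓡 n) 𝓘(ℝ, ℝ) 1 w)
    (hf : ContMDiff (𝓡 n) 𝓘(ℝ, ℝ) 2 f) :
    ∫ x, w x * laplacian n f x ∂(volumeMeasure n M) =
      -∫ x, inner ℝ (grad n w x) (grad n f x) ∂(volumeMeasure n M) := by
  have hf1 : ContMDiff (𝓡 n) 𝓘(ℝ, ℝ) 1 f := hf.of_le (by norm_num)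
  obtain ⟨t, ρ, -, hρ, -, hsub, hsum⟩ := exists_finite_partition (n := n) (isClosed_univ (X := M))
    (fun x ↦ (extChartAt (𝓡 n) x).source) fun x _ ↦
      ⟨isOpen_extChartAt_source x, mem_extChartAt_source x⟩
  let P : (M → ℝ) → Prop := fun w ↦ ContMDiff (𝓡 n) 𝓘(ℝ, ℝ) 1 w ∧ ∫ x, w x *
    laplacian n f x ∂(volumeMeasure n M) =
      -∫ x, inner ℝ (grad n w x) (grad n f x) ∂(volumeMeasure n M)
  have hint : ∀ {a : M → ℝ}, Continuous a →
      Integrable (fun x ↦ a x * laplacian n f x) (volumeMeasure n M) := fun ha ↦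
    integrable_of_continuous (ha.mul (continuous_laplacian hf))
  have hP : P (∑ i, fun x ↦ ρ i x * w x) := by
    refine Finset.sum_induction _ P ?_ ?_ fun i _ ↦ ?_
    · rintro a b ⟨ha, ha'⟩ ⟨hb, hb'⟩
      refine ⟨ha.add hb, ?_⟩
      have hg : ∀ x, inner ℝ (grad n (a + b) x) (grad n f x) =
          inner ℝ (grad n a x) (grad n f x) + inner ℝ (grad n b x) (grad n f x) := fun x ↦ by
        rw [← inner_add_left, ← grad_add (mdifferentiable_of_contMDiff ha x)
          (mdifferentiable_of_contMDiff hb x)]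
        rfl
      simp_rw [hg, Pi.add_apply, add_mul]
      rw [integral_add (hint ha.continuous) (hint hb.continuous),
        integral_add (integrable_of_continuous (continuous_inner_grad ha hf1))
        (integrable_of_continuous (continuous_inner_grad hb hf1)), ha', hb', neg_add]
    · refine ⟨contMDiff_const, ?_⟩
      have hg : ∀ x, grad n (0 : M → ℝ) x = 0 := fun x ↦
        grad_eq_zero_of_eventuallyEq_zero (EventuallyEq.refl _ _)
      simp [hg]
    · have h1 : ContMDiff (𝓡 n) 𝓘(ℝ, ℝ) 1 (fun x ↦ ρ i x * w x) := ((hρ i).of_le (by simp)).mul hw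
      have h2 : tsupport (fun x ↦ ρ i x * w x) ⊆ (extChartAt (𝓡 n) (i : M)).source :=
        (tsupport_mul_subset_left (f := ρ i) (g := w)).trans (hsub i)
      refine ⟨h1, ?_⟩
      rw [← integral_mul_laplacianIn h2 h1 hf]
      refine integral_congr_ae (.of_forall fun x ↦ ?_)
      by_cases hx : x ∈ tsupport (fun x ↦ ρ i x * w x)
      · simp only [laplacian_eq_laplacianIn_of_mem (h2 hx) hf]
      · have := image_eq_zero_of_notMem_tsupport hx
        simp [this]
  have hw' : (∑ i, fun x ↦ ρ i x * w x) = w := by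
    ext x
    rw [Finset.sum_apply, ← Finset.sum_mul, hsum x (mem_univ x), one_mul]
  rw [hw'] at hP
  exact hP.2

end

/-! ### The Riemannian distance in a chart -/

section
variable {n : ℕ} {M : Type*} [EMetricSpace M] [ChartedSpace (EuclideanSpace ℝ (Fin n)) M]
  [IsManifold (𝓡 n) ∞ M]
  [RiemannianBundle (fun x : M ↦ TangentSpace (𝓡 n) x)]

lemma norm_mfderiv_congr {F : Type*} [NormedAddCommGroup F] [NormedSpace ℝ F] {f g : F → M} {y : F}
    (h : f =ᶠ[𝓝 y] g) (v : F) :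
    ‖mfderiv 𝓘(ℝ, F) (𝓡 n) f y v‖ = ‖mfderiv 𝓘(ℝ, F) (𝓡 n) g y v‖ := by
  rw [norm_eq_sqrt_real_inner, norm_eq_sqrt_real_inner, inner_mfderiv_congr h]

variable
    [IsContMDiffRiemannianBundle (𝓡 n) ∞ (EuclideanSpace ℝ (Fin n))
      (fun x : M ↦ TangentSpace (𝓡 n) x)]

/-- Near `p` the metric is close to its value at `p`, which is given by the linear map `T`. -/
lemma eventually_norm_chartDeriv_le {p : M}
    {T : EuclideanSpace ℝ (Fin n) ≃L[ℝ] EuclideanSpace ℝ (Fin n)}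
    (hT : ∀ v, ‖T v‖ = ‖chartDeriv p (extChartAt (𝓡 n) p p) v‖) {K : ℝ≥0} (hK : 1 < K) :
    ∀ᶠ y in 𝓝 (extChartAt (𝓡 n) p p), ∀ v,
      ‖chartDeriv p y v‖ ≤ K * ‖T v‖ ∧ ‖T v‖ ≤ K * ‖chartDeriv p y v‖ := by
  set y₀ := extChartAt (𝓡 n) p p with hy₀
  set D : EuclideanSpace ℝ (Fin n) → ℝ := fun y ↦
    ∑ i, ∑ j, |metricMatrix p y i j - metricMatrix p y₀ i j| with hD
  set C := ‖(T.symm : EuclideanSpace ℝ (Fin n) →L[ℝ] EuclideanSpace ℝ (Fin n))‖ with hC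
  have hKr : (1 : ℝ) < K := by exact_mod_cast hK
  have hDc : Tendsto (fun y ↦ D y * C ^ 2) (𝓝 y₀) (𝓝 0) := by
    have hc : ContinuousAt (fun y ↦ D y * C ^ 2) y₀ := by
      refine ContinuousAt.mul (tendsto_finsetSum _ fun i _ ↦ tendsto_finsetSum _ fun j _ ↦ ?_)
        continuousAt_const
      exact (((contDiffOn_metricMatrix p i j).continuousOn.continuousAt
        (extChartAt_target_mem_nhds (I := 𝓡 n) p)).sub continuousAt_const).abs
    have h0 : D y₀ * C ^ 2 = 0 := by simp [hD]
    rw [← h0]; exact hc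
  have hε : 0 < 1 - ((K : ℝ) ^ 2)⁻¹ := by
    have : ((K : ℝ) ^ 2)⁻¹ < 1 := inv_lt_one_of_one_lt₀ (by nlinarith)
    linarith
  filter_upwards [hDc.eventually_lt_const hε] with y hy v
  have hsq : ∀ y, ‖chartDeriv p y v‖ ^ 2 = ∑ i, ∑ j, v i * v j * metricMatrix p y i j := fun y ↦ by
    rw [← real_inner_self_eq_norm_sq, inner_chartDeriv]
  have hv : ‖v‖ ≤ C * ‖T v‖ := by
    have := (T.symm : EuclideanSpace ℝ (Fin n) →L[ℝ] EuclideanSpace ℝ (Fin n)).le_opNorm (T v)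
    simpa using this
  have hdiff : |‖chartDeriv p y v‖ ^ 2 - ‖T v‖ ^ 2| ≤ D y * C ^ 2 * ‖T v‖ ^ 2 := by
    have hTs : ‖T v‖ ^ 2 = ∑ i, ∑ j, v i * v j * metricMatrix p y₀ i j := by rw [hT, hsq]
    calc |‖chartDeriv p y v‖ ^ 2 - ‖T v‖ ^ 2|
        = |∑ i, (∑ j, v i * v j * metricMatrix p y i j - ∑ j, v i * v j * metricMatrix p y₀ i j)| :=
          by
          rw [hsq, hTs, ← Finset.sum_sub_distrib]
      _ ≤ ∑ i, ∑ j, |metricMatrix p y i j - metricMatrix p y₀ i j| * ‖v‖ ^ 2 := by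
          refine (Finset.abs_sum_le_sum_abs _ _).trans (Finset.sum_le_sum fun i _ ↦ ?_)
          rw [← Finset.sum_sub_distrib]
          refine (Finset.abs_sum_le_sum_abs _ _).trans (Finset.sum_le_sum fun j _ ↦ ?_)
          rw [← mul_sub, abs_mul, mul_comm]
          gcongr
          rw [abs_mul, sq]
          exact mul_le_mul (PiLp.norm_apply_le v i) (PiLp.norm_apply_le v j) (abs_nonneg _)
            (norm_nonneg _)
      _ = D y * ‖v‖ ^ 2 := by simp only [hD, Finset.sum_mul]
      _ ≤ D y * (C * ‖T v‖) ^ 2 := by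
          have : 0 ≤ D y := Finset.sum_nonneg fun i _ ↦ Finset.sum_nonneg fun j _ ↦ abs_nonneg _
          gcongr
      _ = D y * C ^ 2 * ‖T v‖ ^ 2 := by ring
  have hb := abs_le.1 (hdiff.trans (mul_le_mul_of_nonneg_right hy.le (sq_nonneg ‖T v‖)))
  have hK2 : ((K : ℝ) ^ 2)⁻¹ * (K : ℝ) ^ 2 = 1 := inv_mul_cancel₀ (by positivity)
  have hi : 0 < ((K : ℝ) ^ 2)⁻¹ := by positivity
  constructor
  · refine le_of_sq_le_sq ?_ (by positivity)
    rw [mul_pow]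
    nlinarith [sq_nonneg ‖T v‖, hb.2, sq_nonneg ((K : ℝ) ^ 2 - 1)]
  · refine le_of_sq_le_sq ?_ (by positivity)
    rw [mul_pow]
    have h1 : ((K : ℝ) ^ 2)⁻¹ * ‖T v‖ ^ 2 ≤ ‖chartDeriv p y v‖ ^ 2 := by linarith [hb.1]
    calc ‖T v‖ ^ 2 = (K : ℝ) ^ 2 * (((K : ℝ) ^ 2)⁻¹ * ‖T v‖ ^ 2) := by
          rw [← mul_assoc, mul_comm ((K : ℝ) ^ 2), hK2, one_mul]
      _ ≤ _ := by gcongr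

variable [IsRiemannianManifold (𝓡 n) M]

/-- On a convex set of coordinates where the metric is at most `K²` times the flat metric of `T`,
the inverse of the chart is `K`-Lipschitz: the image of a segment is a competitor for the
Riemannian distance. -/
lemma edist_symm_le {p : M}
    {T : EuclideanSpace ℝ (Fin n) ≃L[ℝ] EuclideanSpace ℝ (Fin n)} {K : ℝ≥0}
      {B : Set (EuclideanSpace ℝ (Fin n))}
    (hB : Convex ℝ B) (hBt : B ⊆ (extChartAt (𝓡 n) p).target)
    (hT : ∀ y ∈ B, ∀ v, ‖chartDeriv p y v‖ ≤ K * ‖T v‖) {y z : EuclideanSpace ℝ (Fin n)}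
      (hy : y ∈ B) (hz : z ∈ B) :
    edist ((extChartAt (𝓡 n) p).symm y) ((extChartAt (𝓡 n) p).symm z) ≤ K * edist (T y) (T z) := by
  rw [IsRiemannianManifold.out (I := 𝓡 n)]
  set η : ℝ → EuclideanSpace ℝ (Fin n) := fun t ↦ AffineMap.lineMap (k := ℝ) y z t with hη
  have hηB : ∀ t ∈ Icc (0 : ℝ) 1, η t ∈ B := fun t ht ↦ hB.lineMap_mem hy hz ht
  have hηd : ∀ t, HasDerivAt η (z - y) t := fun t ↦ AffineMap.hasDerivAt_lineMap
  have hηs : ContDiff ℝ 1 η := (ContinuousAffineMap.lineMap (R := ℝ) y z).contDiff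
  have hlen : riemannianEDist (𝓡 n) ((extChartAt (𝓡 n) p).symm y) ((extChartAt (𝓡 n) p).symm z) ≤
      pathELength (𝓡 n) ((extChartAt (𝓡 n) p).symm ∘ η) 0 1 := by
    refine riemannianEDist_le_pathELength ?_ (by simp [hη]) (by simp [hη]) zero_le_one
    exact ((contMDiffOn_symm p).of_le (by simp)).comp hηs.contMDiff.contMDiffOn fun t ht ↦
      hBt (hηB t ht)
  refine hlen.trans ?_
  rw [pathELength_eq_lintegral_mfderiv_Icc]
  calc ∫⁻ t in Icc (0 : ℝ) 1, ‖mfderiv 𝓘(ℝ, ℝ) (𝓡 n) ((extChartAt (𝓡 n) p).symm ∘ η) t 1‖ₑ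
      ≤ ∫⁻ t in Icc (0 : ℝ) 1, K * edist (T y) (T z) := by
        refine setLIntegral_mono' measurableSet_Icc fun t ht ↦ ?_
        have hc := mfderiv_comp t (mdifferentiableAt_symm (hBt (hηB t ht)))
          (hηd t).differentiableAt.mdifferentiableAt
        have h1 : ‖mfderiv 𝓘(ℝ, ℝ) (𝓡 n) ((extChartAt (𝓡 n) p).symm ∘ η) t 1‖ =
            ‖chartDeriv p (η t) (z - y)‖ := by
          rw [hc, mfderiv_eq_fderiv]
          have : fderiv ℝ η t 1 = z - y := by rw [(hηd t).hasFDerivAt.fderiv]; simp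
          rw [← this]
          rfl
        rw [← ofReal_norm, h1, edist_comm, edist_dist, dist_eq_norm, ← map_sub]
        rw [← ENNReal.ofReal_coe_nnreal, ← ENNReal.ofReal_mul (by positivity)]
        exact ENNReal.ofReal_le_ofReal (hT _ (hηB t ht) _)
    _ = K * edist (T y) (T z) := by simp

/-- If the flat metric of `T` is at most `K²` times the Riemannian metric on a ball of radius `3
r`, then the chart is `K`-Lipschitz on the ball of radius `r`: a nearly shortest curve between two
points of the small ball does not leave the large one. -/
lemma edist_chart_le {p : M}
    {T : EuclideanSpace ℝ (Fin n) ≃L[ℝ] EuclideanSpace ℝ (Fin n)} {K : ℝ≥0} (hK : K ≠ 0) {r : ℝ≥0∞}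
    (hr : Metric.eball p (3 * r) ⊆ (extChartAt (𝓡 n) p).source)
    (hT : ∀ x ∈ Metric.eball p (3 * r), ∀ v, ‖T v‖ ≤ K *
      ‖chartDeriv p (extChartAt (𝓡 n) p x) v‖) {x z : M}
    (hx : x ∈ Metric.eball p r) (hz : z ∈ Metric.eball p r) :
    edist (T (extChartAt (𝓡 n) p x)) (T (extChartAt (𝓡 n) p z)) ≤ K * edist x z := by
  have hxz : edist x z < 2 * r := by
    rw [two_mul]
    exact (edist_triangle_right x z p).trans_lt (ENNReal.add_lt_add hx hz)
  have hK' : (K : ℝ≥0∞) ≠ 0 := by simpa using hK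
  rw [mul_comm, ← ENNReal.div_le_iff_le_mul (.inl hK') (.inl ENNReal.coe_ne_top)]
  refine le_of_forall_gt_imp_ge_of_dense fun c hc ↦ ?_
  -- a curve from `x` to `z` shorter than `2 r` stays in the ball of radius `3 r`
  have hc' : riemannianEDist (𝓡 n) x z < min c (2 * r) := by
    rw [← IsRiemannianManifold.out (I := 𝓡 n)]
    exact lt_min hc hxz
  obtain ⟨γ, γ0, γ1, hγ, hlen, -⟩ := exists_lt_locally_constant_of_riemannianEDist_lt hc'
    zero_lt_one
  have hmem : ∀ t ∈ Icc (0 : ℝ) 1, γ t ∈ Metric.eball p (3 * r) := by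
    intro t ht
    have h1 : edist x (γ t) ≤ pathELength (𝓡 n) γ 0 t := by
      rw [IsRiemannianManifold.out (I := 𝓡 n)]
      exact riemannianEDist_le_pathELength hγ.contMDiffOn γ0 rfl ht.1
    have h2 : edist x (γ t) < 2 * r :=
      (h1.trans (pathELength_mono le_rfl ht.2)).trans_lt (hlen.trans_le (min_le_right _ _))
    have h3 : (3 : ℝ≥0∞) * r = 2 * r + r := by ring
    rw [Metric.mem_eball, h3]
    refine (edist_triangle (γ t) x p).trans_lt (ENNReal.add_lt_add ?_ hx)
    rwa [edist_comm]
  set c₁ : ℝ → EuclideanSpace ℝ (Fin n) := extChartAt (𝓡 n) p ∘ γ with hc₁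
  have hc₁s : ContDiffOn ℝ 1 c₁ (Icc 0 1) := by
    rw [← contMDiffOn_iff_contDiffOn]
    refine ContMDiffOn.comp (t := (extChartAt (𝓡 n) p).source) ?_ hγ.contMDiffOn fun t ht ↦
      hr (hmem t ht)
    rw [extChartAt_source]
    exact contMDiffOn_extChartAt
  have hderiv : ∀ t ∈ Icc (0 : ℝ) 1, ‖deriv (T ∘ c₁) t‖ₑ ≤ K * ‖mfderiv 𝓘(ℝ, ℝ) (𝓡 n) γ t 1‖ₑ := by
    intro t ht
    have hsrc := hr (hmem t ht)
    have hev : γ =ᶠ[𝓝 t] (extChartAt (𝓡 n) p).symm ∘ c₁ := by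
      filter_upwards [hγ.continuous.continuousAt.preimage_mem_nhds
        ((isOpen_extChartAt_source (I := 𝓡 n) p).mem_nhds hsrc)] with s hs
      exact ((extChartAt (𝓡 n) p).left_inv hs).symm
    have hcd : DifferentiableAt ℝ c₁ t := by
      rw [← mdifferentiableAt_iff_differentiableAt]
      exact MDifferentiableAt.comp t (mdifferentiableAt_extChartAt
        (by rwa [extChartAt_source] at hsrc))
        (hγ.mdifferentiable one_ne_zero t)
    have hc := mfderiv_comp t (mdifferentiableAt_symm ((extChartAt (𝓡 n) p).map_source hsrc))
      hcd.mdifferentiableAt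
    have h1 : ‖mfderiv 𝓘(ℝ, ℝ) (𝓡 n) γ t 1‖ = ‖chartDeriv p (c₁ t) (deriv c₁ t)‖ := by
      refine (norm_mfderiv_congr hev (1 : ℝ)).trans ?_
      rw [hc, mfderiv_eq_fderiv]
      rfl
    rw [← ofReal_norm, ← ofReal_norm, h1, ← ENNReal.ofReal_coe_nnreal,
      ← ENNReal.ofReal_mul (by positivity)]
    refine ENNReal.ofReal_le_ofReal ?_
    have h2 : deriv (T ∘ c₁) t = T (deriv c₁ t) :=
      ((T : EuclideanSpace ℝ (Fin n) →L[ℝ] EuclideanSpace ℝ (Fin n)).hasFDerivAt.comp_hasDerivAt t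
        hcd.hasDerivAt).deriv
    rw [h2]
    exact hT _ (hmem t ht) _
  have hA : edist (T (extChartAt (𝓡 n) p x)) (T (extChartAt (𝓡 n) p z)) ≤ K * c := by
    have h0 : (T ∘ c₁) 0 = T (extChartAt (𝓡 n) p x) := by simp [hc₁, γ0]
    have h1 : (T ∘ c₁) 1 = T (extChartAt (𝓡 n) p z) := by simp [hc₁, γ1]
    rw [edist_comm, ← h0, ← h1, edist_eq_enorm_sub]
    calc ‖(T ∘ c₁) 1 - (T ∘ c₁) 0‖ₑ ≤ ∫⁻ t in Icc (0 : ℝ) 1, ‖deriv (T ∘ c₁) t‖ₑ :=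
          enorm_sub_le_lintegral_deriv_of_contDiffOn_Icc (T.contDiff.comp_contDiffOn hc₁s)
            zero_le_one
      _ ≤ ∫⁻ t in Icc (0 : ℝ) 1, K * ‖mfderiv 𝓘(ℝ, ℝ) (𝓡 n) γ t 1‖ₑ :=
          setLIntegral_mono' measurableSet_Icc hderiv
      _ = K * pathELength (𝓡 n) γ 0 1 := by
          rw [lintegral_const_mul' _ _ ENNReal.coe_ne_top, pathELength_eq_lintegral_mfderiv_Icc]
      _ ≤ K * c := by
          gcongr
          exact (hlen.trans_le (min_le_left _ _)).le
  exact ENNReal.div_le_of_le_mul' hA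
end

/-! ### Linearized charts -/

section Linear
variable {V : Type*} [NormedAddCommGroup V] [NormedSpace ℝ V]

/-- A strictly differentiable map distorts small distances as its derivative does, up to a factor
close to one. -/
lemma eventually_norm_sub_le_of_hasStrictFDerivAt {F : V → V} {T : V ≃L[ℝ] V} {y₀ : V}
    (hF : HasStrictFDerivAt F (T : V →L[ℝ] V) y₀) {K : ℝ≥0} (hK : 1 < K) :
    ∀ᶠ q : V × V in 𝓝 (y₀, y₀), edist (F q.1) (F q.2) ≤ K * edist (T q.1) (T q.2) ∧
      edist (T q.1) (T q.2) ≤ K * edist (F q.1) (F q.2) := by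
  have hKr : (1 : ℝ) < K := by exact_mod_cast hK
  set C := ‖(T.symm : V →L[ℝ] V)‖ with hC
  have hε : 0 < 1 - (K : ℝ)⁻¹ := sub_pos.2 (inv_lt_one_of_one_lt₀ hKr)
  have hc : 0 < (1 - (K : ℝ)⁻¹) / (C + 1) := by positivity
  filter_upwards [hF.isLittleO.def hc] with q hq
  have hv : ‖q.1 - q.2‖ ≤ C * ‖T (q.1 - q.2)‖ := by
    simpa using (T.symm : V →L[ℝ] V).le_opNorm (T (q.1 - q.2))
  have h1 : ‖F q.1 - F q.2 - T (q.1 - q.2)‖ ≤ (1 - (K : ℝ)⁻¹) * ‖T (q.1 - q.2)‖ := by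
    refine hq.trans ?_
    calc (1 - (K : ℝ)⁻¹) / (C + 1) * ‖q.1 - q.2‖ ≤ (1 - (K : ℝ)⁻¹) / (C + 1) *
        ((C + 1) * ‖T (q.1 - q.2)‖) := by
          gcongr
          exact hv.trans (by gcongr; linarith)
      _ = _ := by rw [← mul_assoc, div_mul_cancel₀ _ (by positivity)]
  have h2 := norm_sub_norm_le (F q.1 - F q.2) (T (q.1 - q.2))
  have h3 := norm_sub_norm_le (T (q.1 - q.2)) (F q.1 - F q.2)
  rw [norm_sub_rev (T _)] at h3
  have hi : (K : ℝ) * (K : ℝ)⁻¹ = 1 := mul_inv_cancel₀ (by positivity)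
  have hi0 : 0 < (K : ℝ)⁻¹ := by positivity
  have ht := norm_nonneg (T (q.1 - q.2))
  simp only [edist_dist, dist_eq_norm, ← map_sub T]
  rw [← ENNReal.ofReal_coe_nnreal, ← ENNReal.ofReal_mul (by positivity),
    ← ENNReal.ofReal_mul (by positivity)]
  constructor <;> refine ENNReal.ofReal_le_ofReal ?_
  · have h4 : 1 - (K : ℝ)⁻¹ ≤ K - 1 := by nlinarith
    nlinarith [mul_le_mul_of_nonneg_right h4 ht]
  · have h4 : (K : ℝ)⁻¹ * ‖T (q.1 - q.2)‖ ≤ ‖F q.1 - F q.2‖ := by nlinarith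
    calc ‖T (q.1 - q.2)‖ = K * ((K : ℝ)⁻¹ * ‖T (q.1 - q.2)‖) := by rw [← mul_assoc, hi, one_mul]
      _ ≤ _ := by gcongr

end Linear

section
variable {m : ℕ} {M : Type*} [TopologicalSpace M] [ChartedSpace (EuclideanSpace ℝ (Fin (m + 1))) M]
  [IsManifold (𝓡 (m + 1)) ∞ M]
  [RiemannianBundle (fun x : M ↦ TangentSpace (𝓡 (m + 1)) x)]

/-- There are linear coordinates `T` on the coordinate space which are orthonormal for the metric
at `p` and whose first axis points along `∇φ`. -/
lemma exists_isometry_chart {φ : M → ℝ} {p : M} (hφ : MDifferentiableAt (𝓡 (m + 1)) 𝓘(ℝ, ℝ) φ p)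
    (hg : grad (m + 1) φ p ≠ 0) :
    ∃ T : EuclideanSpace ℝ (Fin (m + 1)) ≃L[ℝ] EuclideanSpace ℝ (Fin (m + 1)),
      (∀ v w, inner ℝ (T v) (T w) = inner ℝ (chartDeriv p (extChartAt (𝓡 (m + 1)) p p) v)
        (chartDeriv p (extChartAt (𝓡 (m + 1)) p p) w)) ∧
      ∀ v, T v 0 = ‖grad (m + 1) φ p‖⁻¹ *
        fderiv ℝ (φ ∘ (extChartAt (𝓡 (m + 1)) p).symm) (extChartAt (𝓡 (m + 1)) p p) v := by
  set y₀ := extChartAt (𝓡 (m + 1)) p p with hy₀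
  set q := (extChartAt (𝓡 (m + 1)) p).symm y₀ with hq
  have hqp : q = p := extChartAt_to_inv p
  have hy₀t : y₀ ∈ (extChartAt (𝓡 (m + 1)) p).target := mem_extChartAt_target p
  have hnorm : ‖grad (m + 1) φ q‖ = ‖grad (m + 1) φ p‖ := congrArg (fun x ↦ ‖grad (m + 1) φ x‖) hqp
  have hpos : 0 < ‖grad (m + 1) φ q‖ := by rw [hnorm]; exact norm_pos_iff.2 hg
  set ν : TangentSpace (𝓡 (m + 1)) q := ‖grad (m + 1) φ q‖⁻¹ • grad (m + 1) φ q with hν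
  have hν1 : ‖ν‖ = 1 := by
    rw [hν, norm_smul, norm_inv, norm_norm, inv_mul_cancel₀ hpos.ne']
  have hon : Orthonormal ℝ (({0} : Set (Fin (m + 1))).domRestrict fun _ ↦ ν) := by
    refine ⟨fun _ ↦ hν1, fun i j hij ↦ ?_⟩
    exact absurd (Subtype.ext (i.2.trans j.2.symm)) hij
  obtain ⟨b, hb⟩ := hon.exists_orthonormalBasis_extension_of_card_eq (ι := Fin (m + 1))
    (by rw [Fintype.card_fin]; exact finrank_tangentSpace q)
  have hb0 : b 0 = ν := hb 0 rfl
  set A : EuclideanSpace ℝ (Fin (m + 1)) →ₗ[ℝ] EuclideanSpace ℝ (Fin (m + 1)) :=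
    b.repr.toLinearEquiv.toLinearMap ∘ₗ (chartDeriv p y₀).toLinearMap with hA
  have hAinj : Function.Injective A := b.repr.injective.comp (chartDeriv_injective hy₀t)
  refine ⟨(LinearEquiv.ofInjectiveEndo A hAinj).toContinuousLinearEquiv, fun v w ↦ ?_, fun v ↦ ?_⟩
  · exact b.repr.inner_map_map (chartDeriv p y₀ v) (chartDeriv p y₀ w)
  · have h1 : (LinearEquiv.ofInjectiveEndo A hAinj).toContinuousLinearEquiv v 0 =
        inner ℝ (b 0) (chartDeriv p y₀ v) :=
      b.repr_apply_apply _ _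
    have hφq : MDifferentiableAt (𝓡 (m + 1)) 𝓘(ℝ, ℝ) φ q := by rwa [hqp]
    rw [h1, hb0, hν, inner_smul_left, inner_grad, mfderiv_chartDeriv hy₀t hφq, hnorm]
    rfl

/-- Orthonormal coordinates compute the Riemannian density as a Jacobian. -/
lemma abs_det_eq_volumeDensity {n : ℕ} {M : Type*} [TopologicalSpace M]
    [ChartedSpace (EuclideanSpace ℝ (Fin n)) M]
    [RiemannianBundle (fun x : M ↦ TangentSpace (𝓡 n) x)] {p : M} {y : EuclideanSpace ℝ (Fin n)}
    {T : EuclideanSpace ℝ (Fin n) →L[ℝ] EuclideanSpace ℝ (Fin n)}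
    (hT : ∀ v w, inner ℝ (T v) (T w) = inner ℝ (chartDeriv p y v) (chartDeriv p y w)) :
    |T.det| = volumeDensity p y := by
  set A := LinearMap.toMatrix (EuclideanSpace.basisFun (Fin n) ℝ).toBasis
    (EuclideanSpace.basisFun (Fin n) ℝ).toBasis
    T.toLinearMap with hA
  have hG : metricMatrix p y = A.transpose * A := by
    ext i j
    have : metricMatrix p y i j =
        inner ℝ (chartDeriv p y (EuclideanSpace.single i 1))
          (chartDeriv p y (EuclideanSpace.single j 1)) := rfl
    rw [this, ← hT, Matrix.mul_apply, PiLp.inner_apply]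
    refine Finset.sum_congr rfl fun k _ ↦ ?_
    simp [hA, LinearMap.toMatrix_apply, mul_comm]
  rw [volumeDensity, hG, Matrix.det_mul, Matrix.det_transpose, hA, LinearMap.det_toMatrix,
    Real.sqrt_mul_self_eq_abs]
end

/-! ### Almost isometric charts -/

section
variable {m : ℕ} {M : Type*} [EMetricSpace M] [ChartedSpace (EuclideanSpace ℝ (Fin (m + 1))) M]
  [IsManifold (𝓡 (m + 1)) ∞ M]
  [RiemannianBundle (fun x : M ↦ TangentSpace (𝓡 (m + 1)) x)]

variable (m) in
/-- A chart `Θ` whose first coordinate is `φ / c` and which is, up to factors of `K`, an isometry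
for the Riemannian distance, the Riemannian volume and the size `c` of the gradient of `φ`. In
such a chart the nodal set of `φ` is the coordinate hyperplane `z₀ = 0`. -/
structure IsAlmostIsometricChart [MeasurableSpace M] (φ : M → ℝ) (c : ℝ) (K : ℝ≥0)
    (Θ : OpenPartialHomeomorph M (EuclideanSpace ℝ (Fin (m + 1)))) : Prop where
  lipschitz : LipschitzOnWith K Θ Θ.source
  lipschitz_symm : LipschitzOnWith K Θ.symm Θ.target
  apply_zero : ∀ x ∈ Θ.source, Θ x 0 = c⁻¹ * φ x
  norm_grad_le : ∀ x ∈ Θ.source, ‖grad (m + 1) φ x‖ ≤ K * c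
  le_norm_grad : ∀ x ∈ Θ.source, c ≤ K * ‖grad (m + 1) φ x‖
  volume_le : (volumeMeasure (m + 1) M).restrict Θ.source ≤
    (K : ℝ≥0∞) • Measure.map Θ.symm (volume.restrict Θ.target)
  le_volume : Measure.map Θ.symm (volume.restrict Θ.target) ≤
    (K : ℝ≥0∞) • (volumeMeasure (m + 1) M).restrict Θ.source

variable
    [IsContMDiffRiemannianBundle (𝓡 (m + 1)) ∞ (EuclideanSpace ℝ (Fin (m + 1)))
      (fun x : M ↦ TangentSpace (𝓡 (m + 1)) x)] [IsRiemannianManifold (𝓡 (m + 1)) M]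

lemma continuous_norm_grad {n : ℕ} {M : Type*} [TopologicalSpace M]
    [ChartedSpace (EuclideanSpace ℝ (Fin n)) M] [IsManifold (𝓡 n) ∞ M]
    [RiemannianBundle (fun x : M ↦ TangentSpace (𝓡 n) x)]
    [IsContMDiffRiemannianBundle (𝓡 n) ∞ (EuclideanSpace ℝ (Fin n))
      (fun x : M ↦ TangentSpace (𝓡 n) x)]
    {f : M → ℝ} (hf : ContMDiff (𝓡 n) 𝓘(ℝ, ℝ) 1 f) :
    Continuous fun x ↦ ‖grad n f x‖ := by
  simp_rw [norm_eq_sqrt_real_inner]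
  exact (contMDiff_inner_grad (k := 0) hf hf).continuous.sqrt

variable [MeasurableSpace M] [BorelSpace M]

/-- Almost isometric charts exist around every point where `∇φ` does not vanish: take orthonormal
coordinates for the metric at the point, replace the first one by a multiple of `φ`, and shrink
the domain. -/
theorem exists_isAlmostIsometricChart {φ : M → ℝ} (hφ : ContMDiff (𝓡 (m + 1)) 𝓘(ℝ, ℝ) 1 φ) {p : M}
    (hg : grad (m + 1) φ p ≠ 0) {K : ℝ≥0} (hK : 1 < K) :
    ∃ Θ : OpenPartialHomeomorph M (EuclideanSpace ℝ (Fin (m + 1))), p ∈ Θ.source ∧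
      IsAlmostIsometricChart m φ ‖grad (m + 1) φ p‖ K Θ := by
  set ψ := extChartAt (𝓡 (m + 1)) p with hψ
  set y₀ := ψ p with hy₀
  set c := ‖grad (m + 1) φ p‖ with hc
  have hc0 : 0 < c := norm_pos_iff.2 hg
  have hto : IsOpen ψ.target := isOpen_extChartAt_target p
  have hy₀t : y₀ ∈ ψ.target := mem_extChartAt_target p
  obtain ⟨T, hT, hT0⟩ := exists_isometry_chart (mdifferentiable_of_contMDiff hφ p) hg
  -- the chart, with its first coordinate replaced by a multiple of `φ`
  set e₀ : EuclideanSpace ℝ (Fin (m + 1)) := EuclideanSpace.single 0 1 with he₀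
  set pr : EuclideanSpace ℝ (Fin (m + 1)) →L[ℝ] ℝ := EuclideanSpace.proj 0 with hpr
  set F : EuclideanSpace ℝ (Fin (m + 1)) → EuclideanSpace ℝ (Fin (m + 1)) := fun y ↦
    T y + (c⁻¹ * (φ ∘ ψ.symm) y - pr (T y)) • e₀ with hF
  have hφs : ContDiffOn ℝ 1 (φ ∘ ψ.symm) ψ.target := contDiffOn_comp_symm (k := 1) p hφ
  have hFs : ContDiffOn ℝ 1 F ψ.target :=
    T.contDiff.contDiffOn.add
      (((contDiffOn_const.mul hφs).sub (pr.contDiff.comp T.contDiff).contDiffOn).smul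
      contDiffOn_const)
  have hFd : ∀ y ∈ ψ.target, HasFDerivAt F (fderiv ℝ F y) y := fun y hy ↦
    ((hFs.contDiffAt (hto.mem_nhds hy)).differentiableAt one_ne_zero).hasFDerivAt
  have hFT : HasStrictFDerivAt F (T : EuclideanSpace ℝ (Fin (m + 1)) →L[ℝ] EuclideanSpace ℝ
      (Fin (m + 1))) y₀ := by
    have h1 := (hφs.contDiffAt (hto.mem_nhds hy₀t)).hasStrictFDerivAt one_ne_zero
    have hTs :=
      (T : EuclideanSpace ℝ (Fin (m + 1)) →L[ℝ] EuclideanSpace ℝ (Fin (m + 1))).hasStrictFDerivAt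
      (x := y₀)
    have h2 := hTs.add (((h1.const_mul c⁻¹).sub (pr.hasStrictFDerivAt.comp y₀ hTs)).smul_const e₀)
    have h3 : c⁻¹ • fderiv ℝ (φ ∘ ψ.symm) y₀ - pr ∘SL (T : EuclideanSpace ℝ (Fin (m + 1)) →L[ℝ]
        EuclideanSpace ℝ (Fin (m + 1))) = 0 := by
      ext v
      have : T v 0 = c⁻¹ * fderiv ℝ (φ ∘ ψ.symm) y₀ v := hT0 v
      simp [hpr, ← this]
    rw [h3, ContinuousLinearMap.zero_smulRight, add_zero] at h2
    exact h2
  have hF0 : ∀ y, F y 0 = c⁻¹ * (φ ∘ ψ.symm) y := fun y ↦ by simp [hF, he₀, hpr]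
  -- the metric and the nonlinearity of `F` each contribute a factor `√K`
  set L := NNReal.sqrt K with hL
  have hLL : L * L = K := NNReal.mul_self_sqrt K
  have hL1 : 1 < L := by rw [hL, ← NNReal.sqrt_one]; exact NNReal.sqrt_lt_sqrt.2 hK
  have hTn : ∀ v, ‖T v‖ = ‖chartDeriv p y₀ v‖ := fun v ↦ by
    rw [norm_eq_sqrt_real_inner, norm_eq_sqrt_real_inner, hT]
  have hKr : (1 : ℝ) < K := by exact_mod_cast hK
  -- the Jacobian of `F` is close to the Riemannian density
  have hdet : ∀ᶠ y in 𝓝 y₀, volumeDensity p y ≤ K * |(fderiv ℝ F y).det| ∧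
      |(fderiv ℝ F y).det| ≤ K * volumeDensity p y := by
    have hd0 : |(fderiv ℝ F y₀).det| = volumeDensity p y₀ := by
      rw [hFT.hasFDerivAt.fderiv]
      exact abs_det_eq_volumeDensity hT
    have hpos := volumeDensity_pos hy₀t
    have h1 : ContinuousAt (fun y ↦ |(fderiv ℝ F y).det|) y₀ :=
      ((ContinuousLinearMap.continuous_det.continuousAt).comp
        ((hFs.continuousOn_fderiv_of_isOpen hto le_rfl).continuousAt (hto.mem_nhds hy₀t))).abs
    have h2 : ContinuousAt (fun y ↦ volumeDensity p y) y₀ :=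
      (contDiffOn_volumeDensity p).continuousOn.continuousAt (hto.mem_nhds hy₀t)
    have h3 : volumeDensity p y₀ < K * |(fderiv ℝ F y₀).det| := by rw [hd0]; nlinarith
    have h4 : |(fderiv ℝ F y₀).det| < K * volumeDensity p y₀ := by rw [hd0]; nlinarith
    filter_upwards [h2.eventually_lt (continuousAt_const.mul h1) h3,
      h1.eventually_lt (continuousAt_const.mul h2) h4]
      with y ha hb using ⟨ha.le, hb.le⟩
  -- a neighbourhood in the coordinates
  have hev := eventually_norm_sub_le_of_hasStrictFDerivAt hFT hL1
  rw [nhds_prod_eq] at hev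
  obtain ⟨N, hN, hNF⟩ :=
    (eventually_prod_self_iff (r := fun a b ↦ edist (F a) (F b) ≤ L * edist (T a) (T b) ∧
    edist (T a) (T b) ≤ L * edist (F a) (F b))).1 hev
  have hmet := eventually_norm_chartDeriv_le hTn hL1
  obtain ⟨δ, hδ, hball⟩ := Metric.mem_nhds_iff.1
    (inter_mem (inter_mem (hto.mem_nhds hy₀t) hN) (inter_mem hmet hdet))
  -- a neighbourhood in the manifold
  have hWn : {x | x ∈ ψ.source ∧ ψ x ∈ Metric.ball y₀ δ} ∈ 𝓝 p :=
    inter_mem (extChartAt_source_mem_nhds p) ((continuousAt_extChartAt p).preimage_mem_nhds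
      (Metric.ball_mem_nhds _ hδ))
  obtain ⟨ε, hε, hεW⟩ := EMetric.mem_nhds_iff.1 hWn
  -- the factor `3` is the one required by `edist_chart_le`
  have h3 : (3 : ℝ≥0∞) * (ε / 3) = ε := ENNReal.mul_div_cancel (by simp) (by simp)
  have hgr : {x | ‖grad (m + 1) φ x‖ < K * c ∧ c < K * ‖grad (m + 1) φ x‖} ∈ 𝓝 p := by
    have hcg := (continuous_norm_grad hφ).continuousAt (x := p)
    exact inter_mem (hcg.eventually_lt continuousAt_const (show c < K * c by nlinarith))
      (continuousAt_const.eventually_lt (continuousAt_const.mul hcg) (show c < K * c by nlinarith))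
  obtain ⟨G, hGsub, hGo, hpG⟩ := mem_nhds_iff.1 hgr
  set W := Metric.eball p (ε / 3) ∩ G with hW
  have hWo : IsOpen W := Metric.isOpen_eball.inter hGo
  have hpW : p ∈ W := ⟨Metric.mem_eball_self (ENNReal.div_pos hε.ne' (by simp)), hpG⟩
  have hWs : ∀ x ∈ W, x ∈ ψ.source ∧ ψ x ∈ Metric.ball y₀ δ := fun x hx ↦ hεW
    (Metric.eball_subset_eball (ENNReal.div_le_of_le_mul
      (by rw [mul_comm]; exact le_mul_of_one_le_left (zero_le) (by norm_num))) hx.1)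
  set Θ := ((chartAt (EuclideanSpace ℝ (Fin (m + 1))) p).trans
    (hFT.toOpenPartialHomeomorph F)).restrOpen W hWo with hΘ
  have hΘs : ∀ x ∈ Θ.source, x ∈ W := fun x hx ↦ hx.2
  have hΘF : ∀ x, Θ x = F (ψ x) := fun x ↦ rfl
  have hLl : ∀ x ∈ W, ∀ z ∈ W, edist (T (ψ x)) (T (ψ z)) ≤ L * edist x z := fun x hx z hz ↦ by
    refine edist_chart_le (zero_lt_one.trans hL1).ne' (r := ε / 3) ?_ ?_ hx.1 hz.1
    · rw [h3]; exact fun x hx ↦ (hεW hx).1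
    · rw [h3]; exact fun x hx v ↦ ((hball (hεW hx).2).2.1 v).2
  have hLu : ∀ x ∈ W, ∀ z ∈ W, edist x z ≤ L * edist (T (ψ x)) (T (ψ z)) := fun x hx z hz ↦ by
    have := edist_symm_le (convex_ball y₀ δ) (fun y hy ↦ (hball hy).1.1)
      (fun y hy v ↦ ((hball hy).2.1 v).1)
      (hWs x hx).2 (hWs z hz).2
    rwa [ψ.left_inv (hWs x hx).1, ψ.left_inv (hWs z hz).1] at this
  have hNF' : ∀ x ∈ W, ∀ z ∈ W, _ := fun x hx z hz ↦
    hNF _ (hball (hWs x hx).2).1.2 _ (hball (hWs z hz).2).1.2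
  have hmap : ∀ S : Set M, Θ.symm ⁻¹' S ∩ Θ.target =
      F '' (ψ.symm ⁻¹' (S ∩ Θ.source) ∩ ψ.target) := by
    intro S
    ext u
    constructor
    · rintro ⟨hu, hut⟩
      have hx := Θ.map_target hut
      refine ⟨ψ (Θ.symm u), ⟨?_, ψ.map_source (hWs _ hx.2).1⟩, ?_⟩
      · rw [mem_preimage, ψ.left_inv (hWs _ hx.2).1]
        exact ⟨hu, hx⟩
      · rw [← hΘF, Θ.right_inv hut]
    · rintro ⟨y, ⟨⟨hyS, hyΘ⟩, hyt⟩, rfl⟩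
      have : F y = Θ (ψ.symm y) := by rw [hΘF, ψ.right_inv hyt]
      rw [this]
      exact ⟨by rwa [mem_preimage, Θ.left_inv hyΘ], Θ.map_source hyΘ⟩
  have hΘm : AEMeasurable Θ.symm (volume.restrict Θ.target) :=
    Θ.continuousOn_symm.aemeasurable Θ.open_target.measurableSet
  have hΘms : MeasurableSet Θ.source := Θ.open_source.measurableSet
  have hvol1 : ∀ S : Set M, MeasurableSet S → (volumeMeasure (m + 1) M).restrict Θ.source S =
      ∫⁻ y in ψ.symm ⁻¹' (S ∩ Θ.source) ∩ ψ.target, ENNReal.ofReal (volumeDensity p y) := by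
    intro S hS
    rw [Measure.restrict_apply hS, ← chartMeasure_apply p (hS.inter hΘms),
      ← volumeMeasure_restrict_source,
      Measure.restrict_apply (hS.inter hΘms), inter_eq_left.2 fun x hx ↦ (hWs x hx.2.2).1]
  have hvol2 : ∀ S : Set M, MeasurableSet S → Measure.map Θ.symm (volume.restrict Θ.target) S =
      ∫⁻ y in ψ.symm ⁻¹' (S ∩ Θ.source) ∩ ψ.target, ENNReal.ofReal |(fderiv ℝ F y).det| := by
    intro S hS
    rw [Measure.map_apply_of_aemeasurable hΘm hS,
      Measure.restrict_apply' Θ.open_target.measurableSet, hmap,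
      lintegral_abs_det_fderiv_eq_addHaar_image volume
        (measurableSet_preimage_symm p (hS.inter hΘms))
      (fun y hy ↦ (hFd y hy.2).hasFDerivWithinAt)]
    intro y hy z hz hyz
    have h1 : Θ (ψ.symm y) = Θ (ψ.symm z) := by
      rw [hΘF, hΘF, ψ.right_inv hy.2, ψ.right_inv hz.2, hyz]
    exact ψ.symm.injOn hy.2 hz.2 (Θ.injOn hy.1.2 hz.1.2 h1)
  have hden : ∀ S : Set M, ∀ y ∈ ψ.symm ⁻¹' (S ∩ Θ.source) ∩ ψ.target, volumeDensity p y ≤ K *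
      |(fderiv ℝ F y).det| ∧
      |(fderiv ℝ F y).det| ≤ K * volumeDensity p y := by
    rintro S y ⟨hy, hyt⟩
    have := (hball (hWs _ hy.2.2).2).2.2
    rwa [ψ.right_inv hyt] at this
  refine ⟨Θ, ⟨⟨mem_chart_source _ p, hFT.mem_toOpenPartialHomeomorph_source⟩, hpW⟩, ?_, ?_, ?_, ?_,
    ?_, ?_, ?_⟩
  · intro x hx z hz
    rw [hΘF, hΘF]
    calc edist (F (ψ x)) (F (ψ z)) ≤ L * edist (T (ψ x)) (T (ψ z)) := (hNF' x hx.2 z hz.2).1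
      _ ≤ L * (L * edist x z) := by
        gcongr
        exact hLl x hx.2 z hz.2
      _ = K * edist x z := by rw [← mul_assoc, ← hLL, ENNReal.coe_mul]
  · intro u hu v hv
    have hx := Θ.map_target hu
    have hz := Θ.map_target hv
    conv_rhs => rw [← Θ.right_inv hu, ← Θ.right_inv hv, hΘF, hΘF]
    calc edist (Θ.symm u) (Θ.symm v) ≤ L * edist (T (ψ (Θ.symm u))) (T (ψ (Θ.symm v))) :=
        hLu _ hx.2 _ hz.2
      _ ≤ L * (L * edist (F (ψ (Θ.symm u))) (F (ψ (Θ.symm v)))) := by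
        gcongr
        exact (hNF' _ hx.2 _ hz.2).2
      _ = K * _ := by rw [← mul_assoc, ← hLL, ENNReal.coe_mul]
  · intro x hx
    rw [hΘF, hF0, Function.comp_apply, ψ.left_inv (hWs x hx.2).1]
  · exact fun x hx ↦ (hGsub hx.2.2).1.le
  · exact fun x hx ↦ (hGsub hx.2.2).2.le
  · refine Measure.le_iff.2 fun S hS ↦ ?_
    rw [Measure.smul_apply, hvol1 S hS, hvol2 S hS, smul_eq_mul,
      ← lintegral_const_mul' _ _ ENNReal.coe_ne_top]
    refine setLIntegral_mono' (measurableSet_preimage_symm p (hS.inter hΘms)) fun y hy ↦ ?_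
    rw [← ENNReal.ofReal_coe_nnreal, ← ENNReal.ofReal_mul (by positivity)]
    exact ENNReal.ofReal_le_ofReal (hden S y hy).1
  · refine Measure.le_iff.2 fun S hS ↦ ?_
    rw [Measure.smul_apply, hvol1 S hS, hvol2 S hS, smul_eq_mul,
      ← lintegral_const_mul' _ _ ENNReal.coe_ne_top]
    refine setLIntegral_mono' (measurableSet_preimage_symm p (hS.inter hΘms)) fun y hy ↦ ?_
    rw [← ENNReal.ofReal_coe_nnreal, ← ENNReal.ofReal_mul (by positivity)]
    exact ENNReal.ofReal_le_ofReal (hden S y hy).2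
end

/-! ### Hyperplane slices of Euclidean space -/

section EuclideanSlices

variable {m : ℕ}

/-- The point `(t, v)` of `ℝ × ℝᵐ = ℝᵐ⁺¹`. -/
def euclideanCons (t : ℝ) (v : EuclideanSpace ℝ (Fin m)) : EuclideanSpace ℝ (Fin (m + 1)) :=
  WithLp.toLp 2 (Fin.cons t v : Fin (m + 1) → ℝ)

/-- The projection of `ℝ × ℝᵐ = ℝᵐ⁺¹` to the second factor. -/
def euclideanTail (z : EuclideanSpace ℝ (Fin (m + 1))) : EuclideanSpace ℝ (Fin m) :=
  WithLp.toLp 2 fun i ↦ z i.succ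

@[simp] lemma euclideanCons_zero (t : ℝ) (v : EuclideanSpace ℝ (Fin m)) :
  euclideanCons t v 0 = t := rfl

@[simp] lemma euclideanTail_cons (t : ℝ) (v : EuclideanSpace ℝ (Fin m)) :
  euclideanTail (euclideanCons t v) = v := rfl

lemma euclideanCons_tail (z : EuclideanSpace ℝ (Fin (m + 1))) :
    euclideanCons (z 0) (euclideanTail z) = z := by
  ext i
  refine Fin.cases rfl (fun i ↦ rfl) i

lemma isometry_euclideanCons (t : ℝ) : Isometry (euclideanCons (m := m) t) :=
  Isometry.of_dist_eq fun v w ↦ by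
    rw [EuclideanSpace.dist_eq, EuclideanSpace.dist_eq, Fin.sum_univ_succ]
    simp [euclideanCons]

lemma lipschitzWith_euclideanTail : LipschitzWith 1 (euclideanTail (m := m)) :=
  LipschitzWith.of_dist_le_mul fun v w ↦ by
    rw [EuclideanSpace.dist_eq, EuclideanSpace.dist_eq, Fin.sum_univ_succ, NNReal.coe_one, one_mul]
    exact Real.sqrt_le_sqrt (le_add_of_nonneg_left (sq_nonneg _))

lemma continuous_euclideanCons : Continuous fun p : ℝ × EuclideanSpace ℝ (Fin m) ↦
    euclideanCons p.1 p.2 := by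
  refine (PiLp.continuous_toLp 2 _).comp (continuous_pi fun i ↦ ?_)
  refine Fin.cases ?_ (fun i ↦ ?_) i
  · exact continuous_fst
  · exact (EuclideanSpace.proj (𝕜 := ℝ) i).continuous.comp continuous_snd

lemma measurableEmbedding_euclideanCons :
    MeasurableEmbedding fun p : ℝ × EuclideanSpace ℝ (Fin m) ↦ euclideanCons p.1 p.2 :=
  continuous_euclideanCons.measurableEmbedding fun p q h ↦ by
    have h0 := congrArg (fun z : EuclideanSpace ℝ (Fin (m + 1)) ↦ z 0) h
    have h1 := congrArg euclideanTail h
    exact Prod.ext h0 h1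

lemma measurePreserving_euclideanCons :
    MeasurePreserving (fun p : ℝ × EuclideanSpace ℝ (Fin m) ↦ euclideanCons p.1 p.2) := by
  have h1 := (volume_preserving_piFinSuccAbove (fun _ : Fin (m + 1) ↦ ℝ) 0).symm
  have h2 := (MeasurePreserving.id (volume : Measure ℝ)).prod (PiLp.volume_preserving_ofLp (Fin m))
  have h3 := (PiLp.volume_preserving_toLp (Fin (m + 1))).comp (h1.comp h2)
  have h4 : (fun p : ℝ × EuclideanSpace ℝ (Fin m) ↦ euclideanCons p.1 p.2) = WithLp.toLp 2 ∘
      (MeasurableEquiv.piFinSuccAbove (fun _ ↦ ℝ) 0).symm ∘ Prod.map id WithLp.ofLp := by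
    ext p i
    exact Fin.cases rfl (fun i ↦ rfl) i
  rw [h4]
  exact h3

/-- The Cauchy densities `a / (1 + (a c t)²)` concentrate, as `a → ∞`, on the hyperplane `t = 0`
with mass `π / c`. -/
lemma tendsto_integral_cauchy_mul {H : EuclideanSpace ℝ (Fin (m + 1)) → ℝ} (hH : Continuous H)
    (hHc : HasCompactSupport H) {c : ℝ} (hc : 0 < c) :
    Tendsto (fun a : ℝ ↦ ∫ z, a * (1 + (a * (c * z 0)) ^ 2)⁻¹ * H z) atTop
      (𝓝 (Real.pi / c * ∫ v, H (euclideanCons 0 v))) := by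
  set G : ℝ → ℝ := fun t ↦ ∫ v, H (euclideanCons t v) with hG
  have hHi : Integrable H := hH.integrable_of_hasCompactSupport hHc
  have hprod : Integrable (fun p : ℝ × EuclideanSpace ℝ (Fin m) ↦ H (euclideanCons p.1 p.2))
      (volume.prod volume) :=
    (measurePreserving_euclideanCons.integrable_comp_emb measurableEmbedding_euclideanCons).2 hHi
  have hGi : Integrable G := hprod.integral_prod_left
  have hGc : Continuous G := by
    rw [← continuousOn_univ]
    refine continuousOn_integral_of_compact_support (k := euclideanTail '' tsupport H)
      (hHc.isCompact.image lipschitzWith_euclideanTail.continuous) ?_ ?_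
    · exact (hH.comp continuous_euclideanCons).continuousOn
    · exact fun t v _ hv ↦ image_eq_zero_of_notMem_tsupport fun h ↦ hv ⟨_, h, rfl⟩
  have hfub : ∀ a : ℝ, ∫ z, a * (1 + (a * (c * z 0)) ^ 2)⁻¹ * H z = ∫ t, a *
      (1 + (a * (c * t)) ^ 2)⁻¹ * G t := by
    intro a
    rw [← measurePreserving_euclideanCons.integral_comp measurableEmbedding_euclideanCons]
    rw [Measure.volume_eq_prod, integral_prod]
    · simp_rw [euclideanCons_zero, integral_const_mul]
      rfl
    · simp only [euclideanCons_zero]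
      refine hprod.bdd_mul (c := |a|) ?_ ?_
      · exact (by fun_prop (disch := intro; positivity) : Continuous fun p :
          ℝ × EuclideanSpace ℝ (Fin m) ↦ a * (1 + (a * (c * p.1)) ^ 2)⁻¹).aestronglyMeasurable
      · refine .of_forall fun p ↦ ?_
        rw [norm_mul, Real.norm_eq_abs, Real.norm_eq_abs]
        refine mul_le_of_le_one_right (abs_nonneg _) ?_
        rw [abs_of_nonneg (by positivity)]
        exact inv_le_one_of_one_le₀ (by nlinarith [sq_nonneg (a * (c * p.1))])
  simp_rw [hfub]
  have hpi : Real.pi ≠ 0 := Real.pi_ne_zero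
  have key := tendsto_integral_comp_smul_smul_of_integrable (μ := (volume : Measure ℝ)) (F := ℝ)
    (φ := fun t ↦ Real.pi⁻¹ * (1 + t ^ 2)⁻¹) (fun t ↦ by positivity)
    (by rw [integral_const_mul, integral_univ_inv_one_add_sq, inv_mul_cancel₀ hpi]) ?_ hGi
      hGc.continuousAt
  · have h2 := (key.comp (tendsto_id.atTop_mul_const hc)).const_mul (Real.pi / c)
    refine h2.congr fun a ↦ ?_
    rw [Function.comp_apply, ← integral_const_mul]
    refine integral_congr_ae (.of_forall fun t ↦ ?_)
    simp only [Module.finrank_self, pow_one, smul_eq_mul, id]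
    rw [mul_assoc a c t]
    field_simp
  · have h0 : Tendsto (fun t : ℝ ↦ Real.pi⁻¹ * ‖t‖⁻¹) (Bornology.cobounded ℝ) (𝓝 0) := by
      simpa using ((tendsto_norm_cobounded_atTop (E := ℝ)).inv_tendsto_atTop).const_mul Real.pi⁻¹
    refine squeeze_zero (fun t ↦ by positivity) (fun t ↦ ?_) h0
    rw [Module.finrank_self, pow_one, mul_left_comm]
    refine mul_le_mul_of_nonneg_left ?_ (by positivity)
    rcases eq_or_ne t 0 with rfl | ht
    · simp
    · have := norm_pos_iff.2 ht
      rw [← Real.norm_of_nonneg (sq_nonneg t), norm_pow, ← div_eq_mul_inv,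
        div_le_iff₀ (by positivity),
        inv_mul_eq_div, le_div_iff₀ this]
      nlinarith

lemma _root_.LipschitzOnWith.euclideanHausdorffMeasure_image_le {X Y : Type*} [EMetricSpace X]
    [EMetricSpace Y]
    [MeasurableSpace X] [BorelSpace X] [MeasurableSpace Y] [BorelSpace Y] {K : ℝ≥0} {f : X → Y}
      {s : Set X}
    (h : LipschitzOnWith K f s) (d : ℕ) : μHE[d] (f '' s) ≤ (K : ℝ≥0∞) ^ d * μHE[d] s := by
  rw [Measure.euclideanHausdorffMeasure_def, Measure.euclideanHausdorffMeasure_def,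
    Measure.smul_apply,
    Measure.smul_apply, mul_smul_comm]
  gcongr
  simpa using h.hausdorffMeasure_image_le (Nat.cast_nonneg d)

end EuclideanSlices

section
variable {m : ℕ} {M : Type*} [EMetricSpace M] [ChartedSpace (EuclideanSpace ℝ (Fin (m + 1))) M]
  [IsManifold (𝓡 (m + 1)) ∞ M]
  [RiemannianBundle (fun x : M ↦ TangentSpace (𝓡 (m + 1)) x)] [MeasurableSpace M] [BorelSpace M]
  {φ : M → ℝ} {c : ℝ} {K : ℝ≥0} {Θ : OpenPartialHomeomorph M (EuclideanSpace ℝ (Fin (m + 1)))}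

lemma IsAlmostIsometricChart.euclideanCons_zero_tail (h : IsAlmostIsometricChart m φ c K Θ) {x : M}
    (hx : x ∈ nodalSet φ ∩ Θ.source) : euclideanCons 0 (euclideanTail (Θ x)) = Θ x := by
  have h1 : Θ x 0 = 0 := by rw [h.apply_zero x hx.2, show φ x = 0 from hx.1, mul_zero]
  rw [← h1, euclideanCons_tail]

lemma IsAlmostIsometricChart.symm_cons_mem_nodalSet (h : IsAlmostIsometricChart m φ c K Θ)
    (hc : 0 < c)
    {v : EuclideanSpace ℝ (Fin m)} (hv : euclideanCons 0 v ∈ Θ.target) :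
    Θ.symm (euclideanCons 0 v) ∈ nodalSet φ := by
  have h1 := h.apply_zero _ (Θ.map_target hv)
  rw [Θ.right_inv hv, euclideanCons_zero] at h1
  exact (mul_eq_zero.1 h1.symm).resolve_left (inv_ne_zero hc.ne')

lemma IsAlmostIsometricChart.aemeasurable_slice :
    AEMeasurable (fun v ↦ Θ.symm (euclideanCons 0 v))
      ((volume : Measure (EuclideanSpace ℝ (Fin m))).restrict (euclideanCons 0 ⁻¹' Θ.target)) :=
  (Θ.continuousOn_symm.comp (isometry_euclideanCons 0).continuous.continuousOn fun _ hv ↦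
    hv).aemeasurable
    ((Θ.open_target.preimage (isometry_euclideanCons 0).continuous).measurableSet)

/-- In an almost isometric chart, the surface measure of the nodal set is close to Lebesgue
measure on the hyperplane `z₀ = 0`, because Lipschitz maps control Hausdorff measures. -/
lemma IsAlmostIsometricChart.restrict_hausdorffMeasure_le (h : IsAlmostIsometricChart m φ c K Θ) :
    (μHE[m] : Measure M).restrict (nodalSet φ ∩ Θ.source) ≤ (K : ℝ≥0∞) ^ m •
      Measure.map (fun v ↦ Θ.symm (euclideanCons 0 v))
        (volume.restrict (euclideanCons 0 ⁻¹' Θ.target)) := by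
  refine Measure.le_iff.2 fun S hS ↦ ?_
  have ho := (Θ.open_target.preimage (isometry_euclideanCons (m := m) 0).continuous).measurableSet
  rw [Measure.restrict_apply hS, Measure.smul_apply,
    Measure.map_apply_of_aemeasurable aemeasurable_slice hS,
    Measure.restrict_apply' ho, ← EuclideanSpace.euclideanHausdorffMeasure_eq_volume, smul_eq_mul]
  have hL : LipschitzOnWith K (fun v ↦ Θ.symm (euclideanCons 0 v))
      ((fun v : EuclideanSpace ℝ (Fin m) ↦ Θ.symm (euclideanCons 0 v)) ⁻¹' S ∩
        euclideanCons 0 ⁻¹' Θ.target) := by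
    intro v hv w hw
    rw [← (isometry_euclideanCons 0).edist_eq v w]
    exact h.lipschitz_symm hv.2 hw.2
  refine (measure_mono ?_).trans (hL.euclideanHausdorffMeasure_image_le m)
  intro x hx
  have hx' := h.euclideanCons_zero_tail hx.2
  refine ⟨euclideanTail (Θ x), ⟨?_, ?_⟩, ?_⟩
  · simpa only [mem_preimage, hx', Θ.left_inv hx.2.2] using hx.1
  · simpa only [mem_preimage, hx'] using Θ.map_source hx.2.2
  · simp only [hx', Θ.left_inv hx.2.2]

lemma IsAlmostIsometricChart.le_restrict_hausdorffMeasure (h : IsAlmostIsometricChart m φ c K Θ)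
    (hc : 0 < c) :
    Measure.map (fun v ↦ Θ.symm (euclideanCons 0 v))
      (volume.restrict (euclideanCons 0 ⁻¹' Θ.target)) ≤
      (K : ℝ≥0∞) ^ m • (μHE[m] : Measure M).restrict (nodalSet φ ∩ Θ.source) := by
  refine Measure.le_iff.2 fun S hS ↦ ?_
  have ho := (Θ.open_target.preimage (isometry_euclideanCons (m := m) 0).continuous).measurableSet
  rw [Measure.smul_apply, Measure.restrict_apply hS,
    Measure.map_apply_of_aemeasurable aemeasurable_slice hS,
    Measure.restrict_apply' ho, ← EuclideanSpace.euclideanHausdorffMeasure_eq_volume, smul_eq_mul]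
  have hL : LipschitzOnWith K (fun x ↦ euclideanTail (Θ x)) (S ∩ (nodalSet φ ∩ Θ.source)) := by
    intro x hx z hz
    have := lipschitzWith_euclideanTail (Θ x) (Θ z)
    rw [ENNReal.coe_one, one_mul] at this
    exact this.trans (h.lipschitz hx.2.2 hz.2.2)
  refine (measure_mono ?_).trans (hL.euclideanHausdorffMeasure_image_le m)
  intro v hv
  refine ⟨Θ.symm (euclideanCons 0 v), ⟨hv.1, h.symm_cons_mem_nodalSet hc hv.2, Θ.map_target hv.2⟩,
    ?_⟩
  simp only [Θ.right_inv hv.2, euclideanTail_cons]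

end

/-! ### The flux of a function across the nodal set -/

section
variable {n : ℕ} {M : Type*} [TopologicalSpace M] [ChartedSpace (EuclideanSpace ℝ (Fin n)) M]
  [IsManifold (𝓡 n) ∞ M]
  [RiemannianBundle (fun x : M ↦ TangentSpace (𝓡 n) x)]

/-- The number `-½ ∫ sgn φ · div (η ∇φ) dV`, with `sgn 0 = 0`. Formally it is the integral of `η
|∇φ|` over the nodal set, by the divergence theorem on `{φ > 0}` and on `{φ < 0}`. -/
def nodalFlux (n : ℕ) {M : Type*} [TopologicalSpace M] [ChartedSpace (EuclideanSpace ℝ (Fin n)) M]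
    [RiemannianBundle (fun x : M ↦ TangentSpace (𝓡 n) x)] [MeasurableSpace M] (φ η : M → ℝ) : ℝ :=
  -(1 / 2) * ∫ x, Real.sign (φ x) * (inner ℝ (grad n η x) (grad n φ x) + η x *
    laplacian n φ x) ∂(volumeMeasure n M)

lemma continuous_cauchy {X : Type*} [TopologicalSpace X] {φ : X → ℝ} (hφ : Continuous φ) (a : ℝ) :
    Continuous fun x ↦ a * (1 + (a * φ x) ^ 2)⁻¹ :=
  continuous_const.mul ((continuous_const.add ((continuous_const.mul hφ).pow 2)).inv₀
    fun x ↦ (by positivity : 0 < 1 + (a * φ x) ^ 2).ne')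

lemma abs_cauchy_mul_le (a t : ℝ) : |a * (1 + (a * t) ^ 2)⁻¹ * t| ≤ 1 := by
  rw [mul_right_comm, abs_mul, abs_inv, abs_of_pos (by positivity : 0 < 1 + (a * t) ^ 2),
    ← div_eq_mul_inv,
    div_le_one (by positivity)]
  nlinarith [sq_abs (a * t), sq_nonneg (|a * t| - 1)]

lemma tendsto_cauchy_zero {t : ℝ} (ht : t ≠ 0) :
    Tendsto (fun a : ℝ ↦ a * (1 + (a * t) ^ 2)⁻¹) atTop (𝓝 0) := by
  have h1 : Tendsto (fun a : ℝ ↦ (t ^ 2)⁻¹ * a⁻¹) atTop (𝓝 0) := by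
    simpa using tendsto_inv_atTop_zero.const_mul ((t ^ 2)⁻¹)
  refine squeeze_zero' ((eventually_ge_atTop 0).mono fun a ha ↦ by positivity) ?_ h1
  filter_upwards [eventually_gt_atTop 0] with a ha
  rw [← div_eq_mul_inv, ← mul_inv, ← one_div, div_le_div_iff₀ (by positivity) (by positivity)]
  nlinarith

variable [IsContMDiffRiemannianBundle (𝓡 n) ∞ (EuclideanSpace ℝ (Fin n))
  (fun x : M ↦ TangentSpace (𝓡 n) x)]

lemma contMDiff_comp_real {s : ℝ → ℝ} {k : ℕ∞ω} (hs : ContDiff ℝ k s) {φ : M → ℝ}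
    (hφ : ContMDiff (𝓡 n) 𝓘(ℝ, ℝ) k φ) :
    ContMDiff (𝓡 n) 𝓘(ℝ, ℝ) k fun x ↦ s (φ x) :=
  hs.contMDiff.comp hφ

variable [T2Space M] [CompactSpace M] [MeasurableSpace M] [BorelSpace M]

/-- Green's formula for the test function `arctan (a φ) η`. -/
lemma integral_cauchy_mul_norm_grad_sq {φ η : M → ℝ} (hφ : ContMDiff (𝓡 n) 𝓘(ℝ, ℝ) 2 φ)
    (hη : ContMDiff (𝓡 n) 𝓘(ℝ, ℝ) 1 η) (a : ℝ) :
    ∫ x, a * (1 + (a * φ x) ^ 2)⁻¹ * (η x * ‖grad n φ x‖ ^ 2) ∂(volumeMeasure n M) =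
      -∫ x, Real.arctan (a * φ x) * (inner ℝ (grad n η x) (grad n φ x) + η x *
        laplacian n φ x) ∂(volumeMeasure n M) := by
  have hφ1 : ContMDiff (𝓡 n) 𝓘(ℝ, ℝ) 1 φ := hφ.of_le (by norm_num)
  have hA : ContMDiff (𝓡 n) 𝓘(ℝ, ℝ) 1 fun x ↦ Real.arctan (a * φ x) :=
    contMDiff_comp_real (s := fun t ↦ Real.arctan (a * t))
      (Real.contDiff_arctan.comp (contDiff_const.mul contDiff_id)) hφ1
  have hc1 := continuous_inner_grad hη hφ1
  have hc2 := continuous_inner_grad hφ1 hφ1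
  have hc3 := continuous_laplacian hφ
  have hc4 : Continuous fun x ↦ Real.arctan (a * φ x) := hA.continuous
  have hc5 := continuous_cauchy hφ.continuous a
  have hG := integral_mul_laplacian (hA.mul hη) hφ
  have hgr : ∀ x, inner ℝ (grad n ((fun x ↦ Real.arctan (a * φ x)) * η) x) (grad n φ x) =
      Real.arctan (a * φ x) * inner ℝ (grad n η x) (grad n φ x) +
        a * (1 + (a * φ x) ^ 2)⁻¹ * (η x * ‖grad n φ x‖ ^ 2) := by
    intro x
    have h1 : HasDerivAt (fun t ↦ Real.arctan (a * t)) (a * (1 + (a * φ x) ^ 2)⁻¹) (φ x) := by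
      have := ((hasDerivAt_id (φ x)).const_mul a).arctan
      simp only [id, mul_one] at this
      convert this using 1
      rw [one_div, mul_comm]
    have h2 := grad_mul (mdifferentiable_of_contMDiff hA x) (mdifferentiable_of_contMDiff hη x)
    rw [grad_comp (mdifferentiable_of_contMDiff hφ1 x) h1] at h2
    refine (congrArg (fun v ↦ inner ℝ v (grad n φ x)) h2).trans ?_
    rw [inner_add_left, inner_smul_left, inner_smul_left, inner_smul_left,
      real_inner_self_eq_norm_sq]
    simp only [conj_trivial]
    ring
  have hi1 : Integrable (fun x ↦ Real.arctan (a * φ x) * (η x * laplacian n φ x))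
      (volumeMeasure n M) :=
    integrable_of_continuous (hc4.mul (hη.continuous.mul hc3))
  have hi2 : Integrable (fun x ↦ Real.arctan (a * φ x) * inner ℝ (grad n η x) (grad n φ x))
      (volumeMeasure n M) :=
    integrable_of_continuous (hc4.mul hc1)
  have hi3 : Integrable (fun x ↦ a * (1 + (a * φ x) ^ 2)⁻¹ * (η x * ‖grad n φ x‖ ^ 2))
      (volumeMeasure n M) := by
    simp_rw [← real_inner_self_eq_norm_sq]
    exact integrable_of_continuous (hc5.mul (hη.continuous.mul hc2))
  simp_rw [hgr] at hG
  rw [integral_add hi2 hi3] at hG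
  simp_rw [mul_add]
  rw [integral_add hi2 hi1]
  have : ∫ x, Real.arctan (a * φ x) * (η x * laplacian n φ x) ∂(volumeMeasure n M) =
    ∫ x, ((fun x ↦ Real.arctan (a * φ x)) * η) x * laplacian n φ x ∂(volumeMeasure n M) := by
    simp only [Pi.mul_apply, mul_assoc]
  rw [this, hG]
  ring

lemma tendsto_arctan_mul (t : ℝ) :
    Tendsto (fun a : ℝ ↦ Real.arctan (a * t)) atTop (𝓝 (Real.pi / 2 * Real.sign t)) := by
  rcases lt_trichotomy t 0 with ht | rfl | ht
  · rw [Real.sign_of_neg ht, mul_neg_one]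
    exact (Real.tendsto_arctan_atBot.mono_right nhdsWithin_le_nhds).comp
      (tendsto_id.atTop_mul_const_of_neg ht)
  · simp
  · rw [Real.sign_of_pos ht, mul_one]
    exact (Real.tendsto_arctan_atTop.mono_right nhdsWithin_le_nhds).comp
      (tendsto_id.atTop_mul_const ht)

lemma abs_arctan_le (t : ℝ) : |Real.arctan t| ≤ Real.pi / 2 :=
  abs_le.2 ⟨(Real.neg_pi_div_two_lt_arctan t).le, (Real.arctan_lt_pi_div_two t).le⟩

lemma measurable_real_sign : Measurable Real.sign := by
  unfold Real.sign
  exact Measurable.ite measurableSet_Iio measurable_const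
    (Measurable.ite measurableSet_Ioi measurable_const measurable_const)

lemma abs_real_sign_le (t : ℝ) : |Real.sign t| ≤ 1 := by
  rcases Real.sign_apply_eq t with h | h | h <;> simp [h]

lemma integrable_sign_mul {φ G : M → ℝ} (hφ : Continuous φ) (hG : Continuous G) :
    Integrable (fun x ↦ Real.sign (φ x) * G x) (volumeMeasure n M) :=
  (integrable_of_continuous hG).bdd_mul (measurable_real_sign.comp
    hφ.measurable).aestronglyMeasurable
    (.of_forall fun _ ↦ abs_real_sign_le _)

lemma tendsto_integral_arctan_mul {φ G : M → ℝ} (hφ : Continuous φ) (hG : Continuous G) :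
    Tendsto (fun a : ℝ ↦ ∫ x, Real.arctan (a * φ x) * G x ∂(volumeMeasure n M)) atTop
      (𝓝 (Real.pi / 2 * ∫ x, Real.sign (φ x) * G x ∂(volumeMeasure n M))) := by
  rw [← integral_const_mul]
  refine tendsto_integral_filter_of_dominated_convergence (fun x ↦ Real.pi / 2 * |G x|) ?_ ?_
    ((integrable_of_continuous hG.abs).const_mul _) ?_
  · refine .of_forall fun a ↦ Continuous.aestronglyMeasurable ?_
    exact (Real.continuous_arctan.comp (continuous_const.mul hφ)).mul hG
  · refine .of_forall fun a ↦ .of_forall fun x ↦ ?_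
    rw [norm_mul]
    exact mul_le_mul_of_nonneg_right (abs_arctan_le _) (abs_nonneg _)
  · refine .of_forall fun x ↦ ?_
    simp_rw [← mul_assoc]
    exact (tendsto_arctan_mul _).mul_const _

/-- The flux is the limit of volume integrals that concentrate on the nodal set. The factor `π` is
the mass of `1 / (1 + t²)`. -/
lemma tendsto_integral_cauchy_mul_norm_grad_sq {φ η : M → ℝ} (hφ : ContMDiff (𝓡 n) 𝓘(ℝ, ℝ) 2 φ)
    (hη : ContMDiff (𝓡 n) 𝓘(ℝ, ℝ) 1 η) :
    Tendsto (fun a : ℝ ↦ ∫ x, a * (1 + (a * φ x) ^ 2)⁻¹ *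
      (η x * ‖grad n φ x‖ ^ 2) ∂(volumeMeasure n M)) atTop
      (𝓝 (Real.pi * nodalFlux n φ η)) := by
  have hφ1 : ContMDiff (𝓡 n) 𝓘(ℝ, ℝ) 1 φ := hφ.of_le (by norm_num)
  simp_rw [integral_cauchy_mul_norm_grad_sq hφ hη]
  have := (tendsto_integral_arctan_mul (n := n) hφ.continuous
    ((continuous_inner_grad hη hφ1).add (hη.continuous.mul (continuous_laplacian hφ)))).neg
  have h2 : Real.pi * nodalFlux n φ η = -(Real.pi / 2 * ∫ x, Real.sign (φ x) *
      (inner ℝ (grad n η x) (grad n φ x) + η x * laplacian n φ x) ∂(volumeMeasure n M)) := by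
    unfold nodalFlux
    ring
  rw [h2]
  exact this

lemma nodalFlux_nonneg {φ η : M → ℝ} (hφ : ContMDiff (𝓡 n) 𝓘(ℝ, ℝ) 2 φ)
    (hη : ContMDiff (𝓡 n) 𝓘(ℝ, ℝ) 1 η) (h0 : ∀ x, 0 ≤ η x) : 0 ≤ nodalFlux n φ η := by
  have h1 := ge_of_tendsto (b := 0) (tendsto_integral_cauchy_mul_norm_grad_sq hφ hη)
    ((eventually_ge_atTop 0).mono fun a ha ↦ integral_nonneg fun x ↦ by
      have := h0 x
      positivity)
  exact (mul_nonneg_iff_of_pos_left Real.pi_pos).1 h1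

lemma nodalFlux_add {φ η ξ : M → ℝ} (hφ : ContMDiff (𝓡 n) 𝓘(ℝ, ℝ) 2 φ)
    (hη : ContMDiff (𝓡 n) 𝓘(ℝ, ℝ) 1 η) (hξ : ContMDiff (𝓡 n) 𝓘(ℝ, ℝ) 1 ξ) :
    nodalFlux n φ (fun x ↦ η x + ξ x) = nodalFlux n φ η + nodalFlux n φ ξ := by
  have hφ1 : ContMDiff (𝓡 n) 𝓘(ℝ, ℝ) 1 φ := hφ.of_le (by norm_num)
  have hc := continuous_laplacian hφ
  have hi : ∀ {η : M → ℝ}, ContMDiff (𝓡 n) 𝓘(ℝ, ℝ) 1 η → Integrable (fun x ↦ Real.sign (φ x) *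
      (inner ℝ (grad n η x) (grad n φ x) + η x * laplacian n φ x)) (volumeMeasure n M) := fun hη ↦
    integrable_sign_mul hφ.continuous ((continuous_inner_grad hη hφ1).add (hη.continuous.mul hc))
  rw [nodalFlux, nodalFlux, nodalFlux, ← mul_add, ← integral_add (hi hη) (hi hξ)]
  congr 1
  refine integral_congr_ae (.of_forall fun x ↦ ?_)
  simp only
  rw [grad_add (mdifferentiable_of_contMDiff hη x) (mdifferentiable_of_contMDiff hξ x),
    inner_add_left]
  ring

lemma nodalFlux_eq_zero {φ η : M → ℝ} (hφ : ContMDiff (𝓡 n) 𝓘(ℝ, ℝ) 2 φ)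
    (hη : ContMDiff (𝓡 n) 𝓘(ℝ, ℝ) 1 η) (hs : ∀ x ∈ tsupport η, φ x ≠ 0) : nodalFlux n φ η = 0 := by
  have hφ1 : ContMDiff (𝓡 n) 𝓘(ℝ, ℝ) 1 φ := hφ.of_le (by norm_num)
  have hgc : Continuous fun x ↦ ‖grad n φ x‖ ^ 2 := by
    simp_rw [← real_inner_self_eq_norm_sq]
    exact continuous_inner_grad hφ1 hφ1
  have hq : Continuous fun x ↦ η x / φ x := by
    refine continuous_of_tsupport fun x hx ↦ hη.continuous.continuousAt.div
      hφ.continuous.continuousAt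
      (hs x (closure_mono (fun z hz ↦ (div_ne_zero_iff.1 hz).1 :
        Function.support _ ⊆ Function.support η) hx))
  have h1 : Tendsto (fun a : ℝ ↦ ∫ x, a * (1 + (a * φ x) ^ 2)⁻¹ *
    (η x * ‖grad n φ x‖ ^ 2) ∂(volumeMeasure n M)) atTop
      (𝓝 (∫ _, 0 ∂(volumeMeasure n M))) := by
    refine tendsto_integral_filter_of_dominated_convergence
      (fun x ↦ |η x / φ x| * ‖grad n φ x‖ ^ 2) ?_ ?_
      (integrable_of_continuous (hq.abs.mul hgc)) ?_
    · refine .of_forall fun a ↦ Continuous.aestronglyMeasurable ?_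
      exact (continuous_cauchy hφ.continuous a).mul (hη.continuous.mul hgc)
    · refine .of_forall fun a ↦ .of_forall fun x ↦ ?_
      rw [← mul_assoc, norm_mul, norm_mul, Real.norm_eq_abs, Real.norm_eq_abs, norm_pow, norm_norm]
      refine mul_le_mul_of_nonneg_right ?_ (by positivity)
      by_cases hx : η x = 0
      · simp [hx]
      have hφx := hs x (subset_tsupport _ hx)
      calc |a * (1 + (a * φ x) ^ 2)⁻¹| * |η x| = |a * (1 + (a * φ x) ^ 2)⁻¹ * φ x| *
          |η x / φ x| := by
            rw [← abs_mul, ← abs_mul, mul_assoc (a * _), mul_div_cancel₀ _ hφx]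
        _ ≤ _ := mul_le_of_le_one_left (abs_nonneg _) (abs_cauchy_mul_le _ _)
    · refine .of_forall fun x ↦ ?_
      by_cases hx : η x = 0
      · simp [hx]
      have hφx := hs x (subset_tsupport _ hx)
      simpa using (tendsto_cauchy_zero hφx).mul_const (η x * ‖grad n φ x‖ ^ 2)
  rw [integral_zero] at h1
  exact (mul_eq_zero.1 (tendsto_nhds_unique (tendsto_integral_cauchy_mul_norm_grad_sq hφ hη)
    h1)).resolve_left Real.pi_ne_zero

end

/-! ### Flux and nodal integral in an almost isometric chart -/

section
variable {m : ℕ} {M : Type*} [EMetricSpace M] [ChartedSpace (EuclideanSpace ℝ (Fin (m + 1))) M]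
  [IsManifold (𝓡 (m + 1)) ∞ M]
  [RiemannianBundle (fun x : M ↦ TangentSpace (𝓡 (m + 1)) x)] [MeasurableSpace M] [BorelSpace M]

/-- The integral of `η |∇φ|` over the nodal set of `φ`, for `η ≥ 0`, as a Lebesgue integral that
may a priori be infinite. -/
def nodalIntegral (m : ℕ) {M : Type*} [EMetricSpace M]
  [ChartedSpace (EuclideanSpace ℝ (Fin (m + 1))) M]
    [RiemannianBundle (fun x : M ↦ TangentSpace (𝓡 (m + 1)) x)] [MeasurableSpace M] [BorelSpace M]
      (φ η : M → ℝ) : ℝ≥0∞ :=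
  ∫⁻ x in nodalSet φ, ENNReal.ofReal (η x * ‖grad (m + 1) φ x‖) ∂(μHE[m] : Measure M)

variable [IsContMDiffRiemannianBundle (𝓡 (m + 1)) ∞ (EuclideanSpace ℝ (Fin (m + 1)))
  (fun x : M ↦ TangentSpace (𝓡 (m + 1)) x)]
  [CompactSpace M]
  {φ η : M → ℝ} {c : ℝ} {K : ℝ≥0} {Θ : OpenPartialHomeomorph M (EuclideanSpace ℝ (Fin (m + 1)))}

lemma continuous_indicator_comp_symm {X E : Type*} [TopologicalSpace X] [TopologicalSpace E]
    [T2Space E] [CompactSpace X]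
    (Θ : OpenPartialHomeomorph X E) {η : X → ℝ} (hη : Continuous η) (hs : tsupport η ⊆ Θ.source) :
    Continuous (Θ.target.indicator (η ∘ Θ.symm)) ∧
      HasCompactSupport (Θ.target.indicator (η ∘ Θ.symm)) := by
  have hK : IsCompact (Θ '' tsupport η) := (isClosed_tsupport η).isCompact.image_of_continuousOn
    (Θ.continuousOn.mono hs)
  have h0 : ∀ z ∉ Θ '' tsupport η, Θ.target.indicator (η ∘ Θ.symm) z = 0 := by
    intro z hz
    by_cases h : z ∈ Θ.target
    · rw [indicator_of_mem h]
      exact image_eq_zero_of_notMem_tsupport (f := η) fun h' ↦ hz ⟨_, h', Θ.right_inv h⟩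
    · exact indicator_of_notMem h _
  refine ⟨continuous_iff_continuousAt.2 fun z ↦ ?_, HasCompactSupport.intro hK h0⟩
  by_cases h : z ∈ Θ.target
  · refine (hη.continuousAt.comp (Θ.continuousAt_symm h)).congr ?_
    filter_upwards [Θ.open_target.mem_nhds h] with w hw using (indicator_of_mem hw _).symm
  · have hz : z ∉ Θ '' tsupport η := by
      rintro ⟨x, hx, rfl⟩
      exact h (Θ.map_source (hs hx))
    refine continuousAt_const.congr (f := fun _ ↦ (0 : ℝ)) ?_
    filter_upwards [hK.isClosed.isOpen_compl.mem_nhds hz] with w hw using (h0 w hw).symm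

lemma setLIntegral_eq_of_tsupport_subset {X : Type*} [TopologicalSpace X] [MeasurableSpace X]
    {μ : Measure X} {s : Set X}
    (hs : MeasurableSet s) {η f : X → ℝ} (h : tsupport η ⊆ s) :
    ∫⁻ x in s, ENNReal.ofReal (η x * f x) ∂μ = ∫⁻ x, ENNReal.ofReal (η x * f x) ∂μ := by
  rw [← lintegral_indicator hs]
  refine lintegral_congr fun x ↦ ?_
  by_cases hx : x ∈ s
  · rw [indicator_of_mem hx]
  · rw [indicator_of_notMem hx, image_eq_zero_of_notMem_tsupport (fun h' ↦ hx (h h')), zero_mul,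
      ENNReal.ofReal_zero]

/-- The integral of `c η` over the slice of an almost isometric chart that parametrizes the nodal
set. -/
def sliceIntegral (Θ : OpenPartialHomeomorph M (EuclideanSpace ℝ (Fin (m + 1)))) (c : ℝ)
    (η : M → ℝ) : ℝ :=
  c * ∫ v : EuclideanSpace ℝ (Fin m), Θ.target.indicator (η ∘ Θ.symm) (euclideanCons 0 v)

lemma ofReal_sliceIntegral (hη : Continuous η) (h0 : ∀ x, 0 ≤ η x) (hs : tsupport η ⊆ Θ.source)
    (hc : 0 < c) :
    ENNReal.ofReal (sliceIntegral Θ c η) = ∫⁻ v in euclideanCons 0 ⁻¹' Θ.target,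
      ENNReal.ofReal (c * η (Θ.symm (euclideanCons 0 v))) := by
  obtain ⟨hHc, hHs⟩ := continuous_indicator_comp_symm Θ hη hs
  have ho := (Θ.open_target.preimage (isometry_euclideanCons (m := m) 0).continuous).measurableSet
  have hHs' : HasCompactSupport fun v : EuclideanSpace ℝ (Fin m) ↦
      Θ.target.indicator (η ∘ Θ.symm) (euclideanCons 0 v) :=
    hHs.comp_isClosedEmbedding (isometry_euclideanCons 0).isClosedEmbedding
  have hi : Integrable fun v : EuclideanSpace ℝ (Fin m) ↦
      c * Θ.target.indicator (η ∘ Θ.symm) (euclideanCons 0 v) :=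
    ((hHc.comp (isometry_euclideanCons 0).continuous).integrable_of_hasCompactSupport
      hHs').const_mul c
  rw [sliceIntegral, ← integral_const_mul, ofReal_integral_eq_lintegral_ofReal hi
    (.of_forall fun v ↦ mul_nonneg hc.le (indicator_nonneg (fun _ _ ↦ h0 _) _)),
      ← lintegral_indicator ho]
  refine lintegral_congr fun v ↦ ?_
  by_cases hv : euclideanCons 0 v ∈ Θ.target
  · rw [indicator_of_mem hv, indicator_of_mem (show v ∈ euclideanCons 0 ⁻¹' Θ.target from hv)]
    rfl
  · rw [indicator_of_notMem hv, indicator_of_notMem (show v ∉ euclideanCons 0 ⁻¹' Θ.target from hv),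
      mul_zero, ENNReal.ofReal_zero]

namespace IsAlmostIsometricChart

lemma nodalIntegral_le (h : IsAlmostIsometricChart m φ c K Θ)
    (hφ : ContMDiff (𝓡 (m + 1)) 𝓘(ℝ, ℝ) 1 φ)
    (hη : Continuous η) (h0 : ∀ x, 0 ≤ η x) (hs : tsupport η ⊆ Θ.source) (hc : 0 < c) :
    nodalIntegral m φ η ≤ (K : ℝ≥0∞) ^ (m + 1) * ENNReal.ofReal (sliceIntegral Θ c η) := by
  have hfm : Measurable fun x ↦ ENNReal.ofReal (η x * ‖grad (m + 1) φ x‖) :=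
    (hη.mul (continuous_norm_grad hφ)).measurable.ennreal_ofReal
  rw [nodalIntegral, ← setLIntegral_eq_of_tsupport_subset Θ.open_source.measurableSet hs,
    Measure.restrict_restrict Θ.open_source.measurableSet, inter_comm]
  refine (lintegral_mono' h.restrict_hausdorffMeasure_le le_rfl).trans ?_
  rw [lintegral_smul_measure, lintegral_map' hfm.aemeasurable aemeasurable_slice,
    ofReal_sliceIntegral hη h0 hs hc, pow_succ, smul_eq_mul,
    mul_assoc, ← lintegral_const_mul' _ _ ENNReal.coe_ne_top]
  refine mul_le_mul_right ?_ _
  refine setLIntegral_mono'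
    ((Θ.open_target.preimage (isometry_euclideanCons (m := m) 0).continuous).measurableSet)
    fun v hv ↦ ?_
  rw [← ENNReal.ofReal_coe_nnreal, ← ENNReal.ofReal_mul (by positivity)]
  refine ENNReal.ofReal_le_ofReal ?_
  have h1 := h.norm_grad_le _ (Θ.map_target hv)
  have h2 := h0 (Θ.symm (euclideanCons 0 v))
  calc _ ≤ _ := mul_le_mul_of_nonneg_left h1 h2
    _ = _ := by ring

lemma le_nodalIntegral (h : IsAlmostIsometricChart m φ c K Θ)
    (hφ : ContMDiff (𝓡 (m + 1)) 𝓘(ℝ, ℝ) 1 φ)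
    (hη : Continuous η) (h0 : ∀ x, 0 ≤ η x) (hs : tsupport η ⊆ Θ.source) (hc : 0 < c) :
    ENNReal.ofReal (sliceIntegral Θ c η) ≤ (K : ℝ≥0∞) ^ (m + 1) * nodalIntegral m φ η := by
  have hfm : Measurable fun x ↦ ENNReal.ofReal (η x * ‖grad (m + 1) φ x‖) :=
    (hη.mul (continuous_norm_grad hφ)).measurable.ennreal_ofReal
  rw [nodalIntegral, ← setLIntegral_eq_of_tsupport_subset Θ.open_source.measurableSet hs,
    Measure.restrict_restrict Θ.open_source.measurableSet, inter_comm,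
      ofReal_sliceIntegral hη h0 hs hc, pow_succ', mul_assoc]
  have h1 := lintegral_mono' (h.le_restrict_hausdorffMeasure hc)
    (le_refl fun x ↦ ENNReal.ofReal (η x * ‖grad (m + 1) φ x‖))
  rw [lintegral_smul_measure, lintegral_map' hfm.aemeasurable aemeasurable_slice, smul_eq_mul] at h1
  refine le_trans ?_ (mul_le_mul_right h1 _)
  rw [← lintegral_const_mul' _ _ ENNReal.coe_ne_top]
  refine setLIntegral_mono'
    ((Θ.open_target.preimage (isometry_euclideanCons (m := m) 0).continuous).measurableSet)
    fun v hv ↦ ?_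
  rw [← ENNReal.ofReal_coe_nnreal, ← ENNReal.ofReal_mul (by positivity)]
  refine ENNReal.ofReal_le_ofReal ?_
  have h1 := h.le_norm_grad _ (Θ.map_target hv)
  have h2 := h0 (Θ.symm (euclideanCons 0 v))
  calc _ ≤ _ := mul_le_mul_of_nonneg_right h1 h2
    _ = _ := by ring

lemma continuous_cauchy_slice (H : EuclideanSpace ℝ (Fin (m + 1)) → ℝ) (hH : Continuous H)
    (a c : ℝ) :
    Continuous fun z : EuclideanSpace ℝ (Fin (m + 1)) ↦ a * (1 + (a * (c * z 0)) ^ 2)⁻¹ * H z :=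
  (continuous_cauchy (continuous_const.mul (EuclideanSpace.proj (𝕜 := ℝ) 0).continuous) a).mul hH

lemma lintegral_cauchy (hη : Continuous η) (h0 : ∀ x, 0 ≤ η x) (hs : tsupport η ⊆ Θ.source)
    (h : IsAlmostIsometricChart m φ c K Θ)
    (hc : 0 < c) {a : ℝ} (ha : 0 ≤ a) :
    ENNReal.ofReal (∫ z, a * (1 + (a * (c * z 0)) ^ 2)⁻¹ * Θ.target.indicator (η ∘ Θ.symm) z) =
      ∫⁻ z in Θ.target, ENNReal.ofReal (a * (1 + (a * φ (Θ.symm z)) ^ 2)⁻¹ * η (Θ.symm z)) := by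
  obtain ⟨hHc, hHs⟩ := continuous_indicator_comp_symm Θ hη hs
  rw [ofReal_integral_eq_lintegral_ofReal
    ((continuous_cauchy_slice _ hHc a c).integrable_of_hasCompactSupport hHs.mul_left)
    (.of_forall fun z ↦ mul_nonneg (by positivity) (indicator_nonneg (fun _ _ ↦ h0 _) _)),
      ← lintegral_indicator Θ.open_target.measurableSet]
  refine lintegral_congr fun z ↦ ?_
  by_cases hz : z ∈ Θ.target
  · rw [indicator_of_mem hz, indicator_of_mem hz]
    have h1 := h.apply_zero _ (Θ.map_target hz)
    rw [Θ.right_inv hz] at h1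
    rw [h1, mul_inv_cancel_left₀ hc.ne']
    rfl
  · rw [indicator_of_notMem hz, indicator_of_notMem hz, mul_zero, ENNReal.ofReal_zero]

lemma ofReal_integral_cauchy (hφ : ContMDiff (𝓡 (m + 1)) 𝓘(ℝ, ℝ) 1 φ) (hη : Continuous η)
    (h0 : ∀ x, 0 ≤ η x)
    (hs : tsupport η ⊆ Θ.source) {a : ℝ} (ha : 0 ≤ a) :
    ENNReal.ofReal (∫ x, a * (1 + (a * φ x) ^ 2)⁻¹ *
      (η x * ‖grad (m + 1) φ x‖ ^ 2) ∂(volumeMeasure (m + 1) M)) =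
      ∫⁻ x in Θ.source, ENNReal.ofReal (η x *
        (a * (1 + (a * φ x) ^ 2)⁻¹ * ‖grad (m + 1) φ x‖ ^ 2)) ∂(volumeMeasure (m + 1) M) := by
  have hg := continuous_norm_grad hφ
  have hi : Integrable (fun x ↦ a * (1 + (a * φ x) ^ 2)⁻¹ * (η x * ‖grad (m + 1) φ x‖ ^ 2))
      (volumeMeasure (m + 1) M) :=
    integrable_of_continuous ((continuous_cauchy hφ.continuous a).mul (hη.mul (hg.pow 2)))
  rw [setLIntegral_eq_of_tsupport_subset Θ.open_source.measurableSet hs,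
    ofReal_integral_eq_lintegral_ofReal hi
    (.of_forall fun x ↦ by have := h0 x; positivity)]
  exact lintegral_congr fun x ↦ by rw [mul_left_comm]

/-- In an almost isometric chart the flux agrees with the integral over the slice, up to a factor
close to one. Of the factors of `K`, one comes from the volume and two from `|∇φ|²`. -/
lemma nodalFlux_le (h : IsAlmostIsometricChart m φ c K Θ) (hφ : ContMDiff (𝓡 (m + 1)) 𝓘(ℝ, ℝ) 2 φ)
    (hη : ContMDiff (𝓡 (m + 1)) 𝓘(ℝ, ℝ) 1 η) (h0 : ∀ x, 0 ≤ η x) (hs : tsupport η ⊆ Θ.source)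
      (hc : 0 < c) :
    nodalFlux (m + 1) φ η ≤ K ^ 3 * sliceIntegral Θ c η := by
  have hφ1 : ContMDiff (𝓡 (m + 1)) 𝓘(ℝ, ℝ) 1 φ := hφ.of_le (by norm_num)
  have hg := continuous_norm_grad hφ1
  obtain ⟨hHc, hHs⟩ := continuous_indicator_comp_symm Θ hη.continuous hs
  have hlim := (tendsto_integral_cauchy_mul hHc hHs hc).const_mul ((K : ℝ) ^ 3 * c ^ 2)
  have hle := le_of_tendsto_of_tendsto (tendsto_integral_cauchy_mul_norm_grad_sq hφ hη) hlim ?_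
  · have h2 : (K : ℝ) ^ 3 * c ^ 2 * (Real.pi / c * ∫ v :
        EuclideanSpace ℝ (Fin m), Θ.target.indicator (η ∘ Θ.symm) (euclideanCons 0 v)) =
        Real.pi * (K ^ 3 * sliceIntegral Θ c η) := by
      rw [sliceIntegral]
      field_simp
    rw [h2] at hle
    exact le_of_mul_le_mul_left hle Real.pi_pos
  filter_upwards [eventually_ge_atTop 0] with a ha
  refine (ENNReal.ofReal_le_ofReal_iff ?_).1 ?_
  · exact mul_nonneg (by positivity) (integral_nonneg fun z ↦
      mul_nonneg (by positivity) (indicator_nonneg (fun _ _ ↦ h0 _) _))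
  rw [ENNReal.ofReal_mul (by positivity), lintegral_cauchy hη.continuous h0 hs h hc ha,
    ofReal_integral_cauchy hφ1 hη.continuous h0 hs ha]
  have hfm : Measurable fun x ↦ ENNReal.ofReal
      (η x * (a * (1 + (a * φ x) ^ 2)⁻¹ * ‖grad (m + 1) φ x‖ ^ 2)) :=
    (hη.continuous.mul ((continuous_cauchy hφ.continuous a).mul
      (hg.pow 2))).measurable.ennreal_ofReal
  refine (lintegral_mono' h.volume_le le_rfl).trans ?_
  rw [lintegral_smul_measure, lintegral_map' hfm.aemeasurable
    (Θ.continuousOn_symm.aemeasurable Θ.open_target.measurableSet), smul_eq_mul,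
    ← lintegral_const_mul' _ _ ENNReal.coe_ne_top, ← lintegral_const_mul' _ _ ENNReal.ofReal_ne_top]
  refine setLIntegral_mono' Θ.open_target.measurableSet fun z hz ↦ ?_
  rw [← ENNReal.ofReal_coe_nnreal, ← ENNReal.ofReal_mul (by positivity),
    ← ENNReal.ofReal_mul (by positivity)]
  refine ENNReal.ofReal_le_ofReal ?_
  have h1 := pow_le_pow_left₀ (norm_nonneg _) (h.norm_grad_le _ (Θ.map_target hz)) 2
  have h2 := h0 (Θ.symm z)
  calc _ = (K * (a * (1 + (a * φ (Θ.symm z)) ^ 2)⁻¹ * η (Θ.symm z))) *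
      ‖grad (m + 1) φ (Θ.symm z)‖ ^ 2 := by ring
    _ ≤ _ := mul_le_mul_of_nonneg_left h1 (by positivity)
    _ = _ := by ring

lemma le_nodalFlux (h : IsAlmostIsometricChart m φ c K Θ) (hφ : ContMDiff (𝓡 (m + 1)) 𝓘(ℝ, ℝ) 2 φ)
    (hη : ContMDiff (𝓡 (m + 1)) 𝓘(ℝ, ℝ) 1 η) (h0 : ∀ x, 0 ≤ η x) (hs : tsupport η ⊆ Θ.source)
      (hc : 0 < c) :
    sliceIntegral Θ c η ≤ K ^ 3 * nodalFlux (m + 1) φ η := by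
  have hφ1 : ContMDiff (𝓡 (m + 1)) 𝓘(ℝ, ℝ) 1 φ := hφ.of_le (by norm_num)
  have hg := continuous_norm_grad hφ1
  obtain ⟨hHc, hHs⟩ := continuous_indicator_comp_symm Θ hη.continuous hs
  have hlim := (tendsto_integral_cauchy_mul hHc hHs hc).const_mul (c ^ 2)
  have hle :=
    le_of_tendsto_of_tendsto hlim ((tendsto_integral_cauchy_mul_norm_grad_sq hφ hη).const_mul
    ((K : ℝ) ^ 3)) ?_
  · have h2 : c ^ 2 * (Real.pi / c * ∫ v : EuclideanSpace ℝ (Fin m),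
        Θ.target.indicator (η ∘ Θ.symm) (euclideanCons 0 v)) =
        Real.pi * sliceIntegral Θ c η := by
      rw [sliceIntegral]
      field_simp
    rw [h2, mul_left_comm] at hle
    exact le_of_mul_le_mul_left hle Real.pi_pos
  filter_upwards [eventually_ge_atTop 0] with a ha
  refine (ENNReal.ofReal_le_ofReal_iff ?_).1 ?_
  · exact mul_nonneg (by positivity) (integral_nonneg fun x ↦ by have := h0 x; positivity)
  rw [ENNReal.ofReal_mul (by positivity), ENNReal.ofReal_mul (by positivity),
    lintegral_cauchy hη.continuous h0 hs h hc ha,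
    ofReal_integral_cauchy hφ1 hη.continuous h0 hs ha]
  have hfm : Measurable fun x ↦ ENNReal.ofReal
      (η x * (a * (1 + (a * φ x) ^ 2)⁻¹ * ‖grad (m + 1) φ x‖ ^ 2)) :=
    (hη.continuous.mul ((continuous_cauchy hφ.continuous a).mul
      (hg.pow 2))).measurable.ennreal_ofReal
  have h1 := lintegral_mono' h.le_volume (le_refl fun x ↦
    ENNReal.ofReal (η x * (a * (1 + (a * φ x) ^ 2)⁻¹ * ‖grad (m + 1) φ x‖ ^ 2)))
  rw [lintegral_smul_measure, lintegral_map' hfm.aemeasurable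
    (Θ.continuousOn_symm.aemeasurable Θ.open_target.measurableSet), smul_eq_mul] at h1
  have h3 : ENNReal.ofReal ((K : ℝ) ^ 3) = ENNReal.ofReal ((K : ℝ) ^ 2) * K := by
    rw [← ENNReal.ofReal_coe_nnreal (p := K), ← ENNReal.ofReal_mul (by positivity), pow_succ]
  rw [h3, mul_assoc]
  refine le_trans ?_ (mul_le_mul_right h1 _)
  rw [← lintegral_const_mul' _ _ ENNReal.ofReal_ne_top,
    ← lintegral_const_mul' _ _ ENNReal.ofReal_ne_top]
  refine setLIntegral_mono' Θ.open_target.measurableSet fun z hz ↦ ?_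
  rw [← ENNReal.ofReal_mul (by positivity), ← ENNReal.ofReal_mul (by positivity)]
  refine ENNReal.ofReal_le_ofReal ?_
  have h1 := pow_le_pow_left₀ hc.le (h.le_norm_grad _ (Θ.map_target hz)) 2
  have h2 := h0 (Θ.symm z)
  calc _ ≤ _ := mul_le_mul_of_nonneg_right h1 (by positivity)
    _ = _ := by ring

end IsAlmostIsometricChart

end

/-! ### Globalization away from the singular set -/

section
variable {m : ℕ} {M : Type*} [EMetricSpace M] [ChartedSpace (EuclideanSpace ℝ (Fin (m + 1))) M]
  [IsManifold (𝓡 (m + 1)) ∞ M]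
  [RiemannianBundle (fun x : M ↦ TangentSpace (𝓡 (m + 1)) x)] [MeasurableSpace M] [BorelSpace M]
  [IsContMDiffRiemannianBundle (𝓡 (m + 1)) ∞ (EuclideanSpace ℝ (Fin (m + 1)))
    (fun x : M ↦ TangentSpace (𝓡 (m + 1)) x)]
  [CompactSpace M] {φ η : M → ℝ}

lemma measurable_ofReal_mul_norm_grad (hφ : ContMDiff (𝓡 (m + 1)) 𝓘(ℝ, ℝ) 1 φ) (hη : Continuous η) :
    Measurable fun x ↦ ENNReal.ofReal (η x * ‖grad (m + 1) φ x‖) :=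
  (hη.mul (continuous_norm_grad hφ)).measurable.ennreal_ofReal

lemma nodalIntegral_eq_zero (hφ : Continuous φ) (hs : ∀ x ∈ tsupport η, φ x ≠ 0) :
    nodalIntegral m φ η = 0 := by
  have hN : MeasurableSet (nodalSet φ) := (isClosed_eq hφ continuous_const).measurableSet
  rw [nodalIntegral, setLIntegral_congr_fun (g := 0) hN fun x hx ↦ ?_]
  · simp
  · simp only [Pi.zero_apply]
    rw [image_eq_zero_of_notMem_tsupport fun h ↦ hs x h hx, zero_mul, ENNReal.ofReal_zero]

lemma nodalIntegral_sum {ι : Type*} (t : Finset ι) (hφ : ContMDiff (𝓡 (m + 1)) 𝓘(ℝ, ℝ) 1 φ)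
    (ξ : ι → M → ℝ)
    (hξ : ∀ i, Continuous (ξ i)) (h0 : ∀ i x, 0 ≤ ξ i x) :
    nodalIntegral m φ (fun x ↦ ∑ i ∈ t, ξ i x) = ∑ i ∈ t, nodalIntegral m φ (ξ i) := by
  simp only [nodalIntegral]
  rw [← lintegral_finsetSum _ fun i _ ↦ measurable_ofReal_mul_norm_grad hφ (hξ i)]
  refine lintegral_congr fun x ↦ ?_
  rw [Finset.sum_mul, ENNReal.ofReal_sum_of_nonneg fun i _ ↦ mul_nonneg (h0 i x) (norm_nonneg _)]

lemma nodalFlux_sum {ι : Type*} (t : Finset ι) (hφ : ContMDiff (𝓡 (m + 1)) 𝓘(ℝ, ℝ) 2 φ)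
    (ξ : ι → M → ℝ)
    (hξ : ∀ i, ContMDiff (𝓡 (m + 1)) 𝓘(ℝ, ℝ) 1 (ξ i)) :
    nodalFlux (m + 1) φ (fun x ↦ ∑ i ∈ t, ξ i x) = ∑ i ∈ t, nodalFlux (m + 1) φ (ξ i) := by
  classical
  induction t using Finset.induction_on with
  | empty =>
    simp only [Finset.sum_empty]
    exact nodalFlux_eq_zero hφ contMDiff_const fun x hx ↦ by
      have : tsupport (fun _ : M ↦ (0 : ℝ)) = ∅ := tsupport_eq_empty_iff.2 rfl
      rw [this] at hx
      exact hx.elim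
  | insert i t hi ih =>
    simp only [Finset.sum_insert hi]
    rw [nodalFlux_add hφ (hξ i) (contMDiff_finsetSum fun i _ ↦ hξ i), ih]

variable [IsRiemannianManifold (𝓡 (m + 1)) M]

/-- Near a point that is not a singular point of the nodal set, the flux and the nodal integral of
a function with small support agree up to a factor close to one. -/
lemma exists_isOpen_nodalIntegral_le (hφ : ContMDiff (𝓡 (m + 1)) 𝓘(ℝ, ℝ) 2 φ) {p : M}
    (hp : ¬(φ p = 0 ∧ grad (m + 1) φ p = 0)) {K : ℝ≥0} (hK : 1 < K) :
    ∃ U : Set M, (IsOpen U ∧ p ∈ U) ∧ ∀ ξ : M → ℝ, ContMDiff (𝓡 (m + 1)) 𝓘(ℝ, ℝ) 1 ξ →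
      (∀ x, 0 ≤ ξ x) → tsupport ξ ⊆ U →
      nodalIntegral m φ ξ ≤ (K : ℝ≥0∞) ^ (m + 4) * ENNReal.ofReal (nodalFlux (m + 1) φ ξ) ∧
      ENNReal.ofReal (nodalFlux (m + 1) φ ξ) ≤ (K : ℝ≥0∞) ^ (m + 4) * nodalIntegral m φ ξ := by
  have hφ1 : ContMDiff (𝓡 (m + 1)) 𝓘(ℝ, ℝ) 1 φ := hφ.of_le (by norm_num)
  by_cases hg : grad (m + 1) φ p = 0
  · refine ⟨{x | φ x ≠ 0}, ⟨isOpen_ne_fun hφ.continuous continuous_const, fun h ↦ hp ⟨h, hg⟩⟩,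
      fun ξ hξ _ hs ↦ ?_⟩
    rw [nodalIntegral_eq_zero hφ.continuous hs, nodalFlux_eq_zero hφ hξ hs]
    simp
  · obtain ⟨Θ, hpΘ, hΘ⟩ := exists_isAlmostIsometricChart hφ1 hg hK
    have hc := norm_pos_iff.2 hg
    have hK3 : ENNReal.ofReal ((K : ℝ) ^ 3) = (K : ℝ≥0∞) ^ 3 := by
      rw [ENNReal.ofReal_pow K.coe_nonneg, ENNReal.ofReal_coe_nnreal]
    refine ⟨Θ.source, ⟨Θ.open_source, hpΘ⟩, fun ξ hξ h0 hs ↦ ⟨?_, ?_⟩⟩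
    · refine (hΘ.nodalIntegral_le hφ1 hξ.continuous h0 hs hc).trans ?_
      rw [show m + 4 = (m + 1) + 3 by ring, pow_add _ (m + 1) 3, mul_assoc, ← hK3,
        ← ENNReal.ofReal_mul (by positivity)]
      exact mul_le_mul_right (ENNReal.ofReal_le_ofReal (hΘ.le_nodalFlux hφ hξ h0 hs hc)) _
    · refine (ENNReal.ofReal_le_ofReal (hΘ.nodalFlux_le hφ hξ h0 hs hc)).trans ?_
      rw [ENNReal.ofReal_mul (by positivity), hK3, show m + 4 = 3 + (m + 1) by
        ring, pow_add _ 3 (m + 1), mul_assoc]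
      exact mul_le_mul_right (hΘ.le_nodalIntegral hφ1 hξ.continuous h0 hs hc) _

lemma le_of_forall_one_lt_le_pow_mul {a b : ℝ≥0∞} (k : ℕ)
    (h : ∀ K : ℝ≥0, 1 < K → a ≤ (K : ℝ≥0∞) ^ k * b) : a ≤ b := by
  have h1 : Tendsto (fun K : ℝ≥0 ↦ (K : ℝ≥0∞) ^ k * b) (𝓝[>] 1) (𝓝 (1 * b)) := by
    refine ENNReal.Tendsto.mul_const ?_ (.inl one_ne_zero)
    have : Tendsto (fun K : ℝ≥0 ↦ ((K ^ k : ℝ≥0) : ℝ≥0∞)) (𝓝 1) (𝓝 ((1 ^ k : ℝ≥0) : ℝ≥0∞)) :=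
      ENNReal.tendsto_coe.2 ((continuous_pow k).tendsto 1)
    simp only [ENNReal.coe_pow, one_pow, ENNReal.coe_one] at this
    exact this.mono_left nhdsWithin_le_nhds
  rw [one_mul] at h1
  exact ge_of_tendsto h1 (eventually_mem_nhdsWithin.mono fun K hK ↦ h K hK)

/-- The flux of a function that vanishes near the singular part of the nodal set is its nodal
integral. -/
lemma nodalIntegral_eq_of_regular (hφ : ContMDiff (𝓡 (m + 1)) 𝓘(ℝ, ℝ) 2 φ)
    (hη : ContMDiff (𝓡 (m + 1)) 𝓘(ℝ, ℝ) 1 η)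
    (h0 : ∀ x, 0 ≤ η x) (hreg : ∀ x ∈ tsupport η, ¬(φ x = 0 ∧ grad (m + 1) φ x = 0)) :
    nodalIntegral m φ η = ENNReal.ofReal (nodalFlux (m + 1) φ η) := by
  have hφ1 : ContMDiff (𝓡 (m + 1)) 𝓘(ℝ, ℝ) 1 φ := hφ.of_le (by norm_num)
  have key : ∀ K : ℝ≥0, 1 < K →
      nodalIntegral m φ η ≤ (K : ℝ≥0∞) ^ (m + 4) * ENNReal.ofReal (nodalFlux (m + 1) φ η) ∧
      ENNReal.ofReal (nodalFlux (m + 1) φ η) ≤ (K : ℝ≥0∞) ^ (m + 4) * nodalIntegral m φ η := by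
    intro K hK
    choose! U hU hUξ using fun x (hx : x ∈ tsupport η) ↦
      exists_isOpen_nodalIntegral_le hφ (hreg x hx) hK
    obtain ⟨t, ρ, hts, hρ, hρ0, hsub, hsum⟩ :=
      exists_finite_partition (n := m + 1) (isClosed_tsupport η) U hU
    have hξ : ∀ i, ContMDiff (𝓡 (m + 1)) 𝓘(ℝ, ℝ) 1 fun x ↦ ρ i x * η x := fun i ↦
      ((hρ i).of_le (by norm_num)).mul hη
    have hξ0 : ∀ i x, 0 ≤ ρ i x * η x := fun i x ↦ mul_nonneg (hρ0 i x) (h0 x)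
    have hξU : ∀ i, tsupport (fun x ↦ ρ i x * η x) ⊆ U i := fun i ↦
      (tsupport_mul_subset_left).trans (hsub i)
    have hηs : η = fun x ↦ ∑ i, ρ i x * η x := by
      ext x
      by_cases hx : x ∈ tsupport η
      · rw [← Finset.sum_mul, hsum x hx, one_mul]
      · simp [image_eq_zero_of_notMem_tsupport hx]
    have h1 := nodalIntegral_sum Finset.univ hφ1 (fun i x ↦ ρ i x * η x)
      (fun i ↦ (hξ i).continuous) hξ0
    have h2 := nodalFlux_sum Finset.univ hφ (fun i x ↦ ρ i x * η x) hξ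
    rw [← hηs] at h1 h2
    rw [h1, h2, ENNReal.ofReal_sum_of_nonneg fun i _ ↦
      nodalFlux_nonneg hφ (hξ i) (hξ0 i), Finset.mul_sum, Finset.mul_sum]
    exact ⟨Finset.sum_le_sum fun i _ ↦ (hUξ i (hts i) _ (hξ i) (hξ0 i) (hξU i)).1,
      Finset.sum_le_sum fun i _ ↦ (hUξ i (hts i) _ (hξ i) (hξ0 i) (hξU i)).2⟩
  exact le_antisymm (le_of_forall_one_lt_le_pow_mul _ fun K hK ↦ (key K hK).1)
    (le_of_forall_one_lt_le_pow_mul _ fun K hK ↦ (key K hK).2)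

end

/-! ### The derivative of `|∇φ|² + φ²` along `∇φ` -/

section
variable {n : ℕ}

lemma partialDeriv_mul {F G : EuclideanSpace ℝ (Fin n) → ℝ} {y : EuclideanSpace ℝ (Fin n)}
    (hF : DifferentiableAt ℝ F y)
    (hG : DifferentiableAt ℝ G y) (i : Fin n) :
    partialDeriv i (fun y ↦ F y * G y) y = F y * partialDeriv i G y + G y * partialDeriv i F y := by
  simp only [partialDeriv]
  rw [(hF.hasFDerivAt.fun_mul hG.hasFDerivAt).fderiv]
  rfl

lemma partialDeriv_sum {ι : Type*} {t : Finset ι} {F : ι → EuclideanSpace ℝ (Fin n) → ℝ}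
    {y : EuclideanSpace ℝ (Fin n)}
    (hF : ∀ k ∈ t, DifferentiableAt ℝ (F k) y) (i : Fin n) :
    partialDeriv i (fun y ↦ ∑ k ∈ t, F k y) y = ∑ k ∈ t, partialDeriv i (F k) y := by
  simp only [partialDeriv]
  rw [fderiv_fun_sum hF, sum_apply]

lemma partialDeriv_add {F G : EuclideanSpace ℝ (Fin n) → ℝ} {y : EuclideanSpace ℝ (Fin n)}
    (hF : DifferentiableAt ℝ F y)
    (hG : DifferentiableAt ℝ G y) (i : Fin n) :
    partialDeriv i (fun y ↦ F y + G y) y = partialDeriv i F y + partialDeriv i G y := by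
  simp only [partialDeriv]
  rw [fderiv_fun_add hF hG, add_apply]

lemma _root_.ContinuousOn.isBigO_one {E : Type*} [TopologicalSpace E] {s : Set E} {f : E → ℝ}
    (hf : ContinuousOn f s) (hs : IsOpen s) {y : E} (hy : y ∈ s) :
    f =O[𝓝 y] (fun _ ↦ (1 : ℝ)) :=
  (hf.continuousAt (hs.mem_nhds hy)).isBigO_one ℝ

/-- A partial derivative of a product of three functions, two of which are `O(N)`, is `O(N)`. -/
lemma isBigO_partialDeriv_mul {a u v : EuclideanSpace ℝ (Fin n) → ℝ}
    {s : Set (EuclideanSpace ℝ (Fin n))} (hs : IsOpen s)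
    {y : EuclideanSpace ℝ (Fin n)} (hy : y ∈ s) (ha : ContDiffOn ℝ 1 a s) (hu : ContDiffOn ℝ 1 u s)
      (hv : ContDiffOn ℝ 1 v s)
    {N : EuclideanSpace ℝ (Fin n) → ℝ} (huN : u =O[𝓝 y] N) (hvN : v =O[𝓝 y] N) (i : Fin n) :
    partialDeriv i (fun z ↦ a z * (u z * v z)) =O[𝓝 y] N := by
  have hd : ∀ {f : EuclideanSpace ℝ (Fin n) → ℝ}, ContDiffOn ℝ 1 f s →
      ∀ z ∈ s, DifferentiableAt ℝ f z :=
    fun hf z hz ↦ (hf.contDiffAt (hs.mem_nhds hz)).differentiableAt one_ne_zero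
  have hp : ∀ {f : EuclideanSpace ℝ (Fin n) → ℝ}, ContDiffOn ℝ 1 f s →
      partialDeriv i f =O[𝓝 y] fun _ ↦ (1 : ℝ) := fun hf ↦
    (contDiffOn_partialDeriv (k := 0) hs hf i).continuousOn.isBigO_one hs hy
  have hb : ∀ {f : EuclideanSpace ℝ (Fin n) → ℝ}, ContDiffOn ℝ 1 f s → f =O[𝓝 y] fun _ ↦
      (1 : ℝ) := fun hf ↦
    hf.continuousOn.isBigO_one hs hy
  have h1 : (fun z ↦ a z * (u z * partialDeriv i v z + v z * partialDeriv i u z) + u z * v z *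
      partialDeriv i a z) =O[𝓝 y] N := by
    have e1 : (fun z ↦ a z * (u z * partialDeriv i v z + v z * partialDeriv i u z)) =O[𝓝 y] N := by
      simpa using (hb ha).mul ((huN.mul (hp hv)).add (hvN.mul (hp hu)))
    have e2 : (fun z ↦ u z * v z * partialDeriv i a z) =O[𝓝 y] N := by
      simpa using (huN.mul (hb hv)).mul (hp ha)
    exact e1.add e2
  refine h1.congr' ?_ .rfl
  filter_upwards [hs.mem_nhds hy] with z hz
  rw [partialDeriv_mul (hd ha z hz) ((hd hu z hz).fun_mul (hd hv z hz)),
    partialDeriv_mul (hd hu z hz) (hd hv z hz)]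

variable {M : Type*} [TopologicalSpace M] [ChartedSpace (EuclideanSpace ℝ (Fin n)) M]
  [IsManifold (𝓡 n) ∞ M]
  [RiemannianBundle (fun x : M ↦ TangentSpace (𝓡 n) x)]
 [IsContMDiffRiemannianBundle (𝓡 n) ∞ (EuclideanSpace ℝ (Fin n)) (fun x : M ↦ TangentSpace (𝓡 n) x)]

lemma partialDeriv_comp_symm_eq_inner {x₀ : M} {y : EuclideanSpace ℝ (Fin n)}
    (hy : y ∈ (extChartAt (𝓡 n) x₀).target)
    {f : M → ℝ} (hf : MDifferentiableAt (𝓡 n) 𝓘(ℝ, ℝ) f ((extChartAt (𝓡 n) x₀).symm y))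
      (k : Fin n) :
    partialDeriv k (f ∘ (extChartAt (𝓡 n) x₀).symm) y =
      inner ℝ (grad n f ((extChartAt (𝓡 n) x₀).symm y)) (coordVector x₀ y k) := by
  rw [inner_grad, coordVector_eq, mfderiv_chartDeriv hy hf, partialDeriv]

/-- The function `|∇φ|² + φ²`, which vanishes exactly at the singular points of the nodal set. -/
def jetNormSq (n : ℕ) {M : Type*} [TopologicalSpace M] [ChartedSpace (EuclideanSpace ℝ (Fin n)) M]
    [RiemannianBundle (fun x : M ↦ TangentSpace (𝓡 n) x)] (φ : M → ℝ) (x : M) : ℝ :=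
  inner ℝ (grad n φ x) (grad n φ x) + φ x * φ x

lemma jetNormSq_nonneg (φ : M → ℝ) (x : M) : 0 ≤ jetNormSq n φ x :=
  add_nonneg real_inner_self_nonneg (mul_self_nonneg _)

lemma contMDiff_jetNormSq {φ : M → ℝ} (hφ : ContMDiff (𝓡 n) 𝓘(ℝ, ℝ) 2 φ) :
    ContMDiff (𝓡 n) 𝓘(ℝ, ℝ) 1 (jetNormSq n φ) :=
  (contMDiff_inner_grad (k := 1) hφ hφ).add ((hφ.of_le (by norm_num)).mul (hφ.of_le (by norm_num)))

/-- The derivative of `q = |∇φ|² + φ²` along `∇φ` is `O(q)`. In coordinates `q` is quadratic in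
`φ` and its first derivatives, all of which are `O(√q)`, so the partial derivatives of `q` are
`O(√q)` as well, and the components of `∇φ` contribute another `√q`. -/
lemma isBigO_inner_grad_jetNormSq {φ : M → ℝ} (hφ : ContMDiff (𝓡 n) 𝓘(ℝ, ℝ) 2 φ) (p : M) :
    (fun x ↦ inner ℝ (grad n (jetNormSq n φ) x) (grad n φ x)) =O[𝓝 p] jetNormSq n φ := by
  set ψ := extChartAt (𝓡 n) p with hψ
  set y₀ := ψ p with hy₀
  have hto : IsOpen ψ.target := isOpen_extChartAt_target p
  have hy₀t : y₀ ∈ ψ.target := mem_extChartAt_target p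
  have hφ1 : ContMDiff (𝓡 n) 𝓘(ℝ, ℝ) 1 φ := hφ.of_le (by norm_num)
  have hq := contMDiff_jetNormSq hφ
  set Φ := φ ∘ ψ.symm with hΦ
  set N : EuclideanSpace ℝ (Fin n) → ℝ := fun y ↦ √(jetNormSq n φ (ψ.symm y)) with hN
  have hNN : ∀ y, N y * N y = jetNormSq n φ (ψ.symm y) := fun y ↦
    Real.mul_self_sqrt (jetNormSq_nonneg _ _)
  have hΦ2 : ContDiffOn ℝ 2 Φ ψ.target := contDiffOn_comp_symm (k := 2) p hφ
  have hu1 : ∀ k, ContDiffOn ℝ 1 (partialDeriv k Φ) ψ.target := fun k ↦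
    contDiffOn_partialDeriv (k := 1) hto hΦ2 k
  have hΦN : Φ =O[𝓝 y₀] N := by
    refine .of_bound 1 (.of_forall fun y ↦ ?_)
    rw [one_mul, Real.norm_of_nonneg (Real.sqrt_nonneg _)]
    refine Real.abs_le_sqrt ?_
    rw [sq]
    exact le_add_of_nonneg_left real_inner_self_nonneg
  have huN : ∀ k, partialDeriv k Φ =O[𝓝 y₀] N := by
    intro k
    have h1 : (fun y ↦ N y * √(metricMatrix p y k k)) =O[𝓝 y₀] N := by
      have : (fun y ↦ √(metricMatrix p y k k)) =O[𝓝 y₀] fun _ ↦ (1 : ℝ) :=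
        ((contDiffOn_metricMatrix p k k).continuousOn.sqrt).isBigO_one hto hy₀t
      simpa using (isBigO_refl N (𝓝 y₀)).mul this
    refine IsBigO.trans (.of_bound 1 ?_) h1
    filter_upwards [hto.mem_nhds hy₀t] with y hy
    rw [partialDeriv_comp_symm_eq_inner hy (mdifferentiable_of_contMDiff hφ1 _), one_mul, norm_mul,
      Real.norm_of_nonneg (Real.sqrt_nonneg _),
      Real.norm_of_nonneg (Real.sqrt_nonneg _)]
    refine (norm_inner_le_norm _ _).trans ?_
    rw [norm_eq_sqrt_real_inner, norm_eq_sqrt_real_inner]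
    exact mul_le_mul_of_nonneg_right (Real.sqrt_le_sqrt
      (le_add_of_nonneg_right (mul_self_nonneg _))) (Real.sqrt_nonneg _)
  -- the function `|∇φ|² + φ²` in coordinates
  set A : Fin n → Fin n → EuclideanSpace ℝ (Fin n) → ℝ := fun k l y ↦
    (metricMatrix p y)⁻¹ k l * (partialDeriv l Φ y * partialDeriv k Φ y) with hA
  set B : EuclideanSpace ℝ (Fin n) → ℝ := fun y ↦ 1 * (Φ y * Φ y) with hB
  have hg : ∀ k l, ContDiffOn ℝ 1 (fun y ↦ (metricMatrix p y)⁻¹ k l) ψ.target := fun k l ↦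
    (contDiffOn_metricMatrix_inv p k l).of_le (mod_cast le_top)
  have hΦ1 : ContDiffOn ℝ 1 Φ ψ.target := hΦ2.of_le (by norm_num)
  have hAd : ∀ y ∈ ψ.target, ∀ k l, DifferentiableAt ℝ (A k l) y := fun y hy k l ↦
    (((hg k l).mul ((hu1 l).mul (hu1 k))).contDiffAt (hto.mem_nhds hy)).differentiableAt one_ne_zero
  have hBd : ∀ y ∈ ψ.target, DifferentiableAt ℝ B y := fun y hy ↦
    ((contDiffOn_const.mul (hΦ1.mul hΦ1)).contDiffAt (hto.mem_nhds hy)).differentiableAt one_ne_zero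
  have hQ : jetNormSq n φ ∘ ψ.symm =ᶠ[𝓝 y₀] fun y ↦ (∑ k, ∑ l, A k l y) + B y := by
    filter_upwards [hto.mem_nhds hy₀t] with y hy
    simp only [Function.comp_apply, jetNormSq, hA, hB, hΦ]
    rw [inner_grad_grad hy (mdifferentiable_of_contMDiff hφ1 _)
      (mdifferentiable_of_contMDiff hφ1 _)]
    simp only [mul_assoc, one_mul]
    rfl
  have hqN : ∀ i, partialDeriv i (jetNormSq n φ ∘ ψ.symm) =O[𝓝 y₀] N := by
    intro i
    have h1 : (fun y ↦ (∑ k, ∑ l, partialDeriv i (A k l) y) + partialDeriv i B y) =O[𝓝 y₀] N :=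
      (IsBigO.fun_sum fun k _ ↦ IsBigO.fun_sum fun l _ ↦
        isBigO_partialDeriv_mul hto hy₀t (hg k l) (hu1 l) (hu1 k) (huN l) (huN k) i).add
      (isBigO_partialDeriv_mul hto hy₀t contDiffOn_const hΦ1 hΦ1 hΦN hΦN i)
    refine h1.congr' ?_ .rfl
    filter_upwards [hQ.fderiv (𝕜 := ℝ), hto.mem_nhds hy₀t] with y hy hyt
    refine Eq.trans ?_ (congrArg (fun L ↦ L (EuclideanSpace.single i 1)) hy).symm
    have h2 := partialDeriv_add (DifferentiableAt.fun_sum fun k (_ : k ∈ Finset.univ) ↦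
      DifferentiableAt.fun_sum fun l (_ : l ∈ Finset.univ) ↦ hAd y hyt k l) (hBd y hyt) i
    rw [partialDeriv_sum fun k _ ↦ DifferentiableAt.fun_sum fun l _ ↦ hAd y hyt k l] at h2
    refine Eq.trans ?_ h2.symm
    congr 1
    exact Finset.sum_congr rfl fun k _ ↦ (partialDeriv_sum (fun l _ ↦ hAd y hyt k l) i).symm
  have hcoord : (fun y ↦ ∑ i, ∑ j, (metricMatrix p y)⁻¹ i j * partialDeriv j Φ y *
      partialDeriv i (jetNormSq n φ ∘ ψ.symm) y) =O[𝓝 y₀] fun y ↦ N y * N y :=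
    IsBigO.fun_sum fun i _ ↦ IsBigO.fun_sum fun j _ ↦ by
      simpa using (((hg i j).continuousOn.isBigO_one hto hy₀t).mul (huN j)).mul (hqN i)
  have hψc : Tendsto ψ (𝓝 p) (𝓝 y₀) := continuousAt_extChartAt p
  refine (hcoord.comp_tendsto hψc).congr' ?_ ?_
  · filter_upwards [(isOpen_extChartAt_source (I := 𝓡 n) p).mem_nhds
      (mem_extChartAt_source p)] with x hx
    have h1 := inner_grad_grad (ψ.map_source hx) (mdifferentiable_of_contMDiff hq _)
      (mdifferentiable_of_contMDiff hφ1 _)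
    rw [Function.comp_apply, ← h1, ψ.left_inv hx]
  · filter_upwards [(isOpen_extChartAt_source (I := 𝓡 n) p).mem_nhds
      (mem_extChartAt_source p)] with x hx
    rw [Function.comp_apply, hNN, ψ.left_inv hx]

lemma exists_abs_inner_grad_jetNormSq_le [CompactSpace M] {φ : M → ℝ}
    (hφ : ContMDiff (𝓡 n) 𝓘(ℝ, ℝ) 2 φ) :
    ∃ C, 0 ≤ C ∧ ∀ x, |inner ℝ (grad n (jetNormSq n φ) x) (grad n φ x)| ≤ C * jetNormSq n φ x := by
  have h := isCompact_univ.induction_on (X := M)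
    (p := fun s ↦ ∃ C, 0 ≤ C ∧ ∀ x ∈ s, |inner ℝ (grad n (jetNormSq n φ) x) (grad n φ x)| ≤ C *
      jetNormSq n φ x)
    ⟨0, le_rfl, fun x hx ↦ hx.elim⟩ (fun s t hst ⟨C, hC, h⟩ ↦ ⟨C, hC, fun x hx ↦ h x (hst hx)⟩)
    (fun s t ⟨C, hC, h⟩ ⟨D, hD, h'⟩ ↦ ⟨C + D, add_nonneg hC hD, fun x hx ↦ ?_⟩) fun x _ ↦ ?_
  · obtain ⟨C, hC, h⟩ := h
    exact ⟨C, hC, fun x ↦ h x (mem_univ x)⟩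
  · have hq := jetNormSq_nonneg (n := n) φ x
    rw [add_mul]
    rcases hx with hx | hx
    · exact (h x hx).trans (le_add_of_nonneg_right (mul_nonneg hD hq))
    · exact (h' x hx).trans (le_add_of_nonneg_left (mul_nonneg hC hq))
  · obtain ⟨C, hC, h⟩ := (isBigO_inner_grad_jetNormSq hφ x).exists_nonneg
    refine ⟨_, mem_nhdsWithin_of_mem_nhds h.bound, C, hC, fun z hz ↦ ?_⟩
    have hz' : ‖_‖ ≤ C * ‖_‖ := hz
    rwa [Real.norm_eq_abs, Real.norm_of_nonneg (jetNormSq_nonneg _ _)] at hz'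

end

/-! ### Removing the singular set -/

/-- The bound on `t χ'(t)`, for the cutoff `χ(t) = smoothTransition (t - 1)`, is what makes the
derivatives of the rescaled cutoffs `χ(k q)` harmless. -/
lemma exists_abs_mul_deriv_smoothTransition_le :
    ∃ D, 0 ≤ D ∧ ∀ t, |t * deriv Real.smoothTransition (t - 1)| ≤ D := by
  have hc : Continuous fun t ↦ t * deriv Real.smoothTransition (t - 1) :=
    continuous_id.mul ((Real.smoothTransition.contDiff.continuous_deriv (n := 1) le_rfl).comp
      (continuous_id.sub continuous_const))
  have h0 : ∀ t ∉ Icc (1 : ℝ) 2, t * deriv Real.smoothTransition (t - 1) = 0 := by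
    intro t ht
    rw [mul_eq_zero]
    right
    rw [mem_Icc, not_and_or, not_le, not_le] at ht
    rcases ht with ht | ht
    · have : Real.smoothTransition =ᶠ[𝓝 (t - 1)] fun _ ↦ 0 := by
        filter_upwards [Iio_mem_nhds (show t - 1 < 0 by linarith)] with s hs
          using Real.smoothTransition.zero_of_nonpos (le_of_lt hs)
      rw [this.deriv_eq, deriv_const]
    · have : Real.smoothTransition =ᶠ[𝓝 (t - 1)] fun _ ↦ 1 := by
        filter_upwards [Ioi_mem_nhds (show 1 < t - 1 by linarith)] with s hs
          using Real.smoothTransition.one_of_one_le (le_of_lt hs)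
      rw [this.deriv_eq, deriv_const]
  obtain ⟨D, hD⟩ := hc.bounded_above_of_compact_support (HasCompactSupport.intro isCompact_Icc h0)
  exact ⟨D, (norm_nonneg _).trans (hD 0), hD⟩

section
variable {n : ℕ} {M : Type*} [TopologicalSpace M] [ChartedSpace (EuclideanSpace ℝ (Fin n)) M]
  [IsManifold (𝓡 n) ∞ M]
  [RiemannianBundle (fun x : M ↦ TangentSpace (𝓡 n) x)]
  [IsContMDiffRiemannianBundle (𝓡 n) ∞ (EuclideanSpace ℝ (Fin n))
    (fun x : M ↦ TangentSpace (𝓡 n) x)]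

/-- The function `η`, cut off near the singular set `{φ = 0, ∇φ = 0}`: it is unchanged where
`|∇φ|² + φ² ≥ 2 / k` and vanishes where `|∇φ|² + φ² ≤ 1 / k`. -/
def cutoff (n : ℕ) {M : Type*} [TopologicalSpace M] [ChartedSpace (EuclideanSpace ℝ (Fin n)) M]
    [RiemannianBundle (fun x : M ↦ TangentSpace (𝓡 n) x)] (φ η : M → ℝ) (k : ℕ) (x : M) : ℝ :=
  Real.smoothTransition (k * jetNormSq n φ x - 1) * η x

variable {φ η : M → ℝ}

lemma contMDiff_cutoff (hφ : ContMDiff (𝓡 n) 𝓘(ℝ, ℝ) 2 φ)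
    (hη : ContMDiff (𝓡 n) 𝓘(ℝ, ℝ) 1 η) (k : ℕ) :
    ContMDiff (𝓡 n) 𝓘(ℝ, ℝ) 1 (cutoff n φ η k) :=
  (contMDiff_comp_real (s := fun t ↦ Real.smoothTransition (k * t - 1))
    (Real.smoothTransition.contDiff.comp ((contDiff_const.mul contDiff_id).sub contDiff_const))
      (contMDiff_jetNormSq hφ)).mul hη

lemma cutoff_nonneg (h0 : ∀ x, 0 ≤ η x) (k : ℕ) (x : M) : 0 ≤ cutoff n φ η k x :=
  mul_nonneg (Real.smoothTransition.nonneg _) (h0 x)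

lemma cutoff_le (h0 : ∀ x, 0 ≤ η x) (k : ℕ) (x : M) : cutoff n φ η k x ≤ η x :=
  mul_le_of_le_one_left (h0 x) (Real.smoothTransition.le_one _)

lemma eventually_one_lt_mul_sub_one {t : ℝ} (ht : 0 < t) : ∀ᶠ k : ℕ in atTop, 1 < k * t - 1 := by
  have : Tendsto (fun k : ℕ ↦ (k : ℝ) * t) atTop atTop :=
    tendsto_natCast_atTop_atTop.atTop_mul_const ht
  filter_upwards [this.eventually_gt_atTop 2] with k hk
  linarith

lemma eventually_cutoff_eq {x : M} (hx : 0 < jetNormSq n φ x) : ∀ᶠ k :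
    ℕ in atTop, cutoff n φ η k x = η x := by
  filter_upwards [eventually_one_lt_mul_sub_one hx] with k hk
  rw [cutoff, Real.smoothTransition.one_of_one_le hk.le, one_mul]

lemma tsupport_cutoff_regular (hφ : ContMDiff (𝓡 n) 𝓘(ℝ, ℝ) 2 φ) (k : ℕ) :
    ∀ x ∈ tsupport (cutoff n φ η k), ¬(φ x = 0 ∧ grad n φ x = 0) := by
  rintro x hx ⟨h1, h2⟩
  refine notMem_tsupport_iff_eventuallyEq.2 ?_ hx
  have hq : (k : ℝ) * jetNormSq n φ x - 1 < 0 := by simp [jetNormSq, h1, h2]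
  have hc : Continuous fun x ↦ (k : ℝ) * jetNormSq n φ x - 1 :=
    (continuous_const.mul (contMDiff_jetNormSq hφ).continuous).sub continuous_const
  filter_upwards [hc.continuousAt.eventually_lt continuousAt_const hq] with z hz
  rw [cutoff, Real.smoothTransition.zero_of_nonpos (le_of_lt hz), zero_mul, Pi.zero_apply]

lemma inner_grad_cutoff (hφ : ContMDiff (𝓡 n) 𝓘(ℝ, ℝ) 2 φ) (hη : ContMDiff (𝓡 n) 𝓘(ℝ, ℝ) 1 η)
    (k : ℕ) (x : M) :
    inner ℝ (grad n (cutoff n φ η k) x) (grad n φ x) =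
      Real.smoothTransition (k * jetNormSq n φ x - 1) * inner ℝ (grad n η x) (grad n φ x) +
        η x * (deriv Real.smoothTransition (k * jetNormSq n φ x - 1) * k *
          inner ℝ (grad n (jetNormSq n φ) x) (grad n φ x)) := by
  have hq := contMDiff_jetNormSq hφ
  have h1 : HasDerivAt (fun t ↦ Real.smoothTransition (k * t - 1))
    (deriv Real.smoothTransition (k * jetNormSq n φ x - 1) * k)
      (jetNormSq n φ x) := by
    have h2 : HasDerivAt (fun t : ℝ ↦ k * t - 1) k (jetNormSq n φ x) := by
      simpa using ((hasDerivAt_id (jetNormSq n φ x)).const_mul (k : ℝ)).sub_const 1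
    exact ((Real.smoothTransition.contDiff (n := 1)).differentiable one_ne_zero _).hasDerivAt.comp
      (jetNormSq n φ x) h2
  have h3 : ContMDiff (𝓡 n) 𝓘(ℝ, ℝ) 1 fun x ↦ Real.smoothTransition (k * jetNormSq n φ x - 1) :=
    contMDiff_comp_real (s := fun t ↦ Real.smoothTransition (k * t - 1))
      (Real.smoothTransition.contDiff.comp ((contDiff_const.mul contDiff_id).sub contDiff_const)) hq
  have h2 := grad_mul (mdifferentiable_of_contMDiff h3 x) (mdifferentiable_of_contMDiff hη x)
  rw [grad_comp (mdifferentiable_of_contMDiff hq x) h1] at h2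
  refine (congrArg (fun v ↦ inner ℝ v (grad n φ x)) h2).trans ?_
  rw [inner_add_left, inner_smul_left, inner_smul_left, inner_smul_left]
  simp only [conj_trivial]

variable [T2Space M] [CompactSpace M] [MeasurableSpace M] [BorelSpace M]

/-- Cutting off near the singular set does not change the flux in the limit: the derivative of the
cutoff along `∇φ` is bounded and lives where `0 < |∇φ|² + φ² ≤ 2 / k`. -/
lemma tendsto_nodalFlux_cutoff (hφ : ContMDiff (𝓡 n) 𝓘(ℝ, ℝ) 2 φ)
    (hη : ContMDiff (𝓡 n) 𝓘(ℝ, ℝ) 1 η) :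
    Tendsto (fun k ↦ nodalFlux n φ (cutoff n φ η k)) atTop (𝓝 (nodalFlux n φ η)) := by
  have hφ1 : ContMDiff (𝓡 n) 𝓘(ℝ, ℝ) 1 φ := hφ.of_le (by norm_num)
  obtain ⟨C, hC, hCq⟩ := exists_abs_inner_grad_jetNormSq_le hφ
  obtain ⟨D, hD, hDt⟩ := exists_abs_mul_deriv_smoothTransition_le
  have hin := continuous_inner_grad hη hφ1
  have hl := continuous_laplacian hφ
  have hst : ∀ t, |Real.smoothTransition t| ≤ 1 := fun t ↦ by
    rw [abs_of_nonneg (Real.smoothTransition.nonneg t)]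
    exact Real.smoothTransition.le_one t
  refine Tendsto.const_mul _ (tendsto_integral_of_dominated_convergence
    (fun x ↦ |inner ℝ (grad n η x) (grad n φ x)| + |η x| * (C * D) + |η x| * |laplacian n φ x|)
      (fun k ↦ ?_) ?_ (fun k ↦ .of_forall fun x ↦ ?_)
    (.of_forall fun x ↦ ?_))
  · have hk := contMDiff_cutoff hφ hη k
    exact (integrable_sign_mul hφ.continuous ((continuous_inner_grad hk hφ1).add
      (hk.continuous.mul hl))).aestronglyMeasurable
  · exact integrable_of_continuous ((hin.abs.add (hη.continuous.abs.mul continuous_const)).add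
      (hη.continuous.abs.mul hl.abs))
  · rw [inner_grad_cutoff hφ hη, norm_mul]
    refine (mul_le_of_le_one_left (norm_nonneg _) (abs_real_sign_le _)).trans ?_
    refine (norm_add_le _ _).trans (add_le_add ((norm_add_le _ _).trans (add_le_add ?_ ?_)) ?_)
    · rw [norm_mul]
      exact mul_le_of_le_one_left (norm_nonneg _) (hst _)
    · rw [norm_mul]
      refine mul_le_mul_of_nonneg_left ?_ (norm_nonneg _)
      rw [norm_mul]
      calc _ ≤ ‖deriv Real.smoothTransition (k * jetNormSq n φ x - 1) * k‖ *
          (C * jetNormSq n φ x) :=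
            mul_le_mul_of_nonneg_left (hCq x) (norm_nonneg _)
        _ = C * |k * jetNormSq n φ x * deriv Real.smoothTransition (k * jetNormSq n φ x - 1)| := by
            rw [Real.norm_eq_abs, abs_mul, abs_mul, abs_mul, abs_of_nonneg (jetNormSq_nonneg φ x)]
            ring
        _ ≤ C * D := mul_le_mul_of_nonneg_left (hDt _) hC
    · rw [norm_mul]
      refine mul_le_mul_of_nonneg_right ?_ (norm_nonneg _)
      rw [cutoff, norm_mul]
      exact mul_le_of_le_one_left (norm_nonneg _) (hst _)
  · rcases (jetNormSq_nonneg (n := n) φ x).eq_or_lt with hq | hq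
    · have h1 : φ x = 0 := by
        have h2 : inner ℝ (grad n φ x) (grad n φ x) + φ x * φ x = 0 := hq.symm
        have h3 : 0 ≤ inner ℝ (grad n φ x) (grad n φ x) := real_inner_self_nonneg
        exact mul_self_eq_zero.1 (le_antisymm (by linarith) (mul_self_nonneg _))
      simp [h1]
    · refine tendsto_const_nhds.congr' ?_
      filter_upwards [eventually_one_lt_mul_sub_one hq,
        eventually_cutoff_eq (η := η) hq] with k hk hk'
      have h1 : Real.smoothTransition =ᶠ[𝓝 (k * jetNormSq n φ x - 1)] fun _ ↦ 1 := by
        filter_upwards [Ioi_mem_nhds hk] with s hs using Real.smoothTransition.one_of_one_le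
          (le_of_lt hs)
      rw [inner_grad_cutoff hφ hη, h1.deriv_eq, h1.eq_of_nhds, deriv_const, hk']
      ring

/-! ### The identity for eigenfunctions -/

/-- The integral of `|φ| (Δ + λ²) f` is twice the flux of `f`, for an eigenfunction `φ`. -/
lemma integral_abs_mul_laplacian_add (lam : ℝ) (hφ : ContMDiff (𝓡 n) 𝓘(ℝ, ℝ) 2 φ)
    (heigen : ∀ x, laplacian n φ x = -lam ^ 2 * φ x) {f : M → ℝ}
      (hf : ContMDiff (𝓡 n) 𝓘(ℝ, ℝ) 2 f) :
    ∫ x, |φ x| * (laplacian n f x + lam ^ 2 * f x) ∂(volumeMeasure n M) = 2 * nodalFlux n φ f := by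
  have hφ1 : ContMDiff (𝓡 n) 𝓘(ℝ, ℝ) 1 φ := hφ.of_le (by norm_num)
  have hf1 : ContMDiff (𝓡 n) 𝓘(ℝ, ℝ) 1 f := hf.of_le (by norm_num)
  have hin := continuous_inner_grad hφ1 hf1
  have hl := continuous_laplacian hf
  have hG1 : Continuous fun x ↦ φ x * laplacian n f x := hφ.continuous.mul hl
  have habs : ∀ x, Real.sign (φ x) * φ x = |φ x| := fun x ↦ by
    rcases lt_trichotomy (φ x) 0 with h | h | h
    · rw [Real.sign_of_neg h, abs_of_neg h, neg_one_mul]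
    · simp [h]
    · rw [Real.sign_of_pos h, abs_of_pos h, one_mul]
  have hgreen : ∀ a : ℝ, ∫ x, Real.arctan (a * φ x) * (φ x * laplacian n f x) ∂(volumeMeasure n M) =
      -(∫ x, Real.arctan (a * φ x) * inner ℝ (grad n φ x) (grad n f x) ∂(volumeMeasure n M) +
        ∫ x, a * (1 + (a * φ x) ^ 2)⁻¹ * φ x *
          inner ℝ (grad n φ x) (grad n f x) ∂(volumeMeasure n M)) := by
    intro a
    have hw : ContMDiff (𝓡 n) 𝓘(ℝ, ℝ) 1 fun x ↦ Real.arctan (a * φ x) * φ x :=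
      contMDiff_comp_real (s := fun t ↦ Real.arctan (a * t) * t)
        ((Real.contDiff_arctan.comp (contDiff_const.mul contDiff_id)).mul contDiff_id) hφ1
    have hG := integral_mul_laplacian hw hf
    have hgr : ∀ x, inner ℝ (grad n (fun x ↦ Real.arctan (a * φ x) * φ x) x) (grad n f x) =
        Real.arctan (a * φ x) * inner ℝ (grad n φ x) (grad n f x) +
          a * (1 + (a * φ x) ^ 2)⁻¹ * φ x * inner ℝ (grad n φ x) (grad n f x) := by
      intro x
      have h1 : HasDerivAt (fun t ↦ Real.arctan (a * t) * t)
          (Real.arctan (a * φ x) + a * (1 + (a * φ x) ^ 2)⁻¹ * φ x) (φ x) := by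
        have h2 := (((hasDerivAt_id (φ x)).const_mul a).arctan).mul (hasDerivAt_id (φ x))
        simp only [id, mul_one] at h2
        refine h2.congr_deriv ?_
        rw [one_div]
        ring
      refine (congrArg (fun v ↦ inner ℝ v (grad n f x))
        (grad_comp (mdifferentiable_of_contMDiff hφ1 x) h1)).trans ?_
      rw [inner_smul_left, conj_trivial, add_mul]
    have hi1 : Integrable (fun x ↦ Real.arctan (a * φ x) * inner ℝ (grad n φ x) (grad n f x))
        (volumeMeasure n M) :=
      integrable_of_continuous
        ((Real.continuous_arctan.comp (continuous_const.mul hφ.continuous)).mul hin)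
    have hi2 : Integrable (fun x ↦ a * (1 + (a * φ x) ^ 2)⁻¹ * φ x *
        inner ℝ (grad n φ x) (grad n f x)) (volumeMeasure n M) :=
      integrable_of_continuous (((continuous_cauchy hφ.continuous a).mul hφ.continuous).mul hin)
    simp_rw [hgr] at hG
    rw [← integral_add hi1 hi2, ← hG]
    simp only [mul_assoc]
  have hlim0 : Tendsto (fun a : ℝ ↦ ∫ x, a * (1 + (a * φ x) ^ 2)⁻¹ * φ x *
    inner ℝ (grad n φ x) (grad n f x) ∂(volumeMeasure n M))
      atTop (𝓝 (∫ _, 0 ∂(volumeMeasure n M))) := by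
    refine tendsto_integral_filter_of_dominated_convergence
      (fun x ↦ |inner ℝ (grad n φ x) (grad n f x)|) ?_ ?_
      (integrable_of_continuous hin.abs) ?_
    · exact .of_forall fun a ↦
        (((continuous_cauchy hφ.continuous a).mul hφ.continuous).mul hin).aestronglyMeasurable
    · refine .of_forall fun a ↦ .of_forall fun x ↦ ?_
      rw [norm_mul]
      exact mul_le_of_le_one_left (norm_nonneg _) (abs_cauchy_mul_le _ _)
    · refine .of_forall fun x ↦ ?_
      by_cases hx : φ x = 0
      · simp [hx]
      · simpa using ((tendsto_cauchy_zero hx).mul_const (φ x)).mul_const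
          (inner ℝ (grad n φ x) (grad n f x))
  rw [integral_zero] at hlim0
  have hlim1 := tendsto_integral_arctan_mul (n := n) hφ.continuous hin
  have hlim2 := tendsto_integral_arctan_mul (n := n) hφ.continuous hG1
  simp_rw [hgreen] at hlim2
  have hmain := tendsto_nhds_unique hlim2 (hlim1.add hlim0).neg
  -- Kato's identity `∫ |φ| Δf = -∫ sgn φ ⟪∇φ, ∇f⟫`
  have hkato : ∫ x, Real.sign (φ x) * (φ x * laplacian n f x) ∂(volumeMeasure n M) =
      -∫ x, Real.sign (φ x) * inner ℝ (grad n φ x) (grad n f x) ∂(volumeMeasure n M) := by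
    have hpi := Real.pi_pos
    rw [add_zero, ← mul_neg] at hmain
    exact mul_left_cancel₀ (by positivity) hmain
  have hi1 : Integrable (fun x ↦ Real.sign (φ x) * (φ x * laplacian n f x)) (volumeMeasure n M) :=
    integrable_sign_mul hφ.continuous hG1
  have hi2 : Integrable (fun x ↦ Real.sign (φ x) * (φ x * (lam ^ 2 * f x))) (volumeMeasure n M) :=
    integrable_sign_mul hφ.continuous (hφ.continuous.mul (continuous_const.mul hf.continuous))
  have hi3 : Integrable (fun x ↦ Real.sign (φ x) * inner ℝ (grad n φ x) (grad n f x))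
      (volumeMeasure n M) :=
    integrable_sign_mul hφ.continuous hin
  have e1 : ∫ x, |φ x| * (laplacian n f x + lam ^ 2 * f x) ∂(volumeMeasure n M) =
      ∫ x, Real.sign (φ x) * (φ x * laplacian n f x) ∂(volumeMeasure n M) +
        ∫ x, Real.sign (φ x) * (φ x * (lam ^ 2 * f x)) ∂(volumeMeasure n M) := by
    rw [← integral_add hi1 hi2]
    refine integral_congr_ae (.of_forall fun x ↦ ?_)
    simp only
    rw [← habs]
    ring
  have e2 : nodalFlux n φ f = -(1 / 2) * (∫ x, Real.sign (φ x) *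
    inner ℝ (grad n φ x) (grad n f x) ∂(volumeMeasure n M) -
        ∫ x, Real.sign (φ x) * (φ x * (lam ^ 2 * f x)) ∂(volumeMeasure n M)) := by
    rw [nodalFlux, ← integral_sub hi3 hi2]
    congr 1
    refine integral_congr_ae (.of_forall fun x ↦ ?_)
    simp only
    rw [heigen, real_inner_comm]
    ring
  rw [e1, e2, hkato]
  ring

end

section
variable {m : ℕ} {M : Type*} [EMetricSpace M] [ChartedSpace (EuclideanSpace ℝ (Fin (m + 1))) M]
  [IsManifold (𝓡 (m + 1)) ∞ M]
  [RiemannianBundle (fun x : M ↦ TangentSpace (𝓡 (m + 1)) x)] [MeasurableSpace M] [BorelSpace M]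
  [IsContMDiffRiemannianBundle (𝓡 (m + 1)) ∞ (EuclideanSpace ℝ (Fin (m + 1)))
    (fun x : M ↦ TangentSpace (𝓡 (m + 1)) x)]
  [CompactSpace M] [IsRiemannianManifold (𝓡 (m + 1)) M] {φ η : M → ℝ}

/-- The flux is the nodal integral, without any assumption on the singular set. One inequality is
Fatou's lemma, since `|∇φ|` vanishes on the singular set; the other one is the monotonicity of the
nodal integral. -/
theorem nodalIntegral_eq (hφ : ContMDiff (𝓡 (m + 1)) 𝓘(ℝ, ℝ) 2 φ)
    (hη : ContMDiff (𝓡 (m + 1)) 𝓘(ℝ, ℝ) 1 η)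
    (h0 : ∀ x, 0 ≤ η x) : nodalIntegral m φ η = ENNReal.ofReal (nodalFlux (m + 1) φ η) := by
  have hφ1 : ContMDiff (𝓡 (m + 1)) 𝓘(ℝ, ℝ) 1 φ := hφ.of_le (by norm_num)
  have heq : ∀ k, nodalIntegral m φ (cutoff (m + 1) φ η k) =
      ENNReal.ofReal (nodalFlux (m + 1) φ (cutoff (m + 1) φ η k)) := fun k ↦
    nodalIntegral_eq_of_regular hφ (contMDiff_cutoff hφ hη k) (cutoff_nonneg h0 k)
      (tsupport_cutoff_regular hφ k)
  have hlim := ENNReal.tendsto_ofReal (tendsto_nodalFlux_cutoff hφ hη)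
  simp_rw [← heq] at hlim
  refine le_antisymm ?_ ?_
  · rw [← hlim.liminf_eq]
    refine le_trans (lintegral_mono fun x ↦ ?_) (lintegral_liminf_le fun k ↦
      measurable_ofReal_mul_norm_grad hφ1 (contMDiff_cutoff hφ hη k).continuous)
    by_cases hg : grad (m + 1) φ x = 0
    · simp [hg]
    · have hq : 0 < jetNormSq (m + 1) φ x :=
        add_pos_of_pos_of_nonneg (real_inner_self_pos.2 hg) (mul_self_nonneg _)
      refine (tendsto_const_nhds.congr' ?_).liminf_eq.ge
      filter_upwards [eventually_cutoff_eq (η := η) hq] with k hk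
      rw [hk]
  · refine le_of_tendsto' hlim fun k ↦ lintegral_mono fun x ↦ ENNReal.ofReal_le_ofReal ?_
    exact mul_le_mul_of_nonneg_right (cutoff_le h0 k x) (norm_nonneg _)

lemma integrableOn_and_integral_of_nonneg (hφ : ContMDiff (𝓡 (m + 1)) 𝓘(ℝ, ℝ) 2 φ)
    (hη : ContMDiff (𝓡 (m + 1)) 𝓘(ℝ, ℝ) 1 η)
    (h0 : ∀ x, 0 ≤ η x) :
    IntegrableOn (fun x ↦ ‖grad (m + 1) φ x‖ * η x) (nodalSet φ) (surfaceMeasure (m + 1) M) ∧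
      ∫ x in nodalSet φ, ‖grad (m + 1) φ x‖ * η x ∂(surfaceMeasure (m + 1) M) =
        nodalFlux (m + 1) φ η := by
  have hφ1 : ContMDiff (𝓡 (m + 1)) 𝓘(ℝ, ℝ) 1 φ := hφ.of_le (by norm_num)
  have hc : Continuous fun x ↦ ‖grad (m + 1) φ x‖ * η x :=
    (continuous_norm_grad hφ1).mul hη.continuous
  have hnn : ∀ x, 0 ≤ ‖grad (m + 1) φ x‖ * η x := fun x ↦ mul_nonneg (norm_nonneg _) (h0 x)
  have hl : ∫⁻ x in nodalSet φ, ENNReal.ofReal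
      (‖grad (m + 1) φ x‖ * η x) ∂(surfaceMeasure (m + 1) M) =
      ENNReal.ofReal (nodalFlux (m + 1) φ η) := by
    simp_rw [mul_comm ‖_‖]
    exact nodalIntegral_eq (m := m) hφ hη h0
  refine ⟨⟨hc.aestronglyMeasurable, ?_⟩, ?_⟩
  · rw [hasFiniteIntegral_iff_ofReal (.of_forall hnn), hl]
    exact ENNReal.ofReal_lt_top
  · rw [integral_eq_lintegral_of_nonneg_ae (.of_forall hnn) hc.aestronglyMeasurable, hl,
      ENNReal.toReal_ofReal (nodalFlux_nonneg hφ hη h0)]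

theorem integrableOn_and_integral_eq_nodalFlux (hφ : ContMDiff (𝓡 (m + 1)) 𝓘(ℝ, ℝ) 2 φ)
    (hη : ContMDiff (𝓡 (m + 1)) 𝓘(ℝ, ℝ) 1 η) :
    IntegrableOn (fun x ↦ ‖grad (m + 1) φ x‖ * η x) (nodalSet φ) (surfaceMeasure (m + 1) M) ∧
      ∫ x in nodalSet φ, ‖grad (m + 1) φ x‖ * η x ∂(surfaceMeasure (m + 1) M) =
        nodalFlux (m + 1) φ η := by
  obtain ⟨C, hC⟩ := isCompact_univ.exists_bound_of_continuousOn hη.continuous.continuousOn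
  have hD : ContMDiff (𝓡 (m + 1)) 𝓘(ℝ, ℝ) 1 fun _ : M ↦ |C| := contMDiff_const
  have hs : ContMDiff (𝓡 (m + 1)) 𝓘(ℝ, ℝ) 1 fun x ↦ η x + |C| := hη.add hD
  obtain ⟨h1, h1'⟩ := integrableOn_and_integral_of_nonneg hφ hs fun x ↦ by
    have := (hC x (mem_univ x)).trans (le_abs_self C)
    linarith [(abs_le.1 this).1]
  obtain ⟨h2, h2'⟩ := integrableOn_and_integral_of_nonneg hφ hD fun x ↦ abs_nonneg C
  have he : (fun x ↦ ‖grad (m + 1) φ x‖ * η x) =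
      fun x ↦ ‖grad (m + 1) φ x‖ * (η x + |C|) - ‖grad (m + 1) φ x‖ * |C| := by
    ext x
    ring
  rw [he]
  refine ⟨h1.sub h2, ?_⟩
  rw [integral_sub h1 h2, h1', h2', nodalFlux_add hφ hη hD, add_sub_cancel_right]

end

lemma laplacian_const {n : ℕ} {M : Type*} [TopologicalSpace M]
    [ChartedSpace (EuclideanSpace ℝ (Fin n)) M]
    [RiemannianBundle (fun x : M ↦ TangentSpace (𝓡 n) x)] (c : ℝ) (x : M) :
      laplacian n (fun _ ↦ c) x = 0 := by
  have h : ∀ (i : Fin n) (y : EuclideanSpace ℝ (Fin n)) (c : ℝ),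
      partialDeriv i (fun _ ↦ c) y = 0 := by
    simp [partialDeriv]
  have h2 : (fun _ : M ↦ c) ∘ (extChartAt (𝓡 n) x).symm = fun _ ↦ c := rfl
  simp only [laplacian, h2, h, mul_zero, Finset.sum_const_zero]

lemma grad_dim_zero {M : Type*} [TopologicalSpace M] [ChartedSpace (EuclideanSpace ℝ (Fin 0)) M]
    [RiemannianBundle (fun x : M ↦ TangentSpace (𝓡 0) x)] (φ : M → ℝ) (x : M) :
      ‖grad 0 φ x‖ = 0 := by
  have : Subsingleton (TangentSpace (𝓡 0) x) :=
    inferInstanceAs (Subsingleton (EuclideanSpace ℝ (Fin 0)))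
  rw [Subsingleton.elim (grad 0 φ x) 0, norm_zero]

theorem integral_abs_mul_eq (n : ℕ) {M : Type*} [EMetricSpace M] [CompactSpace M]
    [MeasurableSpace M] [BorelSpace M]
    [ChartedSpace (EuclideanSpace ℝ (Fin n)) M] [IsManifold (𝓡 n) ∞ M]
    [RiemannianBundle (fun x : M ↦ TangentSpace (𝓡 n) x)]
    [IsContMDiffRiemannianBundle (𝓡 n) ∞ (EuclideanSpace ℝ (Fin n))
      (fun x : M ↦ TangentSpace (𝓡 n) x)]
    [IsRiemannianManifold (𝓡 n) M] {lam : ℝ} {φ : M → ℝ} (hφ : ContMDiff (𝓡 n) 𝓘(ℝ, ℝ) 2 φ)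
    (heigen : ∀ x, laplacian n φ x = -lam ^ 2 * φ x) {f : M → ℝ}
      (hf : ContMDiff (𝓡 n) 𝓘(ℝ, ℝ) 2 f) :
    Integrable (fun x ↦ |φ x| * (laplacian n f x + lam ^ 2 * f x)) (volumeMeasure n M) ∧
      IntegrableOn (fun x ↦ ‖grad n φ x‖ * f x) (nodalSet φ) (surfaceMeasure n M) ∧
      ∫ x, |φ x| * (laplacian n f x + lam ^ 2 * f x) ∂(volumeMeasure n M) =
        2 * ∫ x in nodalSet φ, ‖grad n φ x‖ * f x ∂(surfaceMeasure n M) := by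
  refine ⟨integrable_of_continuous (hφ.continuous.abs.mul
    ((continuous_laplacian hf).add (continuous_const.mul hf.continuous))), ?_⟩
  rcases n with _ | m
  -- in dimension zero gradients and Laplacians vanish, hence so do both sides
  · have hz : ∀ x, |φ x| * (laplacian 0 f x + lam ^ 2 * f x) = 0 := fun x ↦ by
      have h1 := heigen x
      have h2 : ∀ f : M → ℝ, laplacian 0 f x = 0 := fun f ↦ by simp [laplacian]
      rw [h2, neg_mul, zero_eq_neg, mul_eq_zero] at h1
      rcases h1 with h1 | h1 <;> simp [h1, h2]
    simp [hz, grad_dim_zero, IntegrableOn]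
  · obtain ⟨h1, h2⟩ := integrableOn_and_integral_eq_nodalFlux hφ (hf.of_le (by norm_num))
    exact ⟨h1, by rw [h2, integral_abs_mul_laplacian_add lam hφ heigen hf]⟩

end RiemannianNodal

end

theorem mainTheorem12 (n : ℕ) {M : Type*} [EMetricSpace M] [CompactSpace M]
    [MeasurableSpace M] [BorelSpace M]
    [ChartedSpace (EuclideanSpace ℝ (Fin n)) M] [IsManifold (𝓡 n) ∞ M]
    [RiemannianBundle (fun x : M ↦ TangentSpace (𝓡 n) x)]
    [IsContMDiffRiemannianBundle (𝓡 n) ∞ (EuclideanSpace ℝ (Fin n))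
      (fun x : M ↦ TangentSpace (𝓡 n) x)]
    [IsRiemannianManifold (𝓡 n) M]
    (lam : ℝ) (φ : M → ℝ) (hφ : ContMDiff (𝓡 n) 𝓘(ℝ, ℝ) 2 φ)
    (heigen : ∀ x, RiemannianNodal.laplacian n φ x = -lam ^ 2 * φ x) :
    (∀ f : M → ℝ, ContMDiff (𝓡 n) 𝓘(ℝ, ℝ) 2 f →
      Integrable (fun x ↦ |φ x| * (RiemannianNodal.laplacian n f x + lam ^ 2 * f x))
        (RiemannianNodal.volumeMeasure n M) ∧
      IntegrableOn (fun x ↦ ‖RiemannianNodal.grad n φ x‖ * f x)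
        (RiemannianNodal.nodalSet φ) (RiemannianNodal.surfaceMeasure n M) ∧
      ∫ x, |φ x| * (RiemannianNodal.laplacian n f x + lam ^ 2 * f x)
          ∂(RiemannianNodal.volumeMeasure n M) =
        2 * ∫ x in RiemannianNodal.nodalSet φ, ‖RiemannianNodal.grad n φ x‖ * f x
          ∂(RiemannianNodal.surfaceMeasure n M)) ∧
    (Integrable (fun x ↦ |φ x|) (RiemannianNodal.volumeMeasure n M) ∧
      IntegrableOn (fun x ↦ ‖RiemannianNodal.grad n φ x‖)
        (RiemannianNodal.nodalSet φ) (RiemannianNodal.surfaceMeasure n M) ∧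
      lam ^ 2 * ∫ x, |φ x| ∂(RiemannianNodal.volumeMeasure n M) =
        2 * ∫ x in RiemannianNodal.nodalSet φ, ‖RiemannianNodal.grad n φ x‖
          ∂(RiemannianNodal.surfaceMeasure n M)) := by
  obtain ⟨-, h1, h2⟩ := RiemannianNodal.integral_abs_mul_eq n hφ heigen
    (contMDiff_const : ContMDiff (𝓡 n) 𝓘(ℝ, ℝ) 2 fun _ : M ↦ (1 : ℝ))
  simp only [RiemannianNodal.laplacian_const, zero_add, mul_one] at h1 h2
  rw [integral_mul_const, mul_comm] at h2
  exact ⟨fun f hf ↦ RiemannianNodal.integral_abs_mul_eq n hφ heigen hf,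
    RiemannianNodal.integrable_of_continuous hφ.continuous.abs, h1, h2⟩
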